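/- Let $F$ be a field. A quaternion algebra over $F$ is a central simple $F$-algebra of dimension $4$; let $x \mapsto \bar x$ be its standard involution, $\mathrm{nrd}(x)=x\bar x$ its reduced norm, and $B_0=\{x\in B : x+\bar x=0\}$, a $3$-dimensional $F$-vector space. A conic over $F$ is a plane curve $Q=0$ in $\mathbb{P}^2_F$, with $Q$ a homogeneous polynomial of degree $2$ over $F$, that is nonsingular (over an algebraic closure of $F$); isomorphisms of conics are isomorphisms of curves over $F$. (1) For every quaternion algebra $B$ over $F$, the equation $\mathrm{nrd}|_{B_0}=0$ in $\mathbb{P}(B_0)\cong\mathbb{P}^2_F$ defines a conic $C$ over $F$, and $B\mapsto C$ induces a bijection between the set of isomorphism classes of quaternion algebras over $F$ and the set of isomorphism classes of conics over $F$. (2) Suppose that $F$ is a computable field: elements of $F$ are represented by bit strings (every element by at least one, and the strings that represent an element form a recursively enumerable set), and there are algorithms for addition, subtraction, multiplication, division by nonzero elements, and testing whether an element is zero. Consider the following problems, in which tuples of elements of $F$ are given by tuples of bit strings. - $\mathsf{IsMatrixRing}$: given a quaternion algebra $B$ in standard form $\left(\frac{a,b}{F}\right)$ (that is, with basis $1,i,j,ij$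 such that $i^2=a$, $j^2=b$, $ji=-ij$ with $a,b\in F^\times$ if $\operatorname{char}F\ne 2$, and $i^2+i=a$, $j^2=b$, $ji=(i+1)j$ with $a\in F$, $b\in F^\times$ if $\operatorname{char}F=2$), specified by $(a,b)$, decide whether $B\cong M_2(F)$. - $\mathsf{ExhibitMatrixRing}$: given such $B$, decide whether $B\cong M_2(F)$ and, if so, output an $F$-algebra isomorphism $B \to M_2(F)$, specified by its matrix in the basis $1,i,j,ij$ of $B$ and the matrix units of $M_2(F)$. - $\mathsf{HasPoint}$: given a conic $C$ over $F$, specified by the six coefficients of an equation, decide whether $C(F)\neq\emptyset$. - $\mathsf{ExhibitPoint}$: given such $C$, decide whether $C(F)\ne\emptyset$ and, if so, output homogeneous coordinates of a point of $C(F)$. Then $\mathsf{IsMatrixRing}$ is equivalent to $\mathsf{HasPoint}$, and $\mathsf{ExhibitMatrixRing}$ is equivalent to $\mathsf{ExhibitPoint}$: each problem of a pair reduces to the other by a deterministic procedure (which transforms an instance of the one into an instance of the other and, for the $\mathsf{Exhibit}$ problems, transforms the original instance together with any correct answer to the new one into a correct answer to the original one) that consists of a fixed number of deterministic polynomial-time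 computations on bit strings and of calls to the given algorithms of $F$. If $F$ is polynomial-time computable, i.e. the algorithms of $F$ run in polynomial time in the bit size of the input, then all these reductions can be carried out by deterministic Turing machines in polynomial time. -/

import Mathlib

open scoped LinearAlgebra.Projectivization

universe u

section Quaternion

/-- A quaternion algebra over `F`: a central simple `F`-algebra of dimension `4`. -/
structure QuatAlg (F : Type u) [Field F] : Type (u + 1) where
  carrier : Type u
  [ring : Ring carrier]
  [algebra : Algebra F carrier]
  [central : Algebra.IsCentral F carrier]
  [simple : IsSimpleRing carrier]
  finrank_eq : Module.finrank F carrier = 4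

attribute [instance] QuatAlg.ring QuatAlg.algebra QuatAlg.central QuatAlg.simple

/-- Isomorphism of quaternion algebras: isomorphism of `F`-algebras. -/
instance quatAlgSetoid (F : Type u) [Field F] : Setoid (QuatAlg F) where
  r B B' := Nonempty (B.carrier ≃ₐ[F] B'.carrier)
  iseqv :=
    { refl := fun _ => ⟨AlgEquiv.refl⟩
      symm := fun ⟨e⟩ => ⟨e.symm⟩
      trans := fun ⟨e⟩ ⟨e'⟩ => ⟨e.trans e'⟩ }

/-- A standard involution: an `F`-linear involutive anti-automorphism with `x * σ x ∈ F`. -/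
structure IsStandardInvolution {F B : Type*} [Field F] [Ring B] [Algebra F B]
    (σ : B →ₗ[F] B) : Prop where
  map_one : σ 1 = 1
  map_mul : ∀ x y, σ (x * y) = σ y * σ x
  involutive : ∀ x, σ (σ x) = x
  standard : ∀ x, ∃ c : F, x * σ x = algebraMap F B c

/-- The subspace `B₀` of elements with `trd x = x + σ x = 0`. -/
def traceZero {F B : Type*} [Field F] [Ring B] [Algebra F B] (σ : B →ₗ[F] B) : Submodule F B :=
  LinearMap.ker (LinearMap.id + σ)

end Quaternion

section Conic

open MvPolynomial

/-- The ternary quadratic form `a x² + b y² + c z² + r yz + s xz + t xy`. -/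
@[ext]
structure TernaryForm (F : Type*) where
  a : F
  b : F
  c : F
  r : F
  s : F
  t : F

namespace TernaryForm

variable {F : Type*} [Field F]

/-- The form as a homogeneous polynomial of degree two. -/
noncomputable def poly (Q : TernaryForm F) : MvPolynomial (Fin 3) F :=
  C Q.a * X 0 ^ 2 + C Q.b * X 1 ^ 2 + C Q.c * X 2 ^ 2
    + C Q.r * (X 1 * X 2) + C Q.s * (X 0 * X 2) + C Q.t * (X 0 * X 1)

/-- The projective curve `Q = 0` is nonsingular (Jacobian criterion over an algebraic closure). -/
def Nonsingular (Q : TernaryForm F) : Prop :=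
  ∀ v : Fin 3 → AlgebraicClosure F, v ≠ 0 → aeval v Q.poly = 0 →
    ∃ i, aeval v (pderiv i Q.poly) ≠ 0

end TernaryForm

/-- A conic over `F`: a nonsingular plane curve `Q = 0` of degree two in `ℙ²` over `F`. -/
structure Conic (F : Type*) [Field F] where
  form : TernaryForm F
  nonsingular : form.Nonsingular

/-- The points of the conic with coordinates in an extension `K` of `F`. -/
def Conic.points {F : Type*} [Field F] (C : Conic F) (K : Type*) [Field K] [Algebra F K] :
    Set (ℙ K (Fin 3 → K)) :=
  {P | aeval P.rep C.form.poly = 0}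

/-- A map between the geometric points of two conics is a morphism of curves over `F` if around
every point it is given by homogeneous polynomials of the same degree with coefficients in `F`. -/
def IsConicMorphism {F : Type*} [Field F] {C D : Conic F}
    (φ : C.points (AlgebraicClosure F) → D.points (AlgebraicClosure F)) : Prop :=
  ∀ P : C.points (AlgebraicClosure F), ∃ (d : ℕ) (f : Fin 3 → MvPolynomial (Fin 3) F),
    (∀ i, (f i).IsHomogeneous d) ∧ (fun i => aeval P.1.rep (f i)) ≠ 0 ∧
    ∀ (R : C.points (AlgebraicClosure F)) (hR : (fun i => aeval R.1.rep (f i)) ≠ 0),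
      (φ R).1 = Projectivization.mk (AlgebraicClosure F) (fun i => aeval R.1.rep (f i)) hR

/-- Two conics are isomorphic if there are mutually inverse morphisms over `F` between them. -/
def Conic.Iso {F : Type*} [Field F] (C D : Conic F) : Prop :=
  ∃ φ : C.points (AlgebraicClosure F) ≃ D.points (AlgebraicClosure F),
    IsConicMorphism φ ∧ IsConicMorphism φ.symm

theorem aeval_smul_of_isHomogeneous {F K : Type*} [Field F] [Field K] [Algebra F K]
    {g : MvPolynomial (Fin 3) F} {d : ℕ} (hg : g.IsHomogeneous d) (c : K) (v : Fin 3 → K) :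
    aeval (c • v) g = c ^ d * aeval v g := by
  rw [aeval_def, aeval_def, eval₂_eq', eval₂_eq', Finset.mul_sum]
  refine Finset.sum_congr rfl fun m hm => ?_
  have h : ∑ i, m i = d := by
    have := hg (mem_support_iff.mp hm)
    rwa [Finsupp.weight_apply, Finsupp.sum_fintype _ _ (by simp), Finset.sum_congr rfl
      (fun i _ => by simp : ∀ i ∈ Finset.univ, m i • (1 : Fin 3 → ℕ) i = m i)] at this
  simp only [Pi.smul_apply, smul_eq_mul, mul_pow, Finset.prod_mul_distrib, Finset.prod_pow_eq_pow_sum,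
    h]
  ring

theorem isConicMorphism_id {F : Type*} [Field F] (C : Conic F) :
    IsConicMorphism (C := C) (D := C) id := by
  intro P
  refine ⟨1, X, fun i => isHomogeneous_X F i, ?_, fun R hR => ?_⟩
  · simpa using P.1.rep_nonzero
  · simp [Projectivization.mk_rep]

theorem IsConicMorphism.comp {F : Type*} [Field F] {C D E : Conic F}
    {ψ : D.points (AlgebraicClosure F) → E.points (AlgebraicClosure F)}
    {φ : C.points (AlgebraicClosure F) → D.points (AlgebraicClosure F)}
    (hψ : IsConicMorphism ψ) (hφ : IsConicMorphism φ) : IsConicMorphism (ψ ∘ φ) := by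
  intro P
  obtain ⟨d, f, hf, hfP, hfφ⟩ := hφ P
  obtain ⟨e, g, hg, hgP, hgψ⟩ := hψ (φ P)
  have key : ∀ (R : C.points (AlgebraicClosure F)) (i : Fin 3),
      aeval R.1.rep (aeval f (g i)) = aeval (fun j => aeval R.1.rep (f j)) (g i) := by
    intro R i
    rw [← AlgHom.comp_apply, comp_aeval]
  have rep : ∀ (R : C.points (AlgebraicClosure F)),
      (fun j => aeval R.1.rep (f j)) ≠ 0 → ∃ c : (AlgebraicClosure F), c ≠ 0 ∧
        ∀ i, aeval (φ R).1.rep (g i) = c ^ e * aeval (fun j => aeval R.1.rep (f j)) (g i) := by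
    intro R h
    obtain ⟨c, hc⟩ := Projectivization.exists_smul_eq_mk_rep (AlgebraicClosure F) _ h
    refine ⟨c, c.ne_zero, fun i => ?_⟩
    rw [hfφ R h, ← hc, Units.smul_def, aeval_smul_of_isHomogeneous (hg i)]
  refine ⟨d * e, fun i => aeval f (g i), fun i => (hg i).aeval f hf, ?_, fun R hR => ?_⟩
  · obtain ⟨c, -, hc⟩ := rep P hfP
    intro h0
    apply hgP
    funext i
    have := congrFun h0 i
    rw [key] at this
    simp [hc, this]
  · simp only [key] at hR ⊢
    by_cases h : (fun j => aeval R.1.rep (f j)) = 0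
    · have hz : ∀ i, aeval (fun j => aeval R.1.rep (f j)) (g i)
          = (0 : AlgebraicClosure F) ^ e * aeval (φ R).1.rep (g i) := by
        intro i
        rw [← aeval_smul_of_isHomogeneous (hg i), h, zero_smul]
      have he : e = 0 := by
        by_contra he
        exact hR (by funext i; simp [hz, he])
      subst he
      have hz' : (fun i => aeval (fun j => aeval R.1.rep (f j)) (g i))
          = fun i => aeval (φ R).1.rep (g i) := by
        funext i
        simp [hz]
      simp only [hz'] at hR ⊢
      exact hgψ (φ R) hR
    · obtain ⟨c, hc0, hc⟩ := rep R h
      have hR' : (fun i => aeval (φ R).1.rep (g i)) ≠ 0 := by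
        intro h0
        apply hR
        funext i
        have := congrFun h0 i
        rw [hc] at this
        simpa [hc0] using this
      rw [Function.comp_apply, hgψ (φ R) hR', Projectivization.mk_eq_mk_iff']
      exact ⟨c ^ e, by funext i; simp [hc]⟩

theorem conicIso_equivalence (F : Type*) [Field F] : Equivalence (Conic.Iso (F := F)) := by
  refine ⟨fun C => ?_, fun {C D} h => ?_, fun {C D E} h k => ?_⟩
  · exact ⟨Equiv.refl _, isConicMorphism_id C, isConicMorphism_id C⟩
  · obtain ⟨φ, h₁, h₂⟩ := h
    exact ⟨φ.symm, h₂, h₁⟩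
  · obtain ⟨φ, h₁, h₂⟩ := h
    obtain ⟨ψ, k₁, k₂⟩ := k
    refine ⟨φ.trans ψ, ?_, ?_⟩
    · rw [Equiv.coe_trans]
      exact k₁.comp h₁
    · rw [Equiv.symm_trans, Equiv.coe_trans]
      exact h₂.comp k₂

/-- Isomorphism of conics over `F`. -/
instance conicSetoid (F : Type*) [Field F] : Setoid (Conic F) where
  r := Conic.Iso
  iseqv := conicIso_equivalence F

/-- `C` is the conic `nrd₀ = 0` in `ℙ(B₀)`, written in the coordinates of some basis of `B₀`;
here `nrd x = x * σ x` for a standard involution `σ` of `B`. -/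
def IsNormConic {F : Type u} [Field F] (B : QuatAlg F) (C : Conic F) : Prop :=
  ∃ σ : B.carrier →ₗ[F] B.carrier, IsStandardInvolution σ ∧
    ∃ e : (Fin 3 → F) ≃ₗ[F] traceZero σ, ∀ v : Fin 3 → F,
      algebraMap F B.carrier (aeval v C.form.poly) = (e v : B.carrier) * σ (e v)

end Conic

section Algorithms

/-- The word over the alphabet `{0, 1, separator}` that represents a tuple of bit strings: every
entry is followed by a separator. -/
def tupleCode (ws : List (List Bool)) : List (Option Bool) :=
  ws.flatMap fun w => w.map some ++ [none]

/-- A function on tuples of bit strings that a (deterministic, multitape) Turing machine computes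
in polynomial time. -/
def PolyTime (f : List (List Bool) → List (List Bool)) : Prop :=
  Nonempty (Turing.TM2ComputableInPolyTime tupleCode tupleCode f)

/-- The structure of a computable field on `F`: elements are represented by bit strings (each
element by at least one, and the strings that represent something are recursively enumerable),
and there are algorithms for the four operations and for testing whether an element is zero.
Their output on strings that represent nothing, and that of a division by zero, is irrelevant. -/
structure ComputableField (F : Type*) [Field F] where
  decode : List Bool → Option F
  decode_surjective : ∀ x, ∃ w, decode w = some x
  re_codes : REPred fun w => (decode w).isSome = true
  add : List Bool → List Bool → List Bool
  sub : List Bool → List Bool → List Bool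
  mul : List Bool → List Bool → List Bool
  div : List Bool → List Bool → List Bool
  isZero : List Bool → Bool
  decode_add : ∀ u v x y, decode u = some x → decode v = some y → decode (add u v) = some (x + y)
  decode_sub : ∀ u v x y, decode u = some x → decode v = some y → decode (sub u v) = some (x - y)
  decode_mul : ∀ u v x y, decode u = some x → decode v = some y → decode (mul u v) = some (x * y)
  decode_div : ∀ u v x y, decode u = some x → decode v = some y → y ≠ 0 →
    decode (div u v) = some (x / y)
  isZero_iff : ∀ u x, decode u = some x → (isZero u = true ↔ x = 0)
  computable_add : Computable₂ add
  computable_sub : Computable₂ sub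
  computable_mul : Computable₂ mul
  computable_div : Computable₂ div
  computable_isZero : Computable isZero

namespace ComputableField

variable {F : Type*} [Field F] (E : ComputableField F)

/-- The algorithms of the field run in polynomial time (in the bit size of the input). -/
structure IsPolyTime : Prop where
  add : ∃ f, PolyTime f ∧
    ∀ u v x y, E.decode u = some x → E.decode v = some y → f [u, v] = [E.add u v]
  sub : ∃ f, PolyTime f ∧
    ∀ u v x y, E.decode u = some x → E.decode v = some y → f [u, v] = [E.sub u v]
  mul : ∃ f, PolyTime f ∧
    ∀ u v x y, E.decode u = some x → E.decode v = some y → f [u, v] = [E.mul u v]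
  div : ∃ f, PolyTime f ∧
    ∀ u v x y, E.decode u = some x → E.decode v = some y → y ≠ 0 → f [u, v] = [E.div u v]
  isZero : ∃ f, PolyTime f ∧ ∀ u x, E.decode u = some x → f [u] = [[E.isZero u]]

/-- A binary operation on bit strings as a subroutine acting on tuples. -/
def binary (op : List Bool → List Bool → List Bool) : List (List Bool) → List (List Bool)
  | [u, v] => [op u v]
  | _ => []

/-- A test on bit strings as a subroutine acting on tuples. -/
def test (p : List Bool → Bool) : List (List Bool) → List (List Bool)
  | [u] => [[p u]]
  | _ => []

/-- Functions computed by a deterministic procedure that consists of a fixed number of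
polynomial-time computations and of calls to the algorithms of the field. -/
inductive PolyTimeWithField : (List (List Bool) → List (List Bool)) → Prop
  | polyTime {f} : PolyTime f → PolyTimeWithField f
  | add : PolyTimeWithField (binary E.add)
  | sub : PolyTimeWithField (binary E.sub)
  | mul : PolyTimeWithField (binary E.mul)
  | div : PolyTimeWithField (binary E.div)
  | isZero : PolyTimeWithField (test E.isZero)
  | comp {f g} : PolyTimeWithField g → PolyTimeWithField f → PolyTimeWithField (g ∘ f)
  | append {f g} : PolyTimeWithField f → PolyTimeWithField g →
      PolyTimeWithField fun ws => f ws ++ g ws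

/-- The tuple `ws` of bit strings represents the tuple `xs` of elements of `F`. -/
def Represents (ws : List (List Bool)) (xs : List F) : Prop :=
  ws.map E.decode = xs.map some

end ComputableField

/-- A decision problem whose instances are (some) tuples of bit strings. -/
structure DecisionProblem where
  IsInstance : List (List Bool) → Prop
  Yes : List (List Bool) → Prop

/-- A search problem: `IsAnswer ws s` says that `s` is a correct answer to the instance `ws`. -/
structure SearchProblem where
  IsInstance : List (List Bool) → Prop
  IsAnswer : List (List Bool) → List (List Bool) → Prop

/-- Many-one reducibility by functions of the class `𝒞`. -/
def DecisionProblem.Reduces (𝒞 : (List (List Bool) → List (List Bool)) → Prop)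
    (A B : DecisionProblem) : Prop :=
  ∃ f, 𝒞 f ∧ ∀ ws, A.IsInstance ws → B.IsInstance (f ws) ∧ (A.Yes ws ↔ B.Yes (f ws))

/-- Reducibility of search problems by functions of the class `𝒞`: `f` turns an instance `ws`
into an instance of the other problem, and `g` turns `ws` followed by any correct answer to the
latter into a correct answer to `ws`. -/
def SearchProblem.Reduces (𝒞 : (List (List Bool) → List (List Bool)) → Prop)
    (A B : SearchProblem) : Prop :=
  ∃ f g, 𝒞 f ∧ 𝒞 g ∧ ∀ ws, A.IsInstance ws → B.IsInstance (f ws) ∧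
    ∀ s, B.IsAnswer (f ws) s → A.IsAnswer ws (g (ws ++ s))

/-- Each of the two decision problems reduces to the other. -/
def DecisionProblem.Equivalent (𝒞 : (List (List Bool) → List (List Bool)) → Prop)
    (A B : DecisionProblem) : Prop :=
  A.Reduces 𝒞 B ∧ B.Reduces 𝒞 A

/-- Each of the two search problems reduces to the other. -/
def SearchProblem.Equivalent (𝒞 : (List (List Bool) → List (List Bool)) → Prop)
    (A B : SearchProblem) : Prop :=
  A.Reduces 𝒞 B ∧ B.Reduces 𝒞 A

open Classical in
/-- The standard form `(a, b | F)`, with basis `1, i, j, ij` and `i² = a`, `j² = b`, `ji = -ij` if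
`char F ≠ 2`, and `i² = a + i`, `j² = b`, `ji = j - ij = (i + 1) j` if `char F = 2`. -/
noncomputable abbrev StdQuat {F : Type*} [Field F] (a b : F) : Type _ :=
  QuaternionAlgebra F a (if (2 : F) = 0 then 1 else 0) b

/-- The parameters for which `(a, b | F)` is a standard form of a quaternion algebra. -/
def IsStdParam {F : Type*} [Field F] (a b : F) : Prop :=
  b ≠ 0 ∧ ((2 : F) ≠ 0 → a ≠ 0)

/-- The basis `1, i, j, ij` of the standard form. -/
noncomputable def stdBasis {F : Type*} [Field F] (a b : F) : List (StdQuat a b) :=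
  [⟨1, 0, 0, 0⟩, ⟨0, 1, 0, 0⟩, ⟨0, 0, 1, 0⟩, ⟨0, 0, 0, 1⟩]

/-- The list of coefficients of a linear map from `(a, b | F)` to the `2 × 2` matrices, in the
basis `1, i, j, ij` and the basis of matrix units. -/
noncomputable def coefficients {F : Type*} [Field F] {a b : F}
    (φ : StdQuat a b ≃ₐ[F] Matrix (Fin 2) (Fin 2) F) : List F :=
  (stdBasis a b).flatMap fun x => [φ x 0 0, φ x 0 1, φ x 1 0, φ x 1 1]

/-- The list of coefficients of a ternary quadratic form. -/
def TernaryForm.coeffs {F : Type*} (Q : TernaryForm F) : List F :=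
  [Q.a, Q.b, Q.c, Q.r, Q.s, Q.t]

namespace ComputableField

variable {F : Type*} [Field F] (E : ComputableField F)

/-- Given a quaternion algebra in standard form, decide whether it is isomorphic to the matrix
ring. -/
def IsMatrixRing : DecisionProblem where
  IsInstance ws := ∃ a b : F, IsStdParam a b ∧ E.Represents ws [a, b]
  Yes ws := ∃ a b : F, E.Represents ws [a, b] ∧
    Nonempty (StdQuat a b ≃ₐ[F] Matrix (Fin 2) (Fin 2) F)

/-- Given a quaternion algebra in standard form, decide whether it is isomorphic to the matrix
ring and, if so, output an isomorphism. The empty tuple stands for the answer "no". -/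
def ExhibitMatrixRing : SearchProblem where
  IsInstance ws := ∃ a b : F, IsStdParam a b ∧ E.Represents ws [a, b]
  IsAnswer ws s := ∃ a b : F, E.Represents ws [a, b] ∧
    ((s = [] ∧ IsEmpty (StdQuat a b ≃ₐ[F] Matrix (Fin 2) (Fin 2) F)) ∨
      ∃ φ : StdQuat a b ≃ₐ[F] Matrix (Fin 2) (Fin 2) F, E.Represents s (coefficients φ))

/-- Given a conic, decide whether it has an `F`-rational point. -/
def HasPoint : DecisionProblem where
  IsInstance ws := ∃ C : Conic F, E.Represents ws C.form.coeffs
  Yes ws := ∃ C : Conic F, E.Represents ws C.form.coeffs ∧ (C.points F).Nonempty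

/-- Given a conic, decide whether it has an `F`-rational point and, if so, output (homogeneous
coordinates of) such a point. The empty tuple stands for the answer "no". -/
def ExhibitPoint : SearchProblem where
  IsInstance ws := ∃ C : Conic F, E.Represents ws C.form.coeffs
  IsAnswer ws s := ∃ C : Conic F, E.Represents ws C.form.coeffs ∧
    ((s = [] ∧ C.points F = ∅) ∨
      ∃ (v : Fin 3 → F) (hv : v ≠ 0), Projectivization.mk F v hv ∈ C.points F ∧
        E.Represents s [v 0, v 1, v 2])

end ComputableField

end Algorithms

/-!
The proof rests on the standard forms `(a, b | F)` and on their norm forms `normForm a b`, ternary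
forms that give the reduced norm on the elements of trace zero.

**The bijection.** Every quaternion algebra has a standard form (`QuatAlg.exists_standardForm`): by
Wedderburn's theorem it is a division algebra or `M₂(F)`, and in a division algebra of dimension
four every element is quadratic over the centre. The standard involution is unique, so that the norm
conic is determined by the algebra up to a linear change of variables
(`IsNormConic.exists_act_eq`). Every nonsingular ternary form becomes a multiple of some
`normForm a b` after an explicit change of variables (`TernaryForm.reduction`), which gives
surjectivity. For injectivity, an isomorphism of conics is first shown to come from a matrix over
`F` (`exists_matrix_of_iso`). Over a separable closure `L` both conics have the equation `y² = x z`,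
which is parametrized by `(1, t, t²)`; an isomorphism is then a rational function of `t` that
generates `L(t)`, hence a fractional linear transformation, and its symmetric square is a matrix that induces
the isomorphism. This matrix is unique up to a factor and the isomorphism is defined over `F`, so
that some multiple of the matrix is fixed by the Galois group. Finally, similar norm forms belong to
isomorphic algebras (`algEquiv_of_act_eq_smul`), because products of two elements of trace zero
generate the algebra and their relations can be read off from the norm form.

**The reductions.** A nontrivial zero of `normForm a b` gives, by explicit formulas, matrices that
satisfy the relations of `(a, b | F)` and hence an isomorphism with `M₂(F)` (`exists_splitting`).
Conversely, under such an isomorphism the elements of trace zero whose image has vanishing first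
column are isotropic, and form a line that is spanned by a cross product (`eval_splittingPoint`).
Together with the explicit reduction of a conic to a norm form, this describes all four reductions
by finitely many field operations and case distinctions on whether an element is zero.

Such expressions are computed by every class of functions on tuples of bit strings that contains the
polynomial-time functions and the algorithms of the field, and that is closed under composition and
joining of output tuples (`IsFieldClass`); case distinctions are made by deleting the output of the
wrong branch, which a finite-state transducer can do. Both classes of functions in the theorem have
these properties. For the polynomial-time functions this is a statement about Turing machines,
`PolyTime.comp` and `PolyTime.append`: two machines are run inside a larger one that copies tapes
between them, and the output of a machine is at most polynomially longer than its input.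
-/

/-! ### Running Turing machines inside larger ones -/

section Simulation

open Turing StateTransition Function

/-- `f`, iterated at most `n` times from `a`, arrives at `b`. -/
def ReachesWithin {σ : Type*} (f : σ → Option σ) (n : ℕ) (a b : σ) : Prop :=
  ∃ m ≤ n, (flip bind f)^[m] (some a) = some b

theorem ReachesWithin.single {σ : Type*} {f : σ → Option σ} {a b : σ} (h : f a = some b) :
    ReachesWithin f 1 a b :=
  ⟨1, le_rfl, h⟩

theorem ReachesWithin.trans {σ : Type*} {f : σ → Option σ} {n m : ℕ} {a b c : σ}
    (h : ReachesWithin f n a b) (h' : ReachesWithin f m b c) : ReachesWithin f (n + m) a c := by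
  obtain ⟨i, hi, hab⟩ := h
  obtain ⟨j, hj, hbc⟩ := h'
  exact ⟨j + i, by omega, by rw [iterate_add_apply, hab, hbc]⟩

theorem ReachesWithin.mono {σ : Type*} {f : σ → Option σ} {n m : ℕ} {a b : σ}
    (h : ReachesWithin f n a b) (hnm : n ≤ m) : ReachesWithin f m a b :=
  let ⟨i, hi, hab⟩ := h
  ⟨i, hi.trans hnm, hab⟩

theorem reachesWithin_iff_evalsToInTime {σ : Type*} {f : σ → Option σ} {n : ℕ} {a b : σ} :
    ReachesWithin f n a b ↔ Nonempty (EvalsToInTime f a (some b) n) :=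
  ⟨fun ⟨m, hm, h⟩ => ⟨⟨⟨m, h⟩, hm⟩⟩, fun ⟨h⟩ => ⟨h.steps, h.steps_le_m, h.evals_in_steps⟩⟩

variable {K K' : Type} [DecidableEq K] [DecidableEq K'] {Γ : K → Type} {Γ' : K' → Type}
  {Λ Λ' σ σ' : Type}

/-- The data needed to run a stack machine inside a larger one: its stacks, labels and states are
those of the larger machine, up to the given maps, and instead of halting it jumps to `exit`. -/
structure MachineEmbedding {K K' : Type} (Γ : K → Type) (Λ σ : Type) (Γ' : K' → Type)
    (Λ' σ' : Type) where
  stack : K → K'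
  stack_injective : Injective stack
  symbol : ∀ k, Γ k ≃ Γ' (stack k)
  label : Λ → Λ'
  exit : Λ'
  get : σ' → σ
  set : σ → σ' → σ'
  get_set : ∀ a v, get (set a v) = a
  set_set : ∀ a b v, set a (set b v) = set a v

namespace MachineEmbedding

variable (e : MachineEmbedding Γ Λ σ Γ' Λ' σ')

/-- The translation of the statements of the embedded machine. -/
def mapStmt : TM2.Stmt Γ Λ σ → TM2.Stmt Γ' Λ' σ'
  | .push k f q => .push (e.stack k) (fun v => e.symbol k (f (e.get v))) (mapStmt q)
  | .peek k f q =>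
    .peek (e.stack k) (fun v s => e.set (f (e.get v) (s.map (e.symbol k).symm)) v) (mapStmt q)
  | .pop k f q =>
    .pop (e.stack k) (fun v s => e.set (f (e.get v) (s.map (e.symbol k).symm)) v) (mapStmt q)
  | .load f q => .load (fun v => e.set (f (e.get v)) v) (mapStmt q)
  | .branch f q₁ q₂ => .branch (fun v => f (e.get v)) (mapStmt q₁) (mapStmt q₂)
  | .goto f => .goto fun v => e.label (f (e.get v))
  | .halt => .goto fun _ => e.exit

/-- The configuration `c'` of the larger machine shows `c` on the embedded part, and agrees with
`v₀` and `S₀` elsewhere. -/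
structure Shows (v₀ : σ') (S₀ : ∀ k, List (Γ' k)) (c : TM2.Cfg Γ Λ σ) (c' : TM2.Cfg Γ' Λ' σ') :
    Prop where
  label : c'.l = some (c.l.elim e.exit e.label)
  var : c'.var = e.set c.var v₀
  stack : ∀ k, c'.stk (e.stack k) = (c.stk k).map (e.symbol k)
  frame : ∀ k', (∀ k, e.stack k ≠ k') → c'.stk k' = S₀ k'

variable {e}

theorem shows_stepAux {v₀ : σ'} {S₀ : ∀ k, List (Γ' k)} (q : TM2.Stmt Γ Λ σ) :
    ∀ {v : σ} {S : ∀ k, List (Γ k)} {v' : σ'} {S' : ∀ k, List (Γ' k)}, v' = e.set v v₀ →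
      (∀ k, S' (e.stack k) = (S k).map (e.symbol k)) →
      (∀ k', (∀ k, e.stack k ≠ k') → S' k' = S₀ k') →
      e.Shows v₀ S₀ (TM2.stepAux q v S) (TM2.stepAux (e.mapStmt q) v' S') := by
  have upd : ∀ {S : ∀ k, List (Γ k)} {S' : ∀ k, List (Γ' k)} (k : K) (L : List (Γ k)),
      (∀ k, S' (e.stack k) = (S k).map (e.symbol k)) → ∀ j,
      update S' (e.stack k) (L.map (e.symbol k)) (e.stack j)
        = (update S k L j).map (e.symbol j) := by
    intro S S' k L h j
    by_cases hj : j = k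
    · subst hj; simp
    · rw [update_of_ne hj, update_of_ne (fun h => hj (e.stack_injective h)), h]
  have frm : ∀ {S' : ∀ k, List (Γ' k)} (k : K) (L : List (Γ' (e.stack k))),
      (∀ k', (∀ k, e.stack k ≠ k') → S' k' = S₀ k') →
      ∀ k', (∀ k, e.stack k ≠ k') → update S' (e.stack k) L k' = S₀ k' := by
    intro S' k L h k' hk'
    rw [update_of_ne (hk' k).symm, h k' hk']
  induction q with
  | push k f q ih =>
    intro v S v' S' hv hS hf
    simp only [mapStmt, TM2.stepAux]
    refine ih hv (fun j => ?_) (frm _ _ hf)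
    rw [← upd k (f v :: S k) hS j, hS k, hv, e.get_set, List.map_cons]
  | peek k f q ih =>
    intro v S v' S' hv hS hf
    simp only [mapStmt, TM2.stepAux]
    refine ih ?_ hS hf
    rw [hv, e.get_set, e.set_set, hS k, List.head?_map, Option.map_map]
    simp
  | pop k f q ih =>
    intro v S v' S' hv hS hf
    simp only [mapStmt, TM2.stepAux]
    refine ih ?_ (fun j => ?_) (frm _ _ hf)
    · rw [hv, e.get_set, e.set_set, hS k, List.head?_map, Option.map_map]
      simp
    · rw [← upd k (S k).tail hS j, hS k, List.map_tail]
  | load f q ih =>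
    intro v S v' S' hv hS hf
    simp only [mapStmt, TM2.stepAux]
    refine ih ?_ hS hf
    rw [hv, e.get_set, e.set_set]
  | branch f q₁ q₂ ih₁ ih₂ =>
    intro v S v' S' hv hS hf
    simp only [mapStmt, TM2.stepAux]
    rw [show f (e.get v') = f v by rw [hv, e.get_set]]
    cases f v
    · exact ih₂ hv hS hf
    · exact ih₁ hv hS hf
  | goto f =>
    intro v S v' S' hv hS hf
    simp only [mapStmt, TM2.stepAux]
    exact ⟨by simp [hv, e.get_set], hv, hS, hf⟩
  | halt =>
    intro v S v' S' hv hS hf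
    simp only [mapStmt, TM2.stepAux]
    exact ⟨rfl, hv, hS, hf⟩

/-- A run of the embedded machine is a run of the larger one, in the same number of steps. -/
theorem reachesWithin_of_shows {M : Λ → TM2.Stmt Γ Λ σ} {M' : Λ' → TM2.Stmt Γ' Λ' σ'}
    (hM : ∀ l, M' (e.label l) = e.mapStmt (M l)) {v₀ : σ'} {S₀ : ∀ k, List (Γ' k)} {n : ℕ}
    {c d : TM2.Cfg Γ Λ σ} {c' : TM2.Cfg Γ' Λ' σ'} (hc : e.Shows v₀ S₀ c c')
    (h : ReachesWithin (TM2.step M) n c d) :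
    ∃ d', ReachesWithin (TM2.step M') n c' d' ∧ e.Shows v₀ S₀ d d' := by
  obtain ⟨m, hm, h⟩ := h
  suffices ∃ d', (flip bind (TM2.step M'))^[m] (some c') = some d' ∧ e.Shows v₀ S₀ d d' by
    obtain ⟨d', h₁, h₂⟩ := this
    exact ⟨d', ⟨m, hm, h₁⟩, h₂⟩
  clear hm
  induction m generalizing c c' with
  | zero =>
    simp only [iterate_zero, id_eq, Option.some.injEq] at h
    subst h
    exact ⟨c', rfl, hc⟩
  | succ m ih =>
    have none_fix : ∀ m, (flip bind (TM2.step M))^[m] none = none := fun m =>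
      iterate_fixed rfl m
    rw [iterate_succ_apply] at h ⊢
    obtain ⟨l, v, S⟩ := c
    obtain ⟨l', v', S'⟩ := c'
    cases l with
    | none =>
      have : flip bind (TM2.step M) (some ⟨none, v, S⟩) = none := rfl
      rw [this, none_fix] at h
      exact absurd h (by simp)
    | some l =>
      have hl : l' = some (e.label l) := hc.label
      subst hl
      refine ih (c := TM2.stepAux (M l) v S) (c' := TM2.stepAux (M' (e.label l)) v' S') ?_ h
      rw [hM]
      exact shows_stepAux _ hc.var hc.stack hc.frame

end MachineEmbedding

/-- The number of `push` commands in a statement. -/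
def pushCount : TM2.Stmt Γ Λ σ → ℕ
  | .push _ _ q => pushCount q + 1
  | .peek _ _ q => pushCount q
  | .pop _ _ q => pushCount q
  | .load _ q => pushCount q
  | .branch _ q₁ q₂ => pushCount q₁ + pushCount q₂
  | .goto _ => 0
  | .halt => 0

theorem length_stepAux_le (k : K) (q : TM2.Stmt Γ Λ σ) (v : σ) (S : ∀ k, List (Γ k)) :
    ((TM2.stepAux q v S).stk k).length ≤ (S k).length + pushCount q := by
  induction q generalizing v S with
  | push j f q ih =>
    refine (ih _ _).trans ?_
    by_cases h : k = j
    · subst h; simp [pushCount]; omega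
    · simp [pushCount, update_of_ne h]
  | peek j f q ih => exact ih _ _
  | pop j f q ih =>
    refine (ih _ _).trans ?_
    by_cases h : k = j
    · subst h; simp [pushCount]
    · simp [pushCount, update_of_ne h]
  | load f q ih => exact ih _ _
  | branch f q₁ q₂ ih₁ ih₂ =>
    have h₁ := ih₁ v S
    have h₂ := ih₂ v S
    simp only [TM2.stepAux, pushCount]
    cases f v
    · exact h₂.trans (by omega)
    · exact h₁.trans (by omega)
  | goto f => simp [pushCount]
  | halt => simp [pushCount]

/-- The stacks of a machine grow at most linearly with the number of steps. -/
theorem length_stk_le_of_reachesWithin [Fintype Λ] {M : Λ → TM2.Stmt Γ Λ σ} {n : ℕ}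
    {c d : TM2.Cfg Γ Λ σ} (h : ReachesWithin (TM2.step M) n c d) (k : K) :
    (d.stk k).length ≤ (c.stk k).length + n * ∑ l, pushCount (M l) := by
  obtain ⟨m, hm, h⟩ := h
  suffices (d.stk k).length ≤ (c.stk k).length + m * ∑ l, pushCount (M l) from
    this.trans (by gcongr)
  clear hm
  induction m generalizing c with
  | zero =>
    simp only [iterate_zero, id_eq, Option.some.injEq] at h
    simp [h]
  | succ m ih =>
    rw [iterate_succ_apply] at h
    obtain ⟨l, v, S⟩ := c
    cases l with
    | none =>
      rw [show flip bind (TM2.step M) (some ⟨none, v, S⟩) = none from rfl,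
        iterate_fixed (f := flip bind (TM2.step M)) rfl m] at h
      exact absurd h (by simp)
    | some l =>
      have h₁ := ih h
      have h₂ := length_stepAux_le k (M l) v S
      have h₃ : pushCount (M l) ≤ ∑ l, pushCount (M l) :=
        Finset.single_le_sum (f := fun l => pushCount (M l)) (fun _ _ => Nat.zero_le _)
          (Finset.mem_univ l)
      simp only at h₁ h₂ ⊢
      rw [add_mul]
      omega

theorem initList_stk_self (tm : FinTM2) (s : List (tm.Γ tm.k₀)) :
    (initList tm s).stk tm.k₀ = s := by
  simp [initList]

theorem initList_stk_of_ne (tm : FinTM2) (s : List (tm.Γ tm.k₀)) {k : tm.K} (h : k ≠ tm.k₀) :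
    (initList tm s).stk k = [] := by
  simp [initList, h]

theorem haltList_stk_self (tm : FinTM2) (s : List (tm.Γ tm.k₁)) :
    (haltList tm s).stk tm.k₁ = s := by
  simp [haltList]

theorem haltList_stk_of_ne (tm : FinTM2) (s : List (tm.Γ tm.k₁)) {k : tm.K} (h : k ≠ tm.k₁) :
    (haltList tm s).stk k = [] := by
  simp [haltList, h]

end Simulation

/-! ### Polynomial time is closed under composition and concatenation -/

section Glue

open Turing StateTransition Function

variable {K : Type} [DecidableEq K] {Γ : K → Type} {Λ τ α : Type} [Inhabited α]

variable (Γ α) in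
/-- A stack whose symbols are identified with `α`. -/
structure Port where
  k : K
  symbol : Γ k ≃ α

/-- Push the symbol in the register on each of the given stacks. -/
def pushAll : List (Port Γ α) → TM2.Stmt Γ Λ (τ × Option α) → TM2.Stmt Γ Λ (τ × Option α)
  | [], q => q
  | t :: ts, q => .push t.k (fun v => t.symbol.symm (v.2.getD default)) (pushAll ts q)

/-- Move the contents of a stack, symbol by symbol, to each of the stacks `ts`, and continue at
`next`; `self` is the label of this command. -/
def moveStmt (src : Port Γ α) (ts : List (Port Γ α)) (self next : Λ) :
    TM2.Stmt Γ Λ (τ × Option α) :=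
  .pop src.k (fun v s => (v.1, s.map src.symbol))
    (.branch (fun v => v.2.isSome) (pushAll ts (.goto fun _ => self)) (.goto fun _ => next))

theorem stepAux_pushAll (ts : List (Port Γ α)) (hts : (ts.map Port.k).Nodup)
    (q : TM2.Stmt Γ Λ (τ × Option α)) (v : τ × Option α) (S : ∀ k, List (Γ k)) :
    ∃ S', TM2.stepAux (pushAll ts q) v S = TM2.stepAux q v S' ∧
      (∀ t ∈ ts, S' t.k = t.symbol.symm (v.2.getD default) :: S t.k) ∧
      ∀ k, k ∉ ts.map Port.k → S' k = S k := by
  induction ts generalizing S with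
  | nil => exact ⟨S, rfl, by simp, by simp⟩
  | cons t ts ih =>
    rw [List.map_cons, List.nodup_cons] at hts
    obtain ⟨S', h₁, h₂, h₃⟩ :=
      ih hts.2 (update S t.k (t.symbol.symm (v.2.getD default) :: S t.k))
    refine ⟨S', by rw [← h₁]; rfl, ?_, ?_⟩
    · intro u hu
      rcases List.mem_cons.1 hu with rfl | hu
      · rw [h₃ _ hts.1, update_self]
      · rw [h₂ u hu, update_of_ne]
        rintro h
        exact hts.1 (List.mem_map.2 ⟨u, hu, h⟩)
    · intro k hk
      rw [List.map_cons, List.mem_cons, not_or] at hk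
      rw [h₃ k hk.2, update_of_ne hk.1]

theorem reachesWithin_move {M : Λ → TM2.Stmt Γ Λ (τ × Option α)} {src : Port Γ α}
    {ts : List (Port Γ α)} {self next : Λ} (hM : M self = moveStmt src ts self next)
    (hsrc : src.k ∉ ts.map Port.k) (hts : (ts.map Port.k).Nodup) (L : List α) (v : τ)
    (r : Option α) (S : ∀ k, List (Γ k)) (hS : S src.k = L.map src.symbol.symm) :
    ∃ S', ReachesWithin (TM2.step M) (L.length + 1) ⟨some self, (v, r), S⟩
        ⟨some next, (v, none), S'⟩ ∧
      S' src.k = [] ∧ (∀ t ∈ ts, S' t.k = L.reverse.map t.symbol.symm ++ S t.k) ∧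
      ∀ k, k ≠ src.k → k ∉ ts.map Port.k → S' k = S k := by
  induction L generalizing S r with
  | nil =>
    refine ⟨S, .single ?_, hS, by simp, fun _ _ _ => rfl⟩
    have : update S src.k [] = S := by rw [← hS.trans (List.map_nil), update_eq_self]
    simp [hM, moveStmt, hS, this]
  | cons a L ih =>
    obtain ⟨S₁, h₁, h₂, h₃⟩ := stepAux_pushAll ts hts (.goto fun _ => self) (v, some a)
      (update S src.k (L.map src.symbol.symm))
    have hstep : TM2.step M ⟨some self, (v, r), S⟩ = some ⟨some self, (v, some a), S₁⟩ := by
      simp only [TM2.step, hM, moveStmt, TM2.stepAux, hS]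
      simpa using h₁
    have hsrc₁ : S₁ src.k = L.map src.symbol.symm := by rw [h₃ _ hsrc, update_self]
    obtain ⟨S', r₁, r₂, r₃, r₄⟩ := ih (some a) S₁ hsrc₁
    refine ⟨S', ?_, r₂, ?_, ?_⟩
    · have := (ReachesWithin.single hstep).trans r₁
      rwa [add_comm, ← List.length_cons (a := a)] at this
    · intro t ht
      have hne : t.k ≠ src.k := fun h => hsrc (h ▸ List.mem_map_of_mem ht)
      rw [r₃ t ht, h₂ t ht, update_of_ne hne]
      simp
    · intro k hk hk'
      rw [r₄ k hk hk', h₃ k hk', update_of_ne hk]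

/-- Moving a word reverses it: `T` is what the target stack held before. -/
theorem reachesWithin_move_one {M : Λ → TM2.Stmt Γ Λ (τ × Option α)} {src t : Port Γ α}
    {self next : Λ} (hM : M self = moveStmt src [t] self next) (hne : t.k ≠ src.k) (L T : List α)
    (v : τ) (S : ∀ k, List (Γ k)) (hS : S src.k = L.map src.symbol.symm)
    (hT : S t.k = T.map t.symbol.symm) :
    ∃ S', ReachesWithin (TM2.step M) (L.length + 1) ⟨some self, (v, none), S⟩
        ⟨some next, (v, none), S'⟩ ∧
      S' src.k = [] ∧ S' t.k = (L.reverse ++ T).map t.symbol.symm ∧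
      ∀ k, k ≠ src.k → k ≠ t.k → S' k = S k := by
  obtain ⟨S', h₁, h₂, h₃, h₄⟩ :=
    reachesWithin_move hM (by simpa using hne.symm) (by simp) L v none S hS
  exact ⟨S', h₁, h₂, by rw [h₃ t (by simp), hT, ← List.map_append],
    fun k h h' => h₄ k h (by simpa using h')⟩

variable (f g : FinTM2) (J P : Type)

/-- The alphabets of the stacks of two machines together with stacks `J` over
`{0, 1, separator}`. -/
def GlueSymbol : f.K ⊕ g.K ⊕ J → Type :=
  Sum.elim f.Γ (Sum.elim g.Γ fun _ => Option Bool)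

/-- The stacks of two machines together with additional ones, and a program that may call the
machines: its labels are the elements of `P`. When the two machines halt, the program continues at
`exitF` and `exitG`, respectively. -/
abbrev GlueStmt : Type :=
  TM2.Stmt (GlueSymbol f g J) (f.Λ ⊕ g.Λ ⊕ P) ((f.σ × g.σ) × Option (Option Bool))

variable {f g J P}

/-- The first machine as a part of the glued machine. -/
def embedLeft (exitF : f.Λ ⊕ g.Λ ⊕ P) : MachineEmbedding f.Γ f.Λ f.σ (GlueSymbol f g J)
    (f.Λ ⊕ g.Λ ⊕ P) ((f.σ × g.σ) × Option (Option Bool)) where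
  stack := Sum.inl
  stack_injective := Sum.inl_injective
  symbol k := Equiv.refl (f.Γ k)
  label := Sum.inl
  exit := exitF
  get v := v.1.1
  set a v := ((a, v.1.2), v.2)
  get_set _ _ := rfl
  set_set _ _ _ := rfl

/-- The second machine as a part of the glued machine. -/
def embedRight (exitG : f.Λ ⊕ g.Λ ⊕ P) : MachineEmbedding g.Γ g.Λ g.σ (GlueSymbol f g J)
    (f.Λ ⊕ g.Λ ⊕ P) ((f.σ × g.σ) × Option (Option Bool)) where
  stack k := Sum.inr (Sum.inl k)
  stack_injective := Sum.inr_injective.comp Sum.inl_injective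
  symbol k := Equiv.refl (g.Γ k)
  label l := Sum.inr (Sum.inl l)
  exit := exitG
  get v := v.1.2
  set a v := ((v.1.1, a), v.2)
  get_set _ _ := rfl
  set_set _ _ _ := rfl

/-- The commands of the glued machine. -/
def glueProgram [DecidableEq J] (exitF exitG : f.Λ ⊕ g.Λ ⊕ P) (phase : P → GlueStmt f g J P) :
    f.Λ ⊕ g.Λ ⊕ P → GlueStmt f g J P :=
  Sum.elim (fun l => (embedLeft exitF).mapStmt (f.m l))
    (Sum.elim (fun l => (embedRight exitG).mapStmt (g.m l)) phase)

/-- The glued machine, with input stack `k₀` and output stack `k₁`. -/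
def glueMachine [DecidableEq J] [Fintype J] [Fintype P] (k₀ k₁ : f.K ⊕ g.K ⊕ J)
    (fin : Fintype (GlueSymbol f g J k₀)) (main exitF exitG : f.Λ ⊕ g.Λ ⊕ P)
    (phase : P → GlueStmt f g J P) : FinTM2 :=
  letI := f.kFin
  letI := g.kFin
  letI := f.ΛFin
  letI := g.ΛFin
  letI := f.σFin
  letI := g.σFin
  { K := f.K ⊕ g.K ⊕ J
    k₀ := k₀
    k₁ := k₁
    Γ := GlueSymbol f g J
    Λ := f.Λ ⊕ g.Λ ⊕ P
    main := main
    σ := (f.σ × g.σ) × Option (Option Bool)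
    initialState := ((f.initialState, g.initialState), none)
    Γk₀Fin := fin
    m := glueProgram exitF exitG phase }

theorem reachesWithin_left [DecidableEq J] {exitF exitG : f.Λ ⊕ g.Λ ⊕ P}
    {phase : P → GlueStmt f g J P} {n : ℕ} {s : List (f.Γ f.k₀)} {s' : List (f.Γ f.k₁)}
    (h : ReachesWithin f.step n (initList f s) (haltList f s')) (b : g.σ)
    (r : Option (Option Bool)) (S : ∀ k, List (GlueSymbol f g J k)) (h₀ : S (Sum.inl f.k₀) = s)
    (h₁ : ∀ k, k ≠ f.k₀ → S (Sum.inl k) = []) :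
    ∃ S', ReachesWithin (TM2.step (glueProgram exitF exitG phase)) n
        ⟨some (Sum.inl f.main), ((f.initialState, b), r), S⟩
        ⟨some exitF, ((f.initialState, b), r), S'⟩ ∧
      S' (Sum.inl f.k₁) = s' ∧ (∀ k, k ≠ f.k₁ → S' (Sum.inl k) = []) ∧
      ∀ k, S' (Sum.inr k) = S (Sum.inr k) := by
  have hinit : (embedLeft exitF).Shows ((f.initialState, b), r) S (initList f s)
      ⟨some (Sum.inl f.main), ((f.initialState, b), r), S⟩ := by
    refine ⟨rfl, rfl, fun k => ?_, fun _ _ => rfl⟩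
    by_cases hk : k = f.k₀
    · subst hk
      rw [initList_stk_self]
      exact h₀.trans (List.map_id _).symm
    · rw [initList_stk_of_ne _ _ hk]
      exact h₁ k hk
  obtain ⟨⟨l', v', S'⟩, hr, hs⟩ := MachineEmbedding.reachesWithin_of_shows
    (M' := glueProgram exitF exitG phase) (fun l => rfl) hinit h
  refine ⟨S', ?_, ?_, fun k hk => ?_, fun k => ?_⟩
  · have hl : l' = some exitF := hs.label
    have hv : v' = ((f.initialState, b), r) := hs.var
    rwa [hl, hv] at hr
  · exact (hs.stack f.k₁).trans (by rw [haltList_stk_self]; exact List.map_id _)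
  · exact (hs.stack k).trans (by rw [haltList_stk_of_ne _ _ hk]; rfl)
  · exact hs.frame _ fun _ => Sum.inl_ne_inr

theorem reachesWithin_right [DecidableEq J] {exitF exitG : f.Λ ⊕ g.Λ ⊕ P}
    {phase : P → GlueStmt f g J P} {n : ℕ} {s : List (g.Γ g.k₀)} {s' : List (g.Γ g.k₁)}
    (h : ReachesWithin g.step n (initList g s) (haltList g s')) (b : f.σ)
    (r : Option (Option Bool)) (S : ∀ k, List (GlueSymbol f g J k))
    (h₀ : S (Sum.inr (Sum.inl g.k₀)) = s)
    (h₁ : ∀ k, k ≠ g.k₀ → S (Sum.inr (Sum.inl k)) = []) :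
    ∃ S', ReachesWithin (TM2.step (glueProgram exitF exitG phase)) n
        ⟨some (Sum.inr (Sum.inl g.main)), ((b, g.initialState), r), S⟩
        ⟨some exitG, ((b, g.initialState), r), S'⟩ ∧
      S' (Sum.inr (Sum.inl g.k₁)) = s' ∧ (∀ k, k ≠ g.k₁ → S' (Sum.inr (Sum.inl k)) = []) ∧
      (∀ k, S' (Sum.inl k) = S (Sum.inl k)) ∧
      ∀ k, S' (Sum.inr (Sum.inr k)) = S (Sum.inr (Sum.inr k)) := by
  have hinit : (embedRight exitG).Shows ((b, g.initialState), r) S (initList g s)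
      ⟨some (Sum.inr (Sum.inl g.main)), ((b, g.initialState), r), S⟩ := by
    refine ⟨rfl, rfl, fun k => ?_, fun _ _ => rfl⟩
    by_cases hk : k = g.k₀
    · subst hk
      rw [initList_stk_self]
      exact h₀.trans (List.map_id _).symm
    · rw [initList_stk_of_ne _ _ hk]
      exact h₁ k hk
  obtain ⟨⟨l', v', S'⟩, hr, hs⟩ := MachineEmbedding.reachesWithin_of_shows
    (M' := glueProgram exitF exitG phase) (fun l => rfl) hinit h
  refine ⟨S', ?_, ?_, fun k hk => ?_, fun k => ?_, fun k => ?_⟩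
  · have hl : l' = some exitG := hs.label
    have hv : v' = ((b, g.initialState), r) := hs.var
    rwa [hl, hv] at hr
  · exact (hs.stack g.k₁).trans (by rw [haltList_stk_self]; exact List.map_id _)
  · exact (hs.stack k).trans (by rw [haltList_stk_of_ne _ _ hk]; rfl)
  · exact hs.frame _ fun _ => Sum.inr_ne_inl
  · exact hs.frame _ fun _ h => Sum.inl_ne_inr (Sum.inr_injective h)

end Glue

section PolyTimeClosure

open Turing StateTransition Function

theorem Polynomial.eval_mono_nat (p : Polynomial ℕ) {m n : ℕ} (h : m ≤ n) :
    p.eval m ≤ p.eval n := by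
  rw [Polynomial.eval_eq_sum, Polynomial.eval_eq_sum, Polynomial.sum, Polynomial.sum]
  gcongr

theorem reachesWithin_of_polyTime {f : List (List Bool) → List (List Bool)}
    (hf : TM2ComputableInPolyTime tupleCode tupleCode f) (ws : List (List Bool)) :
    ReachesWithin hf.tm.step (hf.time.eval (tupleCode ws).length)
      (initList hf.tm ((tupleCode ws).map hf.inputAlphabet.symm))
      (haltList hf.tm ((tupleCode (f ws)).map hf.outputAlphabet.symm)) :=
  reachesWithin_iff_evalsToInTime.2 ⟨hf.outputsFun ws⟩

/-- The size of the output of a machine is bounded by that of the input plus a constant multiple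
of the running time. -/
theorem length_tupleCode_le {f : List (List Bool) → List (List Bool)}
    (hf : TM2ComputableInPolyTime tupleCode tupleCode f) :
    ∃ c, ∀ ws, (tupleCode (f ws)).length
      ≤ (tupleCode ws).length + hf.time.eval (tupleCode ws).length * c := by
  let _ := hf.tm.ΛFin
  refine ⟨∑ l, pushCount (hf.tm.m l), fun ws => ?_⟩
  have h := length_stk_le_of_reachesWithin (reachesWithin_of_polyTime hf ws) hf.tm.k₁
  rw [haltList_stk_self, List.length_map] at h
  refine h.trans (Nat.add_le_add_right ?_ _)
  by_cases hk : hf.tm.k₁ = hf.tm.k₀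
  · rw [hk, initList_stk_self, List.length_map]
  · rw [initList_stk_of_ne _ _ hk]
    exact Nat.zero_le _

/-- A machine that arrives in time at a halting configuration which shows the output, and nothing
else, on its stacks computes the function in polynomial time. -/
theorem polyTime_of_machine {f : List (List Bool) → List (List Bool)} (tm : FinTM2)
    (ei : tm.Γ tm.k₀ ≃ Option Bool) (eo : tm.Γ tm.k₁ ≃ Option Bool) (p : Polynomial ℕ)
    (h : ∀ ws, ∃ S : ∀ k, List (tm.Γ k),
      ReachesWithin tm.step (p.eval (tupleCode ws).length)
        (initList tm ((tupleCode ws).map ei.symm)) ⟨none, tm.initialState, S⟩ ∧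
      S tm.k₁ = (tupleCode (f ws)).map eo.symm ∧ ∀ k, k ≠ tm.k₁ → S k = []) : PolyTime f := by
  refine ⟨⟨⟨tm, ei, eo⟩, p, fun ws => ?_⟩⟩
  refine Classical.choice ?_
  obtain ⟨S, hS, h₁, h₂⟩ := h ws
  have hfinal : haltList tm ((tupleCode (f ws)).map eo.symm) = ⟨none, tm.initialState, S⟩ := by
    refine congrArg (TM2.Cfg.mk _ _) (funext fun k => ?_)
    by_cases hk : k = tm.k₁
    · subst hk
      exact (haltList_stk_self tm _).trans h₁.symm
    · exact (haltList_stk_of_ne tm _ hk).trans (h₂ k hk).symm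
  rw [← hfinal] at hS
  exact reachesWithin_iff_evalsToInTime.1 hS

/-- The machine for `f` is run, its output is moved to the input stack of the machine for `g` (by
way of an auxiliary stack, since moving reverses a word), and the latter is run. -/
theorem PolyTime.comp {f g : List (List Bool) → List (List Bool)} (hg : PolyTime g)
    (hf : PolyTime f) : PolyTime (g ∘ f) := by
  obtain ⟨hf⟩ := hf
  obtain ⟨hg⟩ := hg
  obtain ⟨c, hc⟩ := length_tupleCode_le hf
  let F := hf.tm
  let G := hg.tm
  let pF : Port (GlueSymbol F G Unit) (Option Bool) := ⟨Sum.inl F.k₁, hf.outputAlphabet⟩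
  let pG : Port (GlueSymbol F G Unit) (Option Bool) := ⟨Sum.inr (Sum.inl G.k₀), hg.inputAlphabet⟩
  let pT : Port (GlueSymbol F G Unit) (Option Bool) := ⟨Sum.inr (Sum.inr ()), Equiv.refl _⟩
  let lab : Fin 3 → F.Λ ⊕ G.Λ ⊕ Fin 3 := fun p => Sum.inr (Sum.inr p)
  let phase : Fin 3 → GlueStmt F G Unit (Fin 3) :=
    ![moveStmt pF [pT] (lab 0) (lab 1), moveStmt pT [pG] (lab 1) (Sum.inr (Sum.inl G.main)), .halt]
  refine polyTime_of_machine (glueMachine (J := Unit) (P := Fin 3) (Sum.inl F.k₀)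
    (Sum.inr (Sum.inl G.k₁)) F.Γk₀Fin (Sum.inl F.main) (lab 0) (lab 2) phase)
    hf.inputAlphabet hg.outputAlphabet
    (hf.time + 2 * (.X + hf.time * .C c + 1) + hg.time.comp (.X + hf.time * .C c) + 1)
    fun ws => ?_
  set M := glueProgram (lab 0) (lab 2) phase
  have hm := hc ws
  set I := initList (glueMachine (J := Unit) (P := Fin 3) (Sum.inl F.k₀) (Sum.inr (Sum.inl G.k₁))
    F.Γk₀Fin (Sum.inl F.main) (lab 0) (lab 2) phase) ((tupleCode ws).map hf.inputAlphabet.symm)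
  have I₀ : I.stk (Sum.inl F.k₀) = (tupleCode ws).map hf.inputAlphabet.symm :=
    initList_stk_self _ _
  have I₁ : ∀ k, k ≠ Sum.inl F.k₀ → I.stk k = [] := fun k hk => initList_stk_of_ne _ _ hk
  obtain ⟨S₁, r₁, a₁, b₁, c₁⟩ := reachesWithin_left (exitF := lab 0) (exitG := lab 2)
    (phase := phase) (reachesWithin_of_polyTime hf ws) G.initialState none I.stk I₀
    (fun k hk => I₁ _ (fun h => hk (Sum.inl_injective h)))
  obtain ⟨S₂, r₂, a₂, b₂, c₂⟩ := reachesWithin_move_one (M := M) (src := pF) (t := pT)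
    (self := lab 0) (next := lab 1) rfl Sum.inr_ne_inl (tupleCode (f ws)) []
    (F.initialState, G.initialState) S₁ a₁ ((c₁ _).trans (I₁ _ Sum.inr_ne_inl))
  obtain ⟨S₃, r₃, a₃, b₃, c₃⟩ := reachesWithin_move_one (M := M) (src := pT) (t := pG)
    (self := lab 1) (next := Sum.inr (Sum.inl G.main)) rfl (by simp [pG, pT])
    ((tupleCode (f ws)).reverse ++ []) [] (F.initialState, G.initialState) S₂ b₂
    (((c₂ pG.k Sum.inr_ne_inl (by simp [pG, pT])).trans (c₁ _)).trans (I₁ _ Sum.inr_ne_inl))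
  rw [List.append_nil, List.append_nil, List.reverse_reverse] at b₃
  obtain ⟨S₄, r₄, a₄, b₄, c₄, d₄⟩ := reachesWithin_right (exitF := lab 0) (exitG := lab 2)
    (phase := phase) (reachesWithin_of_polyTime hg (f ws)) F.initialState none S₃ b₃
    (fun k hk => by
      have hk' : (Sum.inr (Sum.inl k) : F.K ⊕ G.K ⊕ Unit) ≠ pG.k := by simpa [pG] using hk
      rw [c₃ _ (by simp [pT]) hk', c₂ _ (by simp [pF]) (by simp [pT]), c₁, I₁ _ (by simp)]
      rfl)
  have r₅ : ReachesWithin (TM2.step M) 1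
      ⟨some (lab 2), ((F.initialState, G.initialState), none), S₄⟩
      ⟨none, ((F.initialState, G.initialState), none), S₄⟩ := .single rfl
  refine ⟨S₄, ((((r₁.trans r₂).trans r₃).trans r₄).trans r₅).mono ?_, a₄, ?_⟩
  · have := hg.time.eval_mono_nat hm
    simp only [Polynomial.eval_add, Polynomial.eval_mul, Polynomial.eval_comp, Polynomial.eval_X,
      Polynomial.eval_C, Polynomial.eval_one, Polynomial.eval_ofNat, List.length_reverse,
      List.append_nil] at this ⊢
    omega
  · rintro (k | k | k) hk
    · rw [c₄]
      by_cases h : k = F.k₁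
      · subst h
        exact (c₃ _ Sum.inl_ne_inr Sum.inl_ne_inr).trans a₂
      · rw [c₃ _ (by simp [pT]) (by simp [pG]), c₂ _ (by simpa [pF] using h) (by simp [pT]), b₁ k h]
        rfl
    · exact b₄ k fun h => hk (by rw [h]; rfl)
    · rw [d₄]
      exact a₃

/-- The input is copied to the input stacks of both machines, which are run one after the other;
then both outputs are moved to the output stack, that of `g` first. -/
theorem PolyTime.append {f g : List (List Bool) → List (List Bool)} (hf : PolyTime f)
    (hg : PolyTime g) : PolyTime fun ws => f ws ++ g ws := by
  obtain ⟨hf⟩ := hf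
  obtain ⟨hg⟩ := hg
  obtain ⟨c, hc⟩ := length_tupleCode_le hf
  obtain ⟨d, hd⟩ := length_tupleCode_le hg
  let F := hf.tm
  let G := hg.tm
  let f₀ : Port (GlueSymbol F G (Fin 4)) (Option Bool) := ⟨Sum.inl F.k₀, hf.inputAlphabet⟩
  let f₁ : Port (GlueSymbol F G (Fin 4)) (Option Bool) := ⟨Sum.inl F.k₁, hf.outputAlphabet⟩
  let g₀ : Port (GlueSymbol F G (Fin 4)) (Option Bool) := ⟨Sum.inr (Sum.inl G.k₀), hg.inputAlphabet⟩
  let g₁ : Port (GlueSymbol F G (Fin 4)) (Option Bool) :=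
    ⟨Sum.inr (Sum.inl G.k₁), hg.outputAlphabet⟩
  -- The additional stacks: input, two auxiliary ones, and output.
  let aux : Fin 4 → Port (GlueSymbol F G (Fin 4)) (Option Bool) :=
    fun j => ⟨Sum.inr (Sum.inr j), Equiv.refl _⟩
  let lab : Fin 8 → F.Λ ⊕ G.Λ ⊕ Fin 8 := fun p => Sum.inr (Sum.inr p)
  let phase : Fin 8 → GlueStmt F G (Fin 4) (Fin 8) :=
    ![moveStmt (aux 0) [aux 1, aux 2] (lab 0) (lab 1),
      moveStmt (aux 1) [f₀] (lab 1) (lab 2),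
      moveStmt (aux 2) [g₀] (lab 2) (Sum.inl F.main),
      moveStmt g₁ [aux 1] (lab 3) (lab 4),
      moveStmt (aux 1) [aux 3] (lab 4) (lab 5),
      moveStmt f₁ [aux 1] (lab 5) (lab 6),
      moveStmt (aux 1) [aux 3] (lab 6) (lab 7),
      .halt]
  refine polyTime_of_machine (glueMachine (J := Fin 4) (P := Fin 8) (Sum.inr (Sum.inr 0))
    (Sum.inr (Sum.inr 3)) (inferInstanceAs (Fintype (Option Bool))) (lab 0)
    (Sum.inr (Sum.inl G.main)) (lab 3) phase) (Equiv.refl _) (Equiv.refl _)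
    (3 * (.X + 1) + hf.time + hg.time + 2 * (.X + hg.time * .C d + 1)
      + 2 * (.X + hf.time * .C c + 1) + 1)
    fun ws => ?_
  set M := glueProgram (Sum.inr (Sum.inl G.main)) (lab 3) phase
  set I := initList (glueMachine (J := Fin 4) (P := Fin 8) (Sum.inr (Sum.inr 0))
    (Sum.inr (Sum.inr 3)) (inferInstanceAs (Fintype (Option Bool))) (lab 0)
    (Sum.inr (Sum.inl G.main)) (lab 3) phase) ((tupleCode ws).map (Equiv.refl _).symm)
  let v := (F.initialState, G.initialState)
  have I₀ : I.stk (aux 0).k = (tupleCode ws).map (aux 0).symbol.symm := initList_stk_self _ _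
  have I₁ : ∀ k, k ≠ (aux 0).k → I.stk k = [] := fun k hk => initList_stk_of_ne _ _ hk
  have aux_ne : ∀ {i j : Fin 4}, i ≠ j → (aux i).k ≠ (aux j).k := fun h => by simpa [aux] using h
  have ne_aux : ∀ (k : F.K) (j : Fin 4), (Sum.inl k : F.K ⊕ G.K ⊕ Fin 4) ≠ (aux j).k :=
    fun k j => Sum.inl_ne_inr
  have ne_aux' : ∀ (k : G.K) (j : Fin 4), (Sum.inr (Sum.inl k) : F.K ⊕ G.K ⊕ Fin 4) ≠ (aux j).k :=
    fun k j => by simp [aux]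
  have ne_right : ∀ (k : F.K) (l : G.K ⊕ Fin 4), (Sum.inl k : F.K ⊕ G.K ⊕ Fin 4) ≠ Sum.inr l :=
    fun k l => Sum.inl_ne_inr
  obtain ⟨S₁, r₁, a₁, b₁, c₁⟩ := reachesWithin_move (M := M) (src := aux 0)
    (ts := [aux 1, aux 2]) (self := lab 0) (next := lab 1) rfl (by simp [aux]) (by simp [aux])
    (tupleCode ws) v none I.stk I₀
  replace c₁ : ∀ k, k ≠ (aux 0).k → k ≠ (aux 1).k → k ≠ (aux 2).k → S₁ k = [] :=
    fun k h₀ h₁ h₂ => (c₁ k h₀ (by simpa using ⟨h₁, h₂⟩)).trans (I₁ k h₀)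
  have b₁₁ : S₁ (aux 1).k = (tupleCode ws).reverse.map (aux 1).symbol.symm := by
    rw [b₁ _ (by simp), I₁ _ (aux_ne (by decide))]
    exact List.append_nil _
  have b₁₂ : S₁ (aux 2).k = (tupleCode ws).reverse.map (aux 2).symbol.symm := by
    rw [b₁ _ (by simp), I₁ _ (aux_ne (by decide))]
    exact List.append_nil _
  obtain ⟨S₂, r₂, a₂, b₂, c₂⟩ := reachesWithin_move_one (M := M) (src := aux 1) (t := f₀)
    (self := lab 1) (next := lab 2) rfl (ne_aux _ _) (tupleCode ws).reverse [] v S₁ b₁₁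
    (c₁ _ (ne_aux _ _) (ne_aux _ _) (ne_aux _ _))
  obtain ⟨S₃, r₃, a₃, b₃, c₃⟩ := reachesWithin_move_one (M := M) (src := aux 2) (t := g₀)
    (self := lab 2) (next := Sum.inl F.main) rfl (ne_aux' _ _) (tupleCode ws).reverse [] v S₂
    ((c₂ _ (aux_ne (by decide)) (ne_aux _ _).symm).trans b₁₂)
    ((c₂ _ (ne_aux' _ _) (ne_right _ _).symm).trans
      (c₁ _ (ne_aux' _ _) (ne_aux' _ _) (ne_aux' _ _)))
  rw [List.append_nil, List.reverse_reverse] at b₂ b₃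
  obtain ⟨S₄, r₄, a₄, b₄, c₄⟩ := reachesWithin_left (exitF := Sum.inr (Sum.inl G.main))
    (exitG := lab 3) (phase := phase) (reachesWithin_of_polyTime hf ws) G.initialState none S₃
    ((c₃ _ (ne_aux _ _) (ne_right _ _)).trans b₂)
    (fun k hk => (c₃ _ (ne_aux _ _) (ne_right _ _)).trans
      ((c₂ _ (ne_aux _ _) (fun h => hk (Sum.inl_injective h))).trans
        (c₁ _ (ne_aux _ _) (ne_aux _ _) (ne_aux _ _))))
  obtain ⟨S₅, r₅, a₅, b₅, c₅, d₅⟩ := reachesWithin_right (exitF := Sum.inr (Sum.inl G.main))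
    (exitG := lab 3) (phase := phase) (reachesWithin_of_polyTime hg ws) F.initialState none S₄
    ((c₄ _).trans b₃)
    (fun k hk => (c₄ _).trans ((c₃ _ (ne_aux' _ _) (by simpa [g₀] using hk)).trans
      ((c₂ _ (ne_aux' _ _) (ne_right _ _).symm).trans
        (c₁ _ (ne_aux' _ _) (ne_aux' _ _) (ne_aux' _ _)))))
  have e₅ : ∀ j, j ≠ 1 → j ≠ 2 → S₅ (aux j).k = [] := fun j h₁ h₂ =>
    (d₅ j).trans ((c₄ _).trans ((c₃ _ (aux_ne h₂) (ne_aux' _ _).symm).trans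
      ((c₂ _ (aux_ne h₁) (ne_aux _ _).symm).trans (by
        by_cases h₀ : j = 0
        · subst h₀; exact a₁
        · exact c₁ _ (aux_ne h₀) (aux_ne h₁) (aux_ne h₂)))))
  have e₅₁ : S₅ (aux 1).k = [] :=
    (d₅ 1).trans ((c₄ _).trans ((c₃ _ (aux_ne (by decide)) (ne_aux' _ _).symm).trans a₂))
  have e₅₂ : S₅ (aux 2).k = [] := (d₅ 2).trans ((c₄ _).trans a₃)
  obtain ⟨S₆, r₆, a₆, b₆, c₆⟩ := reachesWithin_move_one (M := M) (src := g₁) (t := aux 1)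
    (self := lab 3) (next := lab 4) rfl (ne_aux' _ _).symm (tupleCode (g ws)) [] v S₅ a₅ e₅₁
  obtain ⟨S₇, r₇, a₇, b₇, c₇⟩ := reachesWithin_move_one (M := M) (src := aux 1) (t := aux 3)
    (self := lab 4) (next := lab 5) rfl (aux_ne (by decide)) _ [] v S₆ b₆
    ((c₆ _ (ne_aux' _ _).symm (aux_ne (by decide))).trans (e₅ 3 (by decide) (by decide)))
  obtain ⟨S₈, r₈, a₈, b₈, c₈⟩ := reachesWithin_move_one (M := M) (src := f₁) (t := aux 1)
    (self := lab 5) (next := lab 6) rfl (ne_aux _ _).symm (tupleCode (f ws)) [] v S₇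
    ((c₇ _ (ne_aux _ _) (ne_aux _ _)).trans ((c₆ _ (ne_right _ _) (ne_aux _ _)).trans
      ((c₅ _).trans a₄))) a₇
  obtain ⟨S₉, r₉, a₉, b₉, c₉⟩ := reachesWithin_move_one (M := M) (src := aux 1) (t := aux 3)
    (self := lab 6) (next := lab 7) rfl (aux_ne (by decide)) _ _ v S₈ b₈
    ((c₈ _ (ne_aux _ _).symm (aux_ne (by decide))).trans b₇)
  have hhalt : ReachesWithin (TM2.step M) 1 ⟨some (lab 7), (v, none), S₉⟩ ⟨none, (v, none), S₉⟩ :=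
    .single rfl
  refine ⟨S₉, (((((((((r₁.trans r₂).trans r₃).trans r₄).trans r₅).trans r₆).trans r₇).trans
    r₈).trans r₉).trans hhalt).mono ?_, b₉.trans ?_, ?_⟩
  · have hc := hc ws
    have hd := hd ws
    simp only [Polynomial.eval_add, Polynomial.eval_mul, Polynomial.eval_X, Polynomial.eval_C,
      Polynomial.eval_one, Polynomial.eval_ofNat, List.length_reverse, List.append_nil]
    omega
  · simp [tupleCode]
    rfl
  · have h₉ : ∀ k, k ≠ (aux 1).k → k ≠ (aux 3).k → k ≠ f₁.k → k ≠ g₁.k → S₉ k = S₅ k :=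
      fun k h₁ h₃ hf hg => (c₉ k h₁ h₃).trans ((c₈ k hf h₁).trans ((c₇ k h₁ h₃).trans (c₆ k hg h₁)))
    rintro (k | k | k) hk
    · by_cases h : k = F.k₁
      · subst h
        exact (c₉ _ (ne_aux _ _) (ne_aux _ _)).trans a₈
      · exact (h₉ _ (ne_aux _ _) (ne_aux _ _) (by simpa [f₁] using h) (ne_right _ _)).trans
          ((c₅ _).trans (b₄ k h))
    · by_cases h : k = G.k₁
      · subst h
        exact (c₉ _ (ne_aux' _ _) (ne_aux' _ _)).trans ((c₈ _ (ne_right _ _).symm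
          (ne_aux' _ _)).trans ((c₇ _ (ne_aux' _ _) (ne_aux' _ _)).trans a₆))
      · exact (h₉ _ (ne_aux' _ _) (ne_aux' _ _) (ne_right _ _).symm (by simpa [g₁] using h)).trans
          (b₅ k h)
    · by_cases h₁ : k = 1
      · subst h₁; exact a₉
      · have h₃ : k ≠ 3 := fun h => hk (by rw [h]; rfl)
        refine (h₉ _ (aux_ne h₁) (aux_ne h₃) (ne_aux _ _).symm (ne_aux' _ _).symm).trans ?_
        by_cases h₂ : k = 2
        · subst h₂; exact e₅₂
        · exact e₅ k h₁ h₂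

end PolyTimeClosure

/-! ### Finite-state transducers run in polynomial time -/

section Transducers

open Turing StateTransition Function

/-- A finite-state transducer: a word is read symbol by symbol, each step emits at most one symbol,
and at the end a word of fixed length, depending on the state, is emitted. -/
structure Transducer (Q : Type) where
  start : Q
  next : Q → Option Bool → Q
  emit : Q → Option Bool → Option (Option Bool)
  final : List (Q → Option Bool)

namespace Transducer

variable {Q : Type} (T : Transducer Q)

/-- The output of a transducer on a word, from a given state. -/
def run : Q → List (Option Bool) → List (Option Bool)
  | q, [] => T.final.map fun a => a q
  | q, a :: l => (T.emit q a).toList ++ run (T.next q a) l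

/-- Push the final word of a transducer. -/
def pushFinal (fs : List (Q → Option Bool))
    (q : TM2.Stmt (fun _ : Fin 3 => Option Bool) (Fin 3) ((Q × Bool) × Option (Option Bool))) :
    TM2.Stmt (fun _ : Fin 3 => Option Bool) (Fin 3) ((Q × Bool) × Option (Option Bool)) :=
  fs.foldr (fun a q => .push 1 (fun v => a v.1.1) q) q

/-- The commands of a machine that runs a transducer, with an input stack, a stack that collects
the output in reverse order, and an output stack. The flag of the state records that the input has
been read. -/
def program : Fin 3 →
    TM2.Stmt (fun _ : Fin 3 => Option Bool) (Fin 3) ((Q × Bool) × Option (Option Bool)) :=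
  ![.pop 0 (fun v s => s.elim ((v.1.1, true), none)
        fun a => ((T.next v.1.1 a, false), T.emit v.1.1 a))
      (.branch (fun v => v.1.2)
        (pushFinal T.final (.load (fun _ => ((T.start, false), none)) (.goto fun _ => 1)))
        (.branch (fun v => v.2.isSome) (.push 1 (fun v => v.2.getD default) (.goto fun _ => 0))
          (.goto fun _ => 0))),
    moveStmt ⟨1, Equiv.refl _⟩ [⟨2, Equiv.refl _⟩] 1 2,
    .halt]

theorem stepAux_pushFinal (fs : List (Q → Option Bool))
    (q : TM2.Stmt (fun _ : Fin 3 => Option Bool) (Fin 3) ((Q × Bool) × Option (Option Bool)))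
    (v : (Q × Bool) × Option (Option Bool)) (x y z : List (Option Bool)) :
    TM2.stepAux (pushFinal fs q) v ![x, y, z]
      = TM2.stepAux q v ![x, (fs.map fun a => a v.1.1).reverse ++ y, z] := by
  induction fs generalizing y with
  | nil => rfl
  | cons a fs ih =>
    have : update ![x, y, z] 1 (a v.1.1 :: y) = ![x, a v.1.1 :: y, z] := by
      ext i; fin_cases i <;> rfl
    simp only [pushFinal, List.foldr_cons, TM2.stepAux, Matrix.cons_val_one,
      Matrix.cons_val_zero] at ih ⊢
    rw [this, ih]
    simp

theorem reachesWithin_run (q : Q) (r : Option (Option Bool)) (l y : List (Option Bool)) :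
    ReachesWithin (TM2.step T.program) (l.length + 1) ⟨some 0, ((q, false), r), ![l, y, []]⟩
      ⟨some 1, ((T.start, false), none), ![[], (T.run q l).reverse ++ y, []]⟩ := by
  induction l generalizing q r y with
  | nil =>
    have : update ![[], y, []] 0 [] = ![([] : List (Option Bool)), y, []] := by
      ext i; fin_cases i <;> rfl
    refine .single ?_
    simp [program, run, this, stepAux_pushFinal]
  | cons a l ih =>
    have h₀ : update ![a :: l, y, []] 0 l = ![l, y, []] := by
      ext i; fin_cases i <;> rfl
    have h₁ : ∀ b, update ![l, y, []] 1 (b :: y) = ![l, b :: y, []] := by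
      intro b; ext i; fin_cases i <;> rfl
    have key : TM2.step T.program ⟨some 0, ((q, false), r), ![a :: l, y, []]⟩
        = some ⟨some 0, ((T.next q a, false), T.emit q a), ![l, (T.emit q a).toList ++ y, []]⟩ := by
      cases h : T.emit q a <;> simp [program, h, h₀, h₁]
    have := (ReachesWithin.single key).trans
      (ih (T.next q a) (T.emit q a) ((T.emit q a).toList ++ y))
    rw [List.length_cons, add_comm (l.length + 1), run, List.reverse_append, List.append_assoc]
    cases h : T.emit q a <;> simpa [h] using this

theorem length_run_le (q : Q) (l : List (Option Bool)) :
    (T.run q l).length ≤ l.length + T.final.length := by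
  induction l generalizing q with
  | nil => simp [run]
  | cons a l ih =>
    have := ih (T.next q a)
    cases h : T.emit q a <;> simp [run, h] <;> omega

/-- The machine that runs a transducer. -/
def machine [Fintype Q] : FinTM2 where
  K := Fin 3
  k₀ := 0
  k₁ := 2
  Γ := fun _ => Option Bool
  Λ := Fin 3
  main := (0 : Fin 3)
  σ := (Q × Bool) × Option (Option Bool)
  initialState := ((T.start, false), none)
  m := T.program

/-- A function on tuples that a transducer computes is computed in polynomial time. -/
theorem polyTime [Fintype Q] {f : List (List Bool) → List (List Bool)}
    (h : ∀ ws, T.run T.start (tupleCode ws) = tupleCode (f ws)) : PolyTime f := by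
  refine polyTime_of_machine T.machine (Equiv.refl _) (Equiv.refl _)
    (.X + 1 + (.X + .C T.final.length + 1) + 1) fun ws => ?_
  have hinit : initList T.machine (tupleCode ws)
      = (⟨some 0, ((T.start, false), none), ![tupleCode ws, [], []]⟩ :
        TM2.Cfg (fun _ : Fin 3 => Option Bool) (Fin 3) ((Q × Bool) × Option (Option Bool))) := by
    refine congrArg (TM2.Cfg.mk _ _) (funext fun (k : Fin 3) => ?_)
    fin_cases k
    · exact initList_stk_self T.machine (tupleCode ws)
    · exact initList_stk_of_ne T.machine (tupleCode ws) (by decide : (1 : Fin 3) ≠ 0)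
    · exact initList_stk_of_ne T.machine (tupleCode ws) (by decide : (2 : Fin 3) ≠ 0)
  replace hinit := (congrArg (initList T.machine) (List.map_id (tupleCode ws))).trans hinit
  have h₁ := T.reachesWithin_run T.start none (tupleCode ws) []
  rw [h, List.append_nil] at h₁
  obtain ⟨S, h₂, h₃, h₄, h₅⟩ := reachesWithin_move_one (M := T.program)
    (src := ⟨1, Equiv.refl (Option Bool)⟩) (t := ⟨2, Equiv.refl (Option Bool)⟩)
    (self := 1) (next := 2) rfl (by decide) (tupleCode (f ws)).reverse [] (T.start, false)
    ![[], (tupleCode (f ws)).reverse, []] (by simp) (by simp)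
  have h₆ : ReachesWithin (TM2.step T.program) 1 ⟨some 2, ((T.start, false), none), S⟩
      ⟨none, ((T.start, false), none), S⟩ := .single rfl
  refine ⟨S, ?_, ?_, ?_⟩
  · have hl := T.length_run_le T.start (tupleCode ws)
    rw [h] at hl
    refine (congrArg (fun c => ReachesWithin T.machine.step _ c _) hinit).mpr
      (((h₁.trans h₂).trans h₆).mono ?_)
    simp
    omega
  · refine h₄.trans ?_
    rw [List.append_nil, List.reverse_reverse]
    rfl
  · intro (k : Fin 3) hk
    fin_cases k
    · exact h₅ 0 (by decide) (by decide)
    · exact h₃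
    · exact absurd rfl hk

end Transducer

theorem tupleCode_cons (w : List Bool) (ws : List (List Bool)) :
    tupleCode (w :: ws) = w.map some ++ none :: tupleCode ws := by
  simp [tupleCode]

/-- The transducer that deletes the first entry of a tuple. -/
def tailTransducer : Transducer Bool where
  start := false
  next q a := q || a.isNone
  emit q a := bif q then some a else none
  final := []

theorem polyTime_tail : PolyTime List.tail := by
  refine tailTransducer.polyTime fun ws => ?_
  have htrue : ∀ l, tailTransducer.run true l = l := by
    intro l
    induction l with
    | nil => rfl
    | cons a l ih => simpa [Transducer.run, tailTransducer] using ih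
  have hfalse : ∀ (w : List Bool) l, tailTransducer.run false (w.map some ++ none :: l) = l := by
    intro w l
    induction w with
    | nil => exact htrue l
    | cons a w ih => exact ih
  cases ws with
  | nil => rfl
  | cons w ws => rw [tupleCode_cons]; exact hfalse w _

/-- The transducer that keeps only the first entry of a tuple. -/
def headTransducer : Transducer Bool where
  start := false
  next q a := q || a.isNone
  emit q a := bif q then none else some a
  final := []

theorem polyTime_take_one : PolyTime (List.take 1) := by
  refine headTransducer.polyTime fun ws => ?_
  have htrue : ∀ l, headTransducer.run true l = [] := by
    intro l
    induction l with
    | nil => rfl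
    | cons a l ih => simpa [Transducer.run, headTransducer] using ih
  have hfalse : ∀ (w : List Bool) l, headTransducer.run false (w.map some ++ none :: l)
      = w.map some ++ [none] := by
    intro w l
    induction w with
    | nil => exact congrArg (none :: ·) (htrue l)
    | cons a w ih => exact congrArg (some a :: ·) ih
  cases ws with
  | nil => rfl
  | cons w ws =>
    rw [tupleCode_cons, List.take_succ_cons, List.take_zero, tupleCode_cons]
    exact hfalse w _

/-- The transducer that ignores its input. -/
def constTransducer (l : List (Option Bool)) : Transducer Unit where
  start := ()
  next _ _ := ()
  emit _ _ := none
  final := l.map fun a _ => a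

theorem polyTime_const (us : List (List Bool)) : PolyTime fun _ => us := by
  refine (constTransducer (tupleCode us)).polyTime fun ws => ?_
  induction tupleCode ws with
  | nil => exact (List.map_map ..).trans (List.map_id _)
  | cons a l ih => exact ih

/-- The transducer that tests whether its input is nonempty. -/
def nonemptyTransducer : Transducer Bool where
  start := false
  next _ _ := true
  emit _ _ := none
  final := [some, fun _ => none]

theorem polyTime_nonempty : PolyTime fun ws => [[!ws.isEmpty]] := by
  refine nonemptyTransducer.polyTime fun ws => ?_
  have htrue : ∀ l, nonemptyTransducer.run true l = [some true, none] := by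
    intro l
    induction l with
    | nil => rfl
    | cons a l ih => exact ih
  rcases ws with _ | ⟨_ | ⟨a, w⟩, ws⟩
  · rfl
  · exact htrue _
  · exact htrue _

/-- Delete the first entry of a tuple; if it is not the one-letter word `b`, delete the others,
too. -/
def guardBit (b : Bool) : List (List Bool) → List (List Bool)
  | [c] :: ws => bif c == b then ws else []
  | _ => []

/-- The states of the transducer for `guardBit`. -/
inductive GuardState
  | start
  | seen
  | copy
  | drop
  deriving DecidableEq

instance : Fintype GuardState :=
  ⟨{.start, .seen, .copy, .drop}, fun q => by cases q <;> simp⟩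

/-- The transducer for `guardBit`. -/
def guardTransducer (b : Bool) : Transducer GuardState where
  start := .start
  next
    | .start, some c => bif c == b then .seen else .drop
    | .seen, none => .copy
    | .copy, _ => .copy
    | _, _ => .drop
  emit
    | .copy, a => some a
    | _, _ => none
  final := []

theorem polyTime_guardBit (b : Bool) : PolyTime (guardBit b) := by
  refine (guardTransducer b).polyTime fun ws => ?_
  have hcopy : ∀ l, (guardTransducer b).run .copy l = l := by
    intro l
    induction l with
    | nil => rfl
    | cons a l ih => exact congrArg (a :: ·) ih
  have hdrop : ∀ l, (guardTransducer b).run .drop l = [] := by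
    intro l
    induction l with
    | nil => rfl
    | cons a l ih => exact ih
  rcases ws with _ | ⟨_ | ⟨c, _ | ⟨d, w⟩⟩, ws⟩
  · rfl
  · exact hdrop _
  · by_cases hc : c = b
    · subst hc
      have : (guardTransducer c).run .seen (none :: tupleCode ws) = tupleCode ws := hcopy _
      simpa [guardBit, tupleCode_cons, Transducer.run, guardTransducer] using this
    · have : (guardTransducer b).run .drop (none :: tupleCode ws) = [] := hdrop _
      have hcb : (c == b) = false := by simpa using hc
      simpa [guardBit, tupleCode_cons, Transducer.run, guardTransducer, hcb, tupleCode] using this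
  · by_cases hc : c = b
    · subst hc
      have : (guardTransducer c).run .drop (w.map some ++ none :: tupleCode ws) = [] := hdrop _
      simpa [guardBit, tupleCode_cons, Transducer.run, guardTransducer, tupleCode] using this
    · have : (guardTransducer b).run .drop (some d :: (w.map some ++ none :: tupleCode ws)) = [] :=
        hdrop _
      have hcb : (c == b) = false := by simpa using hc
      simpa [guardBit, tupleCode_cons, Transducer.run, guardTransducer, hcb, tupleCode] using this

end Transducers

/-! ### Ternary quadratic forms -/

namespace TernaryForm

open Matrix

variable {R S : Type*} [CommRing R] [CommRing S]

/-- The value of a ternary quadratic form at a vector. -/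
def eval (Q : TernaryForm R) (v : Fin 3 → R) : R :=
  Q.a * v 0 ^ 2 + Q.b * v 1 ^ 2 + Q.c * v 2 ^ 2 + Q.r * (v 1 * v 2) + Q.s * (v 0 * v 2)
    + Q.t * (v 0 * v 1)

/-- The polar form `Q(v + w) - Q(v) - Q(w)` of a ternary quadratic form. -/
def polar (Q : TernaryForm R) (v w : Fin 3 → R) : R :=
  2 * Q.a * (v 0 * w 0) + 2 * Q.b * (v 1 * w 1) + 2 * Q.c * (v 2 * w 2)
    + Q.r * (v 1 * w 2 + v 2 * w 1) + Q.s * (v 0 * w 2 + v 2 * w 0) + Q.t * (v 0 * w 1 + v 1 * w 0)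

/-- The form `Q(M v)`. -/
def act (Q : TernaryForm R) (M : Matrix (Fin 3) (Fin 3) R) : TernaryForm R where
  a := Q.eval fun i => M i 0
  b := Q.eval fun i => M i 1
  c := Q.eval fun i => M i 2
  r := Q.polar (fun i => M i 1) fun i => M i 2
  s := Q.polar (fun i => M i 0) fun i => M i 2
  t := Q.polar (fun i => M i 0) fun i => M i 1

/-- The image of a form under a ring homomorphism. -/
def map (f : R →+* S) (Q : TernaryForm R) : TernaryForm S :=
  ⟨f Q.a, f Q.b, f Q.c, f Q.r, f Q.s, f Q.t⟩

instance : SMul R (TernaryForm R) :=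
  ⟨fun k Q => ⟨k * Q.a, k * Q.b, k * Q.c, k * Q.r, k * Q.s, k * Q.t⟩⟩

theorem smul_def (k : R) (Q : TernaryForm R) :
    k • Q = ⟨k * Q.a, k * Q.b, k * Q.c, k * Q.r, k * Q.s, k * Q.t⟩ := rfl

theorem eval_smul (k : R) (Q : TernaryForm R) (v : Fin 3 → R) : (k • Q).eval v = k * Q.eval v := by
  simp only [smul_def, eval]; ring

theorem polar_smul (k : R) (Q : TernaryForm R) (v w : Fin 3 → R) :
    (k • Q).polar v w = k * Q.polar v w := by
  simp only [smul_def, polar]; ring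

theorem eval_smul_right (k : R) (Q : TernaryForm R) (v : Fin 3 → R) :
    Q.eval (k • v) = k ^ 2 * Q.eval v := by
  simp only [eval, Pi.smul_apply, smul_eq_mul]; ring

theorem eval_act (Q : TernaryForm R) (M : Matrix (Fin 3) (Fin 3) R) (v : Fin 3 → R) :
    (Q.act M).eval v = Q.eval (M *ᵥ v) := by
  simp only [eval, act, polar, mulVec, dotProduct, Fin.sum_univ_three]; ring

theorem polar_act (Q : TernaryForm R) (M : Matrix (Fin 3) (Fin 3) R) (v w : Fin 3 → R) :
    (Q.act M).polar v w = Q.polar (M *ᵥ v) (M *ᵥ w) := by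
  simp only [eval, act, polar, mulVec, dotProduct, Fin.sum_univ_three]; ring

theorem act_act (Q : TernaryForm R) (M N : Matrix (Fin 3) (Fin 3) R) :
    (Q.act M).act N = Q.act (M * N) := by
  have h : ∀ j, M *ᵥ (fun i => N i j) = fun i => (M * N) i j := fun j => rfl
  ext <;> simp only [act] <;> simp only [← h] <;> first | exact eval_act .. | exact polar_act ..

theorem act_smul (k : R) (Q : TernaryForm R) (M : Matrix (Fin 3) (Fin 3) R) :
    (k • Q).act M = k • Q.act M := by
  simp only [act, eval_smul, polar_smul]
  rfl

theorem act_smul_right (k : R) (Q : TernaryForm R) (M : Matrix (Fin 3) (Fin 3) R) :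
    Q.act (k • M) = k ^ 2 • Q.act M := by
  simp only [act, smul_def, eval, polar, Matrix.smul_apply, smul_eq_mul, mk.injEq]
  refine ⟨?_, ?_, ?_, ?_, ?_, ?_⟩ <;> ring

@[simp]
theorem act_one (Q : TernaryForm R) : Q.act 1 = Q := by
  simp [act, eval, polar]

theorem smul_smul' (k l : R) (Q : TernaryForm R) : k • l • Q = (k * l) • Q := by
  simp only [smul_def, mul_assoc]

@[simp]
theorem one_smul' (Q : TernaryForm R) : (1 : R) • Q = Q := by
  simp [smul_def]

theorem eval_map (f : R →+* S) (Q : TernaryForm R) (v : Fin 3 → R) :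
    (Q.map f).eval (fun i => f (v i)) = f (Q.eval v) := by
  simp [eval, map]

theorem polar_map (f : R →+* S) (Q : TernaryForm R) (v w : Fin 3 → R) :
    (Q.map f).polar (fun i => f (v i)) (fun i => f (w i)) = f (Q.polar v w) := by
  simp [polar, map, map_ofNat f 2]

theorem map_act (f : R →+* S) (Q : TernaryForm R) (M : Matrix (Fin 3) (Fin 3) R) :
    (Q.act M).map f = (Q.map f).act (M.map f) := by
  simp only [act, Matrix.map_apply, eval_map, polar_map]
  rfl

theorem map_smul (f : R →+* S) (k : R) (Q : TernaryForm R) : (k • Q).map f = f k • Q.map f := by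
  simp [map, smul_def]

theorem map_map {T : Type*} [CommRing T] (g : S →+* T) (f : R →+* S) (Q : TernaryForm R) :
    (Q.map f).map g = Q.map (g.comp f) := rfl

/-- A form is determined by its values. -/
theorem ext_of_eval {Q Q' : TernaryForm R} (h : ∀ v, Q.eval v = Q'.eval v) : Q = Q' := by
  have h₀ := h ![1, 0, 0]
  have h₁ := h ![0, 1, 0]
  have h₂ := h ![0, 0, 1]
  have h₃ := h ![0, 1, 1]
  have h₄ := h ![1, 0, 1]
  have h₅ := h ![1, 1, 0]
  simp only [eval, cons_val_zero, cons_val_one, cons_val_two, head_cons, tail_cons] at *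
  ext
  · linear_combination h₀
  · linear_combination h₁
  · linear_combination h₂
  · linear_combination h₃ - h₁ - h₂
  · linear_combination h₄ - h₀ - h₂
  · linear_combination h₅ - h₀ - h₁

variable {F : Type*} [Field F]

theorem aeval_poly {K : Type*} [Field K] [Algebra F K] (Q : TernaryForm F) (v : Fin 3 → K) :
    MvPolynomial.aeval v Q.poly = (Q.map (algebraMap F K)).eval v := by
  simp [poly, eval, map]

theorem aeval_poly_self (Q : TernaryForm F) (v : Fin 3 → F) :
    MvPolynomial.aeval v Q.poly = Q.eval v := by
  rw [aeval_poly]; rfl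

theorem aeval_pderiv_poly {K : Type*} [Field K] [Algebra F K] (Q : TernaryForm F) (v : Fin 3 → K)
    (i : Fin 3) : MvPolynomial.aeval v (MvPolynomial.pderiv i Q.poly)
      = (Q.map (algebraMap F K)).polar v (Pi.single i 1) := by
  fin_cases i <;>
    simp [poly, polar, map, MvPolynomial.pderiv_X, Derivation.leibniz_pow] <;> ring

theorem polar_eq_sum (Q : TernaryForm R) (v w : Fin 3 → R) :
    Q.polar v w = ∑ i, w i * Q.polar v (Pi.single i 1) := by
  simp [polar, Fin.sum_univ_three, Pi.single_apply]; ring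

/-- A form is nonsingular if its polar form does not vanish identically at any nontrivial zero. -/
theorem nonsingular_iff {Q : TernaryForm F} :
    Q.Nonsingular ↔ ∀ v : Fin 3 → AlgebraicClosure F, v ≠ 0 → (Q.map (algebraMap F _)).eval v = 0 →
      ∃ w, (Q.map (algebraMap F _)).polar v w ≠ 0 := by
  refine forall_congr' fun v => imp_congr_right fun _ => ?_
  rw [aeval_poly]
  refine imp_congr_right fun _ => ⟨fun ⟨i, hi⟩ => ⟨_, by rwa [aeval_pderiv_poly] at hi⟩, ?_⟩
  rintro ⟨w, hw⟩
  by_contra! h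
  refine hw ?_
  rw [polar_eq_sum]
  exact Finset.sum_eq_zero fun i _ => by rw [← aeval_pderiv_poly, h i, mul_zero]

theorem Nonsingular.act {Q : TernaryForm F} (h : Q.Nonsingular) {M : Matrix (Fin 3) (Fin 3) F}
    (hM : IsUnit M.det) : (Q.act M).Nonsingular := by
  rw [nonsingular_iff] at h ⊢
  intro v hv hQ
  rw [map_act, eval_act] at hQ
  have hM' : IsUnit (M.map (algebraMap F (AlgebraicClosure F))) := by
    rw [Matrix.isUnit_iff_isUnit_det]
    have := hM.map (algebraMap F (AlgebraicClosure F))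
    rwa [RingHom.map_det] at this
  obtain ⟨N, hN⟩ := hM'.exists_right_inv
  obtain ⟨w, hw⟩ := h _ (fun h0 => hv ((Matrix.mulVec_injective_of_isUnit hM')
    (h0.trans (Matrix.mulVec_zero _).symm))) hQ
  refine ⟨N *ᵥ w, ?_⟩
  rwa [map_act, polar_act, Matrix.mulVec_mulVec, hN, Matrix.one_mulVec]

end TernaryForm

/-! ### Linear isomorphisms of conics -/

section LinearIsomorphisms

open Matrix

variable {F : Type*} [Field F]

theorem Conic.mk_mem_points_iff {C : Conic F} {K : Type*} [Field K] [Algebra F K] {v : Fin 3 → K}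
    (hv : v ≠ 0) : Projectivization.mk K v hv ∈ C.points K
      ↔ (C.form.map (algebraMap F K)).eval v = 0 := by
  obtain ⟨c, hc⟩ := Projectivization.exists_smul_eq_mk_rep K v hv
  change MvPolynomial.aeval (Projectivization.mk K v hv).rep C.form.poly = 0 ↔ _
  rw [TernaryForm.aeval_poly, ← hc, Units.smul_def, TernaryForm.eval_smul_right, mul_eq_zero,
    or_iff_right (pow_ne_zero 2 c.ne_zero)]

theorem Conic.rep_mem {C : Conic F} {K : Type*} [Field K] [Algebra F K] (P : C.points K) :
    (C.form.map (algebraMap F K)).eval P.1.rep = 0 :=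
  (TernaryForm.aeval_poly _ _).symm.trans P.2

/-- An invertible matrix that carries the zeros of one form to those of another is a morphism of
conics. -/
theorem exists_morphism_of_matrix {C D : Conic F} {M : Matrix (Fin 3) (Fin 3) F}
    (hM : IsUnit M.det) (h : ∀ v : Fin 3 → AlgebraicClosure F,
      (C.form.map (algebraMap F _)).eval v = 0 →
      (D.form.map (algebraMap F _)).eval (M.map (algebraMap F _) *ᵥ v) = 0) :
    ∃ φ : C.points (AlgebraicClosure F) → D.points (AlgebraicClosure F), IsConicMorphism φ ∧
      ∀ (P : C.points (AlgebraicClosure F)) (v : Fin 3 → AlgebraicClosure F) (hv : v ≠ 0),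
        P.1 = Projectivization.mk _ v hv →
        ∃ hw : M.map (algebraMap F _) *ᵥ v ≠ 0, (φ P).1 = Projectivization.mk _ _ hw := by
  have hM' : IsUnit (M.map (algebraMap F (AlgebraicClosure F))) := by
    rw [Matrix.isUnit_iff_isUnit_det]
    have := hM.map (algebraMap F (AlgebraicClosure F))
    rwa [RingHom.map_det] at this
  have hne : ∀ v : Fin 3 → AlgebraicClosure F, v ≠ 0 → M.map (algebraMap F _) *ᵥ v ≠ 0 :=
    fun v hv h0 => hv ((Matrix.mulVec_injective_of_isUnit hM')
      (h0.trans (Matrix.mulVec_zero _).symm))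
  have hf : ∀ v : Fin 3 → AlgebraicClosure F, (fun i => MvPolynomial.aeval v
      (∑ j, MvPolynomial.C (M i j) * MvPolynomial.X j)) = M.map (algebraMap F _) *ᵥ v := by
    intro v
    funext i
    simp [mulVec, dotProduct]
  refine ⟨fun P => ⟨Projectivization.mk _ _ (hne P.1.rep P.1.rep_nonzero),
    (Conic.mk_mem_points_iff _).2 (h _ (Conic.rep_mem P))⟩, fun P => ?_, fun P v hv hP => ?_⟩
  · refine ⟨1, fun i => ∑ j, MvPolynomial.C (M i j) * MvPolynomial.X j, fun i => ?_, ?_,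
      fun R hR => ?_⟩
    · exact MvPolynomial.IsHomogeneous.sum _ _ _ fun j _ =>
        (zero_add 1) ▸ (MvPolynomial.isHomogeneous_C _ _).mul (MvPolynomial.isHomogeneous_X _ _)
    · rw [hf]
      exact hne _ P.1.rep_nonzero
    · simp only [hf]
  · refine ⟨hne v hv, ?_⟩
    obtain ⟨c, hc⟩ := Projectivization.exists_smul_eq_mk_rep (AlgebraicClosure F) v hv
    rw [Projectivization.mk_eq_mk_iff]
    exact ⟨c, by rw [hP, ← hc, Units.smul_def, Units.smul_def, Matrix.mulVec_smul]⟩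

/-- Conics whose equations agree up to a linear change of variables and a factor are isomorphic. -/
theorem Conic.iso_of_act_eq_smul {C D : Conic F} {M : Matrix (Fin 3) (Fin 3) F}
    (hM : IsUnit M.det) {k : F} (hk : k ≠ 0) (h : D.form.act M = k • C.form) : Conic.Iso C D := by
  have hdet : IsUnit M⁻¹.det := by
    rw [Matrix.det_nonsing_inv]
    exact hM.ringInverse
  have hmap : ∀ v : Fin 3 → AlgebraicClosure F,
      (D.form.map (algebraMap F _)).eval (M.map (algebraMap F _) *ᵥ v)
        = algebraMap F _ k * (C.form.map (algebraMap F _)).eval v := by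
    intro v
    rw [← TernaryForm.eval_act, ← TernaryForm.map_act, h, TernaryForm.map_smul,
      TernaryForm.eval_smul]
  have hk' : algebraMap F (AlgebraicClosure F) k ≠ 0 := by simpa using hk
  have hmul : M.map (algebraMap F (AlgebraicClosure F)) * M⁻¹.map (algebraMap F _) = 1 := by
    rw [← Matrix.map_mul, Matrix.mul_nonsing_inv _ hM]
    exact Matrix.map_one _ (map_zero _) (map_one _)
  have hmul' : M⁻¹.map (algebraMap F (AlgebraicClosure F)) * M.map (algebraMap F _) = 1 := by
    rw [← Matrix.map_mul, Matrix.nonsing_inv_mul _ hM]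
    exact Matrix.map_one _ (map_zero _) (map_one _)
  obtain ⟨φ, hφ, hφ'⟩ := exists_morphism_of_matrix (C := C) (D := D) hM
    (fun v hv => by rw [hmap, hv, mul_zero])
  obtain ⟨ψ, hψ, hψ'⟩ := exists_morphism_of_matrix (C := D) (D := C) hdet (fun v hv => by
    have := hmap (M⁻¹.map (algebraMap F _) *ᵥ v)
    rw [Matrix.mulVec_mulVec, hmul, Matrix.one_mulVec, hv] at this
    exact (mul_eq_zero.1 this.symm).resolve_left hk')
  refine ⟨⟨φ, ψ, fun P => ?_, fun P => ?_⟩, hφ, hψ⟩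
  · obtain ⟨h₁, h₂⟩ := hφ' P _ P.1.rep_nonzero (P.1.mk_rep).symm
    obtain ⟨h₃, h₄⟩ := hψ' (φ P) _ h₁ h₂
    refine Subtype.ext (h₄.trans
      ((Projectivization.mk_eq_mk_iff' ..).2 ⟨1, ?_⟩ |>.trans P.1.mk_rep))
    rw [one_smul, Matrix.mulVec_mulVec, hmul', Matrix.one_mulVec]
  · obtain ⟨h₁, h₂⟩ := hψ' P _ P.1.rep_nonzero (P.1.mk_rep).symm
    obtain ⟨h₃, h₄⟩ := hφ' (ψ P) _ h₁ h₂
    refine Subtype.ext (h₄.trans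
      ((Projectivization.mk_eq_mk_iff' ..).2 ⟨1, ?_⟩ |>.trans P.1.mk_rep))
    rw [one_smul, Matrix.mulVec_mulVec, hmul, Matrix.one_mulVec]

end LinearIsomorphisms

/-! ### Quaternion algebras in standard form -/

namespace QuaternionAlgebra

open scoped Quaternion

variable {F : Type*} [Field F] {α β γ : F}

/-- If `β² + 4α` is nonzero, only scalars commute with `i` and `j`. -/
theorem isCentral_of_ne_zero (hd : β ^ 2 + 4 * α ≠ 0) :
    Algebra.IsCentral F ℍ[F,α,β,γ] := by
  refine ⟨fun x hx => ?_⟩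
  rw [Subalgebra.mem_center_iff] at hx
  obtain ⟨x₀, x₁, x₂, x₃⟩ := x
  have hi := hx ⟨0, 1, 0, 0⟩
  have hj := hx ⟨0, 0, 1, 0⟩
  simp only [mk_mul_mk, QuaternionAlgebra.mk.injEq] at hi hj
  obtain ⟨-, -, hi₂, hi₃⟩ := hi
  obtain ⟨-, -, hj₂, hj₃⟩ := hj
  have h₂ : x₂ = 0 := by
    refine (mul_eq_zero.1 (?_ : (β ^ 2 + 4 * α) * x₂ = 0)).resolve_left hd
    linear_combination (-β) * hi₂ + 2 * α * hi₃
  have h₃ : x₃ = 0 := by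
    refine (mul_eq_zero.1 (?_ : (β ^ 2 + 4 * α) * x₃ = 0)).resolve_left hd
    linear_combination 2 * hi₂ + β * hi₃
  have h₁ : x₁ = 0 := by
    refine (mul_eq_zero.1 (?_ : (β ^ 2 + 4 * α) * x₁ = 0)).resolve_left hd
    linear_combination β * hj₂ - 2 * α * hj₃
  subst h₁ h₂ h₃
  exact ⟨x₀, rfl⟩

/-- If `β² + 4α` and `γ` are nonzero, then the commutators of an element with `i` and `j` show that
a nonzero ideal contains a nonzero scalar. -/
theorem isSimpleRing_of_ne_zero (hd : β ^ 2 + 4 * α ≠ 0) (hγ : γ ≠ 0) :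
    IsSimpleRing ℍ[F,α,β,γ] := by
  have key : ∀ (I : TwoSidedIdeal ℍ[F,α,β,γ]) (p q : F), (p ≠ 0 ∨ q ≠ 0) →
      (⟨p, q, 0, 0⟩ : ℍ[F,α,β,γ]) ∈ I → I = ⊤ := by
    intro I p q hpq h
    have hs : ∀ c : F, c ≠ 0 → (⟨c, 0, 0, 0⟩ : ℍ[F,α,β,γ]) ∈ I → I = ⊤ := by
      intro c hc h
      refine (TwoSidedIdeal.one_mem_iff I).1 ?_
      convert I.mul_mem_left ⟨c⁻¹, 0, 0, 0⟩ _ h using 1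
      ext <;> simp [hc]
    by_cases hq : q = 0
    · subst hq
      exact hs p (by simpa using hpq) h
    · refine hs (q * (β ^ 2 + 4 * α)) (mul_ne_zero hq hd) ?_
      have h₁ := I.sub_mem h (I.mul_mem_left ⟨γ⁻¹, 0, 0, 0⟩ _ (I.mul_mem_left ⟨0, 0, 1, 0⟩ _
        (I.mul_mem_right _ ⟨0, 0, 1, 0⟩ h)))
      convert I.mul_mem_left ⟨-β, 2, 0, 0⟩ _ h₁ using 1
      ext <;> simp <;> field_simp <;> ring
  refine ⟨⟨fun I => or_iff_not_imp_left.2 fun hI => ?_⟩⟩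
  obtain ⟨x, hx, hx0⟩ : ∃ x ∈ I, x ≠ 0 := by
    by_contra! h
    exact hI (le_bot_iff.1 fun x hx => (TwoSidedIdeal.mem_bot _).2 (h x hx))
  obtain ⟨x₀, x₁, x₂, x₃⟩ := x
  by_cases h₂ : x₂ = 0 ∧ x₃ = 0
  · obtain ⟨rfl, rfl⟩ := h₂
    refine key I x₀ x₁ ?_ hx
    by_contra! h
    exact hx0 (by rw [h.1, h.2]; rfl)
  · have h₁ := I.mul_mem_right _ ⟨0, 0, 1, 0⟩ (I.sub_mem (I.mul_mem_left ⟨0, 1, 0, 0⟩ _ hx) 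
      (I.mul_mem_right _ ⟨0, 1, 0, 0⟩ hx))
    have h₃ := I.mul_mem_left ⟨-β, 2, 0, 0⟩ _ h₁
    refine key I (γ * (β ^ 2 + 4 * α) * x₂) (γ * (β ^ 2 + 4 * α) * x₃) ?_ ?_
    · simpa [hd, hγ, imp_iff_not_or] using h₂
    · convert h₃ using 1
      ext <;> simp <;> ring

/-- An algebra of dimension four that contains generators satisfying the relations of a
nondegenerate quaternion algebra is isomorphic to it. -/
theorem Basis.exists_algEquiv {A : Type*} [Ring A] [Algebra F A] (q : Basis A α β γ)
    (hd : β ^ 2 + 4 * α ≠ 0) (hγ : γ ≠ 0) (hA : Module.finrank F A = 4) :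
    ∃ e : ℍ[F,α,β,γ] ≃ₐ[F] A, ∀ x, e x = q.lift x := by
  have := isSimpleRing_of_ne_zero hd hγ
  have : Nontrivial A := Module.nontrivial_of_finrank_pos (R := F) (by omega)
  have : FiniteDimensional F A := Module.finite_of_finrank_pos (by omega)
  have hinj : Function.Injective q.liftHom.toLinearMap := q.liftHom.toRingHom.injective
  have hsurj := (LinearMap.injective_iff_surjective_of_finrank_eq_finrank
    ((finrank_eq_four α β γ).trans hA.symm)).1 hinj
  exact ⟨AlgEquiv.ofBijective q.liftHom ⟨hinj, hsurj⟩, fun x => rfl⟩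

/-- Conjugation as a linear map. -/
def starLinearMap (α β γ : F) : ℍ[F,α,β,γ] →ₗ[F] ℍ[F,α,β,γ] where
  toFun := star
  map_add' := star_add
  map_smul' := star_smul

theorem isStandardInvolution_star : IsStandardInvolution (starLinearMap α β γ) where
  map_one := star_one _
  map_mul := star_mul
  involutive := star_star
  standard x := ⟨_, mul_star_eq_coe x⟩

end QuaternionAlgebra

/-! ### The standard involution and the norm form -/

section NormForm

open Matrix QuaternionAlgebra

variable {F : Type u} [Field F]

namespace IsStandardInvolution

variable {B B' : Type*} [Ring B] [Algebra F B] [Ring B'] [Algebra F B'] {σ τ : B →ₗ[F] B}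

theorem apply_algebraMap (h : IsStandardInvolution σ) (c : F) :
    σ (algebraMap F B c) = algebraMap F B c := by
  rw [Algebra.algebraMap_eq_smul_one, map_smul, h.map_one]

theorem exists_eq_sub (h : IsStandardInvolution σ) (x : B) :
    ∃ t : F, σ x = algebraMap F B t - x := by
  obtain ⟨c, hc⟩ := h.standard x
  obtain ⟨d, hd⟩ := h.standard (1 + x)
  refine ⟨d - 1 - c, ?_⟩
  rw [map_add, h.map_one, add_mul, mul_add, one_mul, one_mul, mul_add, mul_one, hc] at hd
  rw [map_sub, map_sub, ← hd, _root_.map_one]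
  abel

/-- An element outside the base field satisfies at most one monic quadratic equation, hence there
is at most one standard involution. -/
protected theorem unique (h : IsStandardInvolution σ) (h' : IsStandardInvolution τ) : σ = τ := by
  ext x
  obtain ⟨t, ht⟩ := h.exists_eq_sub x
  obtain ⟨t', ht'⟩ := h'.exists_eq_sub x
  obtain ⟨c, hc⟩ := h.standard x
  obtain ⟨c', hc'⟩ := h'.standard x
  by_cases htt : t = t'
  · rw [ht, ht', htt]
  · have hx : x = algebraMap F B ((c - c') / (t - t')) := by
      have h₁ : x * algebraMap F B (t - t') = algebraMap F B (c - c') := by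
        rw [map_sub, map_sub, ← hc, ← hc', ht, ht']
        noncomm_ring
      rw [div_eq_mul_inv, _root_.map_mul, ← h₁, mul_assoc, ← _root_.map_mul,
        mul_inv_cancel₀ (sub_ne_zero.2 htt), _root_.map_one, mul_one]
    rw [hx, h.apply_algebraMap, h'.apply_algebraMap]

theorem conj (h : IsStandardInvolution σ) (e : B ≃ₐ[F] B') :
    IsStandardInvolution (e.toLinearMap ∘ₗ σ ∘ₗ e.symm.toLinearMap) where
  map_one := by simp [h.map_one]
  map_mul x y := by simp [h.map_mul]
  involutive x := by simp [h.involutive]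
  standard x := by
    obtain ⟨c, hc⟩ := h.standard (e.symm x)
    exact ⟨c, by simpa using congrArg e hc⟩

end IsStandardInvolution

open Classical in
/-- The reduced norm of `(a, b | F)` on elements of trace zero, in the coordinates given by
`pureQuat`. -/
noncomputable def normForm (a b : F) : TernaryForm F :=
  if (2 : F) = 0 then ⟨1, b, a * b, b, 0, 0⟩ else ⟨-a, -b, a * b, 0, 0, 0⟩

open Classical in
/-- Coordinates on the space of elements of trace zero of `(a, b | F)`: its basis is `i, j, ij` if
`char F ≠ 2`, and `1, j, ij` if `char F = 2`. -/
noncomputable def pureQuat (a b : F) (v : Fin 3 → F) : StdQuat a b :=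
  if (2 : F) = 0 then ⟨v 0, 0, v 1, v 2⟩ else ⟨0, v 0, v 1, v 2⟩

theorem pureQuat_add (a b : F) (v w : Fin 3 → F) :
    pureQuat a b (v + w) = pureQuat a b v + pureQuat a b w := by
  unfold pureQuat
  split_ifs <;> ext <;> simp

theorem pureQuat_smul (a b c : F) (v : Fin 3 → F) :
    pureQuat a b (c • v) = c • pureQuat a b v := by
  unfold pureQuat
  split_ifs <;> ext <;> simp

theorem pureQuat_injective (a b : F) : Function.Injective (pureQuat a b) := by
  intro v w h
  unfold pureQuat at h
  funext i
  split_ifs at h <;> rw [QuaternionAlgebra.mk.injEq] at h <;> fin_cases i <;> tauto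

theorem star_pureQuat (a b : F) (v : Fin 3 → F) : star (pureQuat a b v) = -pureQuat a b v := by
  unfold pureQuat
  split_ifs with h
  · have h' : ∀ x : F, -x = x := fun x => by linear_combination -x * h
    ext <;> simp [h']
  · ext <;> simp [h]

theorem exists_pureQuat_eq {a b : F} {x : StdQuat a b} (hx : x + star x = 0) :
    ∃ v, pureQuat a b v = x := by
  rw [QuaternionAlgebra.self_add_star', ← QuaternionAlgebra.coe_zero,
    QuaternionAlgebra.coe_inj] at hx
  by_cases h : (2 : F) = 0
  · refine ⟨![x.re, x.imJ, x.imK], ?_⟩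
    rw [pureQuat, if_pos h]
    ext <;> simp
    simpa [h] using hx.symm
  · refine ⟨![x.imI, x.imJ, x.imK], ?_⟩
    rw [pureQuat, if_neg h]
    ext <;> simp
    simpa [h, eq_comm] using hx

theorem pureQuat_mul_self (a b : F) (v : Fin 3 → F) :
    pureQuat a b v * pureQuat a b v = algebraMap F _ (-(normForm a b).eval v) := by
  change _ = (⟨_, 0, 0, 0⟩ : StdQuat a b)
  by_cases h : (2 : F) = 0
  · simp only [pureQuat, normForm, if_pos h, TernaryForm.eval, mk_mul_mk, mk.injEq,
      Algebra.algebraMap_self, RingHom.id_apply]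
    refine ⟨?_, ?_, ?_, ?_⟩
    · linear_combination (v 0 ^ 2 + b * v 1 ^ 2 + b * v 1 * v 2) * h
    · ring
    · linear_combination v 0 * v 1 * h
    · linear_combination v 0 * v 2 * h
  · simp only [pureQuat, normForm, if_neg h, TernaryForm.eval, mk_mul_mk, mk.injEq,
      Algebra.algebraMap_self, RingHom.id_apply]
    refine ⟨?_, ?_, ?_, ?_⟩ <;> ring

theorem pureQuat_mul_add_mul (a b : F) (v w : Fin 3 → F) :
    pureQuat a b v * pureQuat a b w + pureQuat a b w * pureQuat a b v
      = algebraMap F _ (-(normForm a b).polar v w) := by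
  have h := pureQuat_mul_self a b (v + w)
  have h' : -(normForm a b).polar v w = -(normForm a b).eval (v + w) - -(normForm a b).eval v
      - -(normForm a b).eval w := by
    simp only [TernaryForm.polar, TernaryForm.eval, Pi.add_apply]; ring
  rw [h', map_sub, map_sub, ← h, ← pureQuat_mul_self, ← pureQuat_mul_self, pureQuat_add]
  noncomm_ring

theorem IsStdParam.disc_ne_zero {a b : F} (h : IsStdParam a b) :
    (open Classical in if (2 : F) = 0 then 1 else 0) ^ 2 + 4 * a ≠ 0 := by
  have h4 : (4 : F) = 2 * 2 := by norm_num
  by_cases h2 : (2 : F) = 0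
  · simp [h2, h4]
  · simp [h2, h4, h.2 h2]

/-- The quaternion algebra with standard form `(a, b | F)`. -/
noncomputable def IsStdParam.quatAlg {a b : F} (h : IsStdParam a b) : QuatAlg F where
  carrier := StdQuat a b
  central := isCentral_of_ne_zero h.disc_ne_zero
  simple := isSimpleRing_of_ne_zero h.disc_ne_zero h.1
  finrank_eq := QuaternionAlgebra.finrank_eq_four ..

theorem IsStdParam.nonsingular_normForm {a b : F} (h : IsStdParam a b) :
    (normForm a b).Nonsingular := by
  rw [TernaryForm.nonsingular_iff]
  intro v hv hQ
  by_contra! hw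
  have hb : algebraMap F (AlgebraicClosure F) b ≠ 0 := by simpa using h.1
  have h₀ := hw ![1, 0, 0]
  have h₁ := hw ![0, 1, 0]
  have h₂ := hw ![0, 0, 1]
  refine hv ?_
  by_cases h2 : (2 : F) = 0
  · have h2' : (2 : AlgebraicClosure F) = 0 := by
      rw [← map_ofNat (algebraMap F (AlgebraicClosure F)) 2, h2, map_zero]
    simp [normForm, if_pos h2, TernaryForm.polar, TernaryForm.eval, TernaryForm.map, h2', hb]
      at h₀ h₁ h₂ hQ
    funext i
    fin_cases i <;> simp_all
  · have h2' : (2 : AlgebraicClosure F) ≠ 0 := by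
      rw [← map_ofNat (algebraMap F (AlgebraicClosure F)) 2]
      simpa using h2
    have ha : a ≠ 0 := h.2 h2
    have hb' := h.1
    simp [normForm, if_neg h2, TernaryForm.polar, TernaryForm.map, h2', ha, hb'] at h₀ h₁ h₂
    funext i
    fin_cases i <;> simp_all

/-- The conic `nrd₀ = 0` of the quaternion algebra with standard form `(a, b | F)`. -/
noncomputable def IsStdParam.conic {a b : F} (h : IsStdParam a b) : Conic F :=
  ⟨normForm a b, h.nonsingular_normForm⟩

theorem isNormConic_of_algEquiv {a b : F} {B : QuatAlg F} (e : StdQuat a b ≃ₐ[F] B.carrier)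
    {C : Conic F} (hC : C.form = normForm a b) : IsNormConic B C := by
  refine ⟨_, isStandardInvolution_star.conj e, ?_⟩
  set σ := e.toLinearMap ∘ₗ starLinearMap _ _ _ ∘ₗ e.symm.toLinearMap with hσ
  have hσe : ∀ x, σ (e x) = e (star x) := fun x => by simp [hσ, starLinearMap]
  have hmem : ∀ v, e (pureQuat a b v) ∈ traceZero σ := fun v => by
    change e _ + σ (e _) = 0
    rw [hσe, star_pureQuat, map_neg, add_neg_cancel]
  refine ⟨LinearEquiv.ofBijective
    { toFun := fun v => ⟨e (pureQuat a b v), hmem v⟩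
      map_add' := fun v w => Subtype.ext (by simp [pureQuat_add])
      map_smul' := fun c v => Subtype.ext (by simp [pureQuat_smul]) } ⟨?_, ?_⟩, fun v => ?_⟩
  · intro v w hvw
    exact pureQuat_injective a b (e.injective (congrArg Subtype.val hvw))
  · rintro ⟨y, hy⟩
    obtain ⟨x, rfl⟩ := e.surjective y
    have hx : x + star x = 0 := by
      have : e x + σ (e x) = 0 := hy
      rwa [hσe, ← map_add, map_eq_zero_iff _ e.injective] at this
    obtain ⟨v, rfl⟩ := exists_pureQuat_eq hx
    exact ⟨v, rfl⟩
  · change _ = e (pureQuat a b v) * σ (e (pureQuat a b v))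
    rw [hσe, star_pureQuat, ← map_mul, mul_neg, pureQuat_mul_self, ← map_neg, neg_neg, e.commutes,
      TernaryForm.aeval_poly_self, hC]

/-- The norm conics of isomorphic quaternion algebras differ by a linear change of variables,
because the standard involution is unique. -/
theorem IsNormConic.exists_act_eq {B B' : QuatAlg F} {C C' : Conic F} (h : IsNormConic B C)
    (h' : IsNormConic B' C') (ε : B.carrier ≃ₐ[F] B'.carrier) :
    ∃ M : Matrix (Fin 3) (Fin 3) F, IsUnit M.det ∧ C'.form.act M = C.form := by
  obtain ⟨σ, hσ, e, he⟩ := h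
  obtain ⟨σ', hσ', e', he'⟩ := h'
  have hε : ∀ x, σ' (ε x) = ε (σ x) := by
    intro x
    rw [(hσ'.unique (hσ.conj ε))]
    simp
  let f : traceZero σ →ₗ[F] traceZero σ' := ε.toLinearMap.restrict fun x hx => by
    change ε x + σ' (ε x) = 0
    rw [hε, ← map_add, (show x + σ x = 0 from hx), map_zero]
  have hf : ∀ x, (f x : B'.carrier) = ε x := fun x => rfl
  let g : (Fin 3 → F) →ₗ[F] (Fin 3 → F) := e'.symm.toLinearMap ∘ₗ f ∘ₗ e.toLinearMap
  have hg : Function.Injective g := by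
    intro v w hvw
    exact e.injective (Subtype.ext (ε.injective (congrArg Subtype.val (e'.symm.injective hvw))))
  refine ⟨LinearMap.toMatrix' g, ?_, ?_⟩
  · rw [LinearMap.det_toMatrix', ← LinearMap.isUnit_iff_isUnit_det, LinearMap.isUnit_iff_ker_eq_bot]
    exact LinearMap.ker_eq_bot.2 hg
  · refine TernaryForm.ext_of_eval fun v => ?_
    rw [TernaryForm.eval_act, LinearMap.toMatrix'_mulVec, ← TernaryForm.aeval_poly_self,
      ← TernaryForm.aeval_poly_self]
    refine (algebraMap F B'.carrier).injective ?_
    rw [he', ← ε.commutes, he, map_mul, ← hε]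
    simp [g, hf]

end NormForm

/-! ### Every quaternion algebra has a standard form -/

section StandardForm

open Matrix QuaternionAlgebra

variable {F : Type u} [Field F]

/-- The relations of `(a, b | F)` in the matrix ring, given a solution of `u² + β u w - α w² = γ`:
`i` is the companion matrix of `X² - β X - α`, and `j` a matrix of trace zero that conjugates it. -/
def companionBasis {α β γ u w : F} (h : u ^ 2 + β * u * w - α * w ^ 2 = γ) :
    QuaternionAlgebra.Basis (Matrix (Fin 2) (Fin 2) F) α β γ where
  i := !![0, α; 1, β]
  j := !![u, β * u - α * w; w, -u]
  k := !![0, α; 1, β] * !![u, β * u - α * w; w, -u]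
  i_mul_i := by
    ext i j; fin_cases i <;> fin_cases j <;> simp [Matrix.mul_apply]
    ring
  j_mul_j := by
    subst h
    ext i j; fin_cases i <;> fin_cases j <;> simp [Matrix.mul_apply] <;> ring
  i_mul_j := rfl
  j_mul_i := by
    ext i j; fin_cases i <;> fin_cases j <;> simp [Matrix.mul_apply] <;> ring

variable {B : Type*} [Ring B] [Algebra F B]

/-- In a division algebra of dimension four with centre `F`, every element is a root of a monic
quadratic polynomial: if `y` does not commute with `x`, then a linear relation between the five
elements `1, x, y, y x, y x²` has the form `p + y q = 0` with `p` and `q` in `F[x]`, and here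
`q = 0`, since otherwise `y = -p q⁻¹` would commute with `x`. -/
theorem exists_quadratic_relation [Algebra.IsCentral F B] (hB : Module.finrank F B = 4)
    (hdiv : ∀ x : B, x ≠ 0 → IsUnit x) (x : B) :
    ∃ t n : F, x * x = t • x + algebraMap F B n := by
  by_cases hx : x ∈ (⊥ : Subalgebra F B)
  · obtain ⟨c, rfl⟩ := Algebra.mem_bot.1 hx
    exact ⟨0, c * c, by simp⟩
  have : FiniteDimensional F B := Module.finite_of_finrank_pos (by omega)
  have : Nontrivial B := Module.nontrivial_of_finrank_pos (R := F) (by omega)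
  obtain ⟨y, hy⟩ : ∃ y, y * x ≠ x * y := by
    by_contra! h
    exact hx (Algebra.IsCentral.out (Subalgebra.mem_center_iff.2 h))
  have hscal : ∀ c d : F, algebraMap F B c + d • x = 0 → c = 0 ∧ d = 0 := by
    intro c d h
    have hd : d = 0 := by
      by_contra hd
      refine hx (Algebra.mem_bot.2 ⟨-(d⁻¹ * c), ?_⟩)
      rw [← eq_neg_iff_add_eq_zero] at h
      rw [map_neg, map_mul, h, mul_neg, neg_neg, ← Algebra.smul_def, smul_smul,
        inv_mul_cancel₀ hd, one_smul]
    subst hd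
    simpa using h
  have hdep : ¬ LinearIndependent F ![1, x, y, y * x, y * (x * x)] := by
    intro h
    have := h.fintype_card_le_finrank
    rw [hB] at this
    simp at this
  obtain ⟨g, hg, hg0⟩ := Fintype.not_linearIndependent_iff.1 hdep
  simp only [Fin.sum_univ_five, cons_val] at hg
  have hg' : (algebraMap F B (g 0) + g 1 • x)
      + y * (algebraMap F B (g 2) + g 3 • x + g 4 • (x * x)) = 0 := by
    rw [← hg, mul_add, mul_add, mul_smul_comm, mul_smul_comm, Algebra.algebraMap_eq_smul_one,
      Algebra.algebraMap_eq_smul_one, mul_smul_comm, mul_one]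
    abel
  set p := algebraMap F B (g 0) + g 1 • x with hp
  set q := algebraMap F B (g 2) + g 3 • x + g 4 • (x * x) with hq
  have hpx : Commute p x :=
    (Algebra.commute_algebraMap_left _ _).add_left ((Commute.refl x).smul_left _)
  have hqx : Commute q x :=
    ((Algebra.commute_algebraMap_left _ _).add_left ((Commute.refl x).smul_left _)).add_left
      (((Commute.refl x).mul_left (Commute.refl x)).smul_left _)
  have hq0 : q = 0 := by
    by_contra hne
    obtain ⟨r, hr⟩ := hdiv q hne
    have hyr : y = -p * (↑r⁻¹ : B) := by
      rw [Units.eq_mul_inv_iff_mul_eq, hr]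
      exact eq_neg_of_add_eq_zero_right hg'
    refine hy ?_
    rw [hyr]
    rw [← hr] at hqx
    exact (hpx.neg_left.mul_left hqx.units_inv_left)
  have hp0 : p = 0 := by rwa [hq0, mul_zero, add_zero] at hg'
  obtain ⟨h0, h1⟩ := hscal _ _ hp0
  have h4 : g 4 ≠ 0 := by
    intro h4
    rw [hq, h4, zero_smul, add_zero] at hq0
    obtain ⟨h2, h3⟩ := hscal _ _ hq0
    obtain ⟨i, hi⟩ := hg0
    fin_cases i <;> exact hi ‹_›
  refine ⟨-((g 4)⁻¹ * g 3), -((g 4)⁻¹ * g 2), ?_⟩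
  have := congrArg ((g 4)⁻¹ • ·) (hq.symm.trans hq0)
  simp only [smul_add, smul_smul, inv_mul_cancel₀ h4, one_smul, smul_zero,
    Algebra.algebraMap_eq_smul_one] at this
  rw [Algebra.algebraMap_eq_smul_one, neg_smul, neg_smul, eq_comm, ← sub_eq_zero, ← neg_eq_zero,
    ← this]
  abel

/-- Completion of `i` to a system of generators: for `y` that does not commute with `i`, the
commutator `j` of `i` and `y` satisfies the relations. -/
theorem exists_basis_of_mul_self [Algebra.IsCentral F B] (hB : Module.finrank F B = 4)
    (hdiv : ∀ x : B, x ≠ 0 → IsUnit x) {i : B} {α β : F} (hi : i * i = α • 1 + β • i)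
    (hiF : i ∉ (⊥ : Subalgebra F B)) (hd : β ^ 2 + 4 * α ≠ 0) :
    ∃ γ : F, γ ≠ 0 ∧ Nonempty (QuaternionAlgebra.Basis B α β γ) := by
  have : Nontrivial B := Module.nontrivial_of_finrank_pos (R := F) (by omega)
  obtain ⟨y, hy⟩ : ∃ y, y * i ≠ i * y := by
    by_contra! h
    exact hiF (Algebra.IsCentral.out (Subalgebra.mem_center_iff.2 h))
  obtain ⟨j, hj⟩ : ∃ j, j = i * y - y * i := ⟨_, rfl⟩
  have hj0 : j ≠ 0 := fun h => hy (sub_eq_zero.1 (hj.symm.trans h)).symm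
  have hji : j * i = β • j - i * j := by
    have h₁ : j * i + i * j = i * i * y - y * (i * i) := by
      rw [hj]; noncomm_ring
    rw [eq_sub_iff_add_eq, h₁, hi, hj, add_mul, mul_add, smul_mul_assoc, smul_mul_assoc,
      mul_smul_comm, mul_smul_comm, one_mul, mul_one, smul_sub]
    abel
  have hjji : j * j * i = i * (j * j) := by
    rw [mul_assoc, hji, mul_sub, mul_smul_comm, ← mul_assoc, hji, sub_mul, smul_mul_assoc]
    rw [sub_sub_cancel, mul_assoc]
  obtain ⟨t, n, ht⟩ := exists_quadratic_relation hB hdiv j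
  have ht0 : t = 0 := by
    by_contra ht0
    have hcomm : j * i = i * j := by
      have : j = t⁻¹ • (j * j - algebraMap F B n) := by
        rw [ht, add_sub_cancel_right, smul_smul, inv_mul_cancel₀ ht0, one_smul]
      rw [this, smul_mul_assoc, mul_smul_comm, sub_mul, mul_sub, hjji, Algebra.commutes]
    have h₂ : ((2 : F) • i - β • 1) * j = 0 := by
      rw [sub_mul, smul_mul_assoc, smul_mul_assoc, one_mul, two_smul]
      nth_rewrite 1 [← hcomm]
      rw [hji]
      abel
    have h₃ : (2 : F) • i - β • (1 : B) = 0 := (hdiv j hj0).mul_left_eq_zero.1 h₂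
    refine hd ((algebraMap F B).injective ?_)
    rw [map_zero, Algebra.algebraMap_eq_smul_one]
    have h₄ : ((2 : F) • i - β • 1) * ((2 : F) • i - β • 1) = (β ^ 2 + 4 * α) • (1 : B) := by
      rw [sub_mul, mul_sub, mul_sub]
      simp only [smul_mul_assoc, mul_smul_comm, one_mul, mul_one, hi]
      module
    rw [← h₄, h₃, zero_mul]
  have hjj : j * j = n • 1 := by rw [ht, ht0, zero_smul, zero_add, Algebra.algebraMap_eq_smul_one]
  refine ⟨n, ?_, ⟨⟨i, j, i * j, hi, hjj, rfl, hji⟩⟩⟩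
  rintro rfl
  rw [zero_smul] at hjj
  exact hj0 ((hdiv j hj0).mul_left_eq_zero.1 hjj)

/-- A generator `i` of the required form is obtained by completing the square, or, in characteristic
two, by scaling an element of nonzero trace. -/
theorem exists_standardForm_of_division [Algebra.IsCentral F B] (hB : Module.finrank F B = 4)
    (hdiv : ∀ x : B, x ≠ 0 → IsUnit x) :
    ∃ a b : F, IsStdParam a b ∧ Nonempty (StdQuat a b ≃ₐ[F] B) := by
  classical
  have : Nontrivial B := Module.nontrivial_of_finrank_pos (R := F) (by omega)
  have hrel := exists_quadratic_relation hB hdiv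
  obtain ⟨x, hx⟩ : ∃ x : B, x ∉ (⊥ : Subalgebra F B) := by
    by_contra! h
    have := Subalgebra.bot_eq_top_iff_finrank_eq_one.1 (top_unique fun x _ => h x :
      (⊥ : Subalgebra F B) = ⊤)
    omega
  suffices ∃ (i : B) (a : F), i * i = a • 1 + (if (2 : F) = 0 then 1 else 0 : F) • i ∧
      i ∉ (⊥ : Subalgebra F B) by
    obtain ⟨i, a, hi, hiF⟩ := this
    have ha : (2 : F) ≠ 0 → a ≠ 0 := by
      rintro h2 rfl
      rw [if_neg h2, zero_smul, zero_smul, add_zero] at hi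
      refine hiF ?_
      by_cases hi0 : i = 0
      · rw [hi0]; exact zero_mem _
      · rw [(hdiv i hi0).mul_left_eq_zero.1 hi]; exact zero_mem _
    have hd : (if (2 : F) = 0 then 1 else 0 : F) ^ 2 + 4 * a ≠ 0 :=
      IsStdParam.disc_ne_zero (b := 1) ⟨one_ne_zero, ha⟩
    obtain ⟨b, hb, ⟨q⟩⟩ := exists_basis_of_mul_self hB hdiv hi hiF hd
    obtain ⟨e, -⟩ := q.exists_algEquiv hd hb hB
    exact ⟨a, b, ⟨hb, ha⟩, ⟨e⟩⟩
  by_cases h2 : (2 : F) = 0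
  · simp only [if_pos h2, one_smul]
    have hneg : ∀ z : B, -z = z := fun z => by
      rw [neg_eq_iff_add_eq_zero, ← two_smul F, h2, zero_smul]
    obtain ⟨z, t, n, hz, ht⟩ : ∃ (z : B) (t n : F), z * z = t • z + algebraMap F B n ∧ t ≠ 0 ∧
        z ∉ (⊥ : Subalgebra F B) := by
      by_contra! h
      -- otherwise all squares are scalars, and so is every `z w + w z`
      have hsq : ∀ z : B, z * z ∈ (⊥ : Subalgebra F B) := by
        intro z
        by_cases hz : z ∈ (⊥ : Subalgebra F B)
        · exact mul_mem hz hz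
        · obtain ⟨t, n, hz'⟩ := hrel z
          by_cases ht : t = 0
          · rw [hz', ht, zero_smul, zero_add]
            exact Subalgebra.algebraMap_mem _ _
          · exact absurd (h z t n hz' ht) hz
      have hadd : ∀ z w : B, z * w + w * z ∈ (⊥ : Subalgebra F B) := by
        intro z w
        have : z * w + w * z = (z + w) * (z + w) - z * z - w * w := by noncomm_ring
        rw [this]
        exact sub_mem (sub_mem (hsq _) (hsq _)) (hsq _)
      obtain ⟨y, hy⟩ : ∃ y, y * x ≠ x * y := by
        by_contra! h
        exact hx (Algebra.IsCentral.out (Subalgebra.mem_center_iff.2 h))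
      obtain ⟨c, hc⟩ := Algebra.mem_bot.1 (hadd x y)
      have hc0 : c ≠ 0 := by
        rintro rfl
        rw [map_zero, eq_comm, add_eq_zero_iff_eq_neg, hneg] at hc
        exact hy hc.symm
      refine hx ?_
      have h₁ := hadd x (x * y)
      rw [mul_assoc x y x, ← mul_add, ← hc, ← Algebra.commutes, ← Algebra.smul_def] at h₁
      simpa [smul_smul, hc0] using Subalgebra.smul_mem _ h₁ c⁻¹
    refine ⟨t⁻¹ • z, (t⁻¹) ^ 2 * n, ?_, fun h => ht.2 ?_⟩
    · rw [smul_mul_smul_comm, hz, smul_add, smul_smul, Algebra.algebraMap_eq_smul_one, smul_smul,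
        mul_assoc, inv_mul_cancel₀ ht.1, mul_one, ← sq, add_comm]
    · simpa [smul_smul, ht.1] using Subalgebra.smul_mem _ h t
  · simp only [if_neg h2, zero_smul, add_zero]
    obtain ⟨t, n, ht⟩ := hrel x
    refine ⟨x - algebraMap F B (t / 2), n + (t / 2) ^ 2, ?_, fun h => hx ?_⟩
    · rw [sub_mul, mul_sub, mul_sub, ← Algebra.commutes, ← Algebra.smul_def, ht,
        ← map_mul, Algebra.algebraMap_eq_smul_one, Algebra.algebraMap_eq_smul_one]
      have : t = t / 2 + t / 2 := by field_simp; ring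
      nth_rewrite 1 [this]
      module
    · simpa using add_mem h (Subalgebra.algebraMap_mem _ (t / 2))

theorem QuatAlg.exists_standardForm (B : QuatAlg F) :
    ∃ a b : F, IsStdParam a b ∧ Nonempty (StdQuat a b ≃ₐ[F] B.carrier) := by
  classical
  have : FiniteDimensional F B.carrier := Module.finite_of_finrank_pos (by rw [B.finrank_eq]; omega)
  have : IsArtinianRing B.carrier := IsArtinianRing.of_finite F _
  obtain ⟨n, hn, D, hD, hA, hfin, ⟨e⟩⟩ :=
    IsSimpleRing.exists_algEquiv_matrix_divisionRing_finite F B.carrier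
  have hdim : n * n * Module.finrank F D = 4 := by
    rw [← B.finrank_eq, e.toLinearEquiv.finrank_eq, Module.finrank_matrix]
    simp
  have hpos : 0 < Module.finrank F D := Module.finrank_pos
  have hn2 : n ≤ 2 := by
    by_contra! h
    have : 3 * 3 * 1 ≤ n * n * Module.finrank F D := by gcongr <;> omega
    omega
  have hn0 := NeZero.ne n
  obtain rfl | rfl : n = 1 ∨ n = 2 := by omega
  · refine exists_standardForm_of_division B.finrank_eq fun x hx => ?_
    have hne : e x 0 0 ≠ 0 := by
      intro h
      refine hx (e.injective ?_)
      ext i j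
      rw [Subsingleton.elim i 0, Subsingleton.elim j 0, h, map_zero]; rfl
    have hu : IsUnit (e x) := by
      refine ⟨⟨e x, Matrix.of fun _ _ => (e x 0 0)⁻¹, ?_, ?_⟩, rfl⟩ <;> ext i j <;>
        rw [Subsingleton.elim i 0, Subsingleton.elim j 0, Matrix.mul_apply] <;> simp [hne]
    simpa using hu
  · have hD1 : Module.finrank F D = 1 := by omega
    have hbij : Function.Bijective (algebraMap F D) := by
      refine ⟨(algebraMap F D).injective, fun x => ?_⟩
      have := (Subalgebra.bot_eq_top_iff_finrank_eq_one (F := F) (E := D)).2 hD1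
      exact Algebra.mem_bot.1 (this ▸ Algebra.mem_top : x ∈ (⊥ : Subalgebra F D))
    have hstd : IsStdParam (1 : F) 1 := ⟨one_ne_zero, fun _ => one_ne_zero⟩
    obtain ⟨e', -⟩ := (companionBasis (F := F) (α := 1) (u := 1) (w := 0) (γ := 1)
      (β := if (2 : F) = 0 then 1 else 0) (by ring)).exists_algEquiv hstd.disc_ne_zero
        one_ne_zero (by rw [Module.finrank_matrix]; simp)
    exact ⟨1, 1, hstd, ⟨e'.trans ((AlgEquiv.mapMatrix
      (AlgEquiv.ofBijective (Algebra.ofId F D) hbij)).trans e.symm)⟩⟩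

end StandardForm

/-! ### Splittings and rational points -/

section Splitting

open Matrix QuaternionAlgebra

variable {F : Type u} [Field F]

/-- The relations of `(a, b | F)` in the matrix ring, given a root `l` of `X² - β X - α`. -/
def diagonalBasis {α β γ l : F} (h : l ^ 2 = β * l + α) :
    QuaternionAlgebra.Basis (Matrix (Fin 2) (Fin 2) F) α β γ where
  i := !![l, 0; 0, β - l]
  j := !![0, γ; 1, 0]
  k := !![l, 0; 0, β - l] * !![0, γ; 1, 0]
  i_mul_i := by
    obtain rfl : α = l ^ 2 - β * l := by rw [h]; ring
    ext i j; fin_cases i <;> fin_cases j <;> simp [Matrix.mul_apply] <;> ring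
  j_mul_j := by
    ext i j; fin_cases i <;> fin_cases j <;> simp [Matrix.mul_apply]
  i_mul_j := rfl
  j_mul_i := by
    ext i j; fin_cases i <;> fin_cases j <;> simp [Matrix.mul_apply]
    ring

open Classical in
/-- A solution `(u, w)` of `u² + β u w - a w² = b`, the norm equation that splits `(a, b | F)`,
computed from a zero of the norm form with nonzero first coordinate. -/
noncomputable def splittingCoord (a b : F) (v : Fin 3 → F) : F × F :=
  if (2 : F) = 0 then (b * v 1 / v 0, b * v 2 / v 0) else (b * v 2 / v 0, b * v 1 / (a * v 0))

open Classical in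
/-- The images of `i` and `j` under the splitting of `(a, b | F)` given by a zero of its norm form.
If the first coordinate vanishes, then `X² - β X - a` has a root. -/
noncomputable def splittingPair (a b : F) (v : Fin 3 → F) :
    Matrix (Fin 2) (Fin 2) F × Matrix (Fin 2) (Fin 2) F :=
  letI β : F := if (2 : F) = 0 then 1 else 0
  letI p := splittingCoord a b v
  if v 0 = 0 then (!![v 1 / v 2, 0; 0, β - v 1 / v 2], !![0, b; 1, 0])
  else (!![0, a; 1, β], !![p.1, β * p.1 - a * p.2; p.2, -p.1])

/-- The given matrices satisfy the relations of `(a, b | F)`, and an algebra homomorphism from a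
central simple algebra onto one of the same dimension is an isomorphism. -/
theorem exists_splitting {a b : F} (h : IsStdParam a b) {v : Fin 3 → F} (hv : v ≠ 0)
    (hQ : (normForm a b).eval v = 0) :
    ∃ φ : StdQuat a b ≃ₐ[F] Matrix (Fin 2) (Fin 2) F,
      φ ⟨0, 1, 0, 0⟩ = (splittingPair a b v).1 ∧ φ ⟨0, 0, 1, 0⟩ = (splittingPair a b v).2 ∧
      φ ⟨0, 0, 0, 1⟩ = (splittingPair a b v).1 * (splittingPair a b v).2 := by
  have hM : Module.finrank F (Matrix (Fin 2) (Fin 2) F) = 4 := by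
    rw [Module.finrank_matrix]; simp
  have hb := h.1
  by_cases h0 : v 0 = 0
  · have h2 : v 2 ≠ 0 := by
      intro h2
      refine hv ?_
      have h1 : v 1 = 0 := by
        unfold normForm at hQ
        split_ifs at hQ <;> simpa [TernaryForm.eval, h0, h2, hb] using hQ
      funext i
      fin_cases i <;> assumption
    have hl : (v 1 / v 2) ^ 2 = (open Classical in if (2 : F) = 0 then 1 else 0) * (v 1 / v 2)
        + a := by
      field_simp
      refine mul_left_cancel₀ hb ?_
      by_cases hc : (2 : F) = 0
      · rw [normForm, if_pos hc, TernaryForm.eval, h0] at hQ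
        rw [if_pos hc]
        linear_combination hQ - b * v 2 * (v 1 + a * v 2) * hc
      · rw [normForm, if_neg hc, TernaryForm.eval, h0] at hQ
        rw [if_neg hc]
        linear_combination -hQ
    obtain ⟨φ, hφ⟩ := (diagonalBasis (γ := b) hl).exists_algEquiv h.disc_ne_zero hb hM
    refine ⟨φ, ?_, ?_, ?_⟩ <;> rw [hφ] <;>
      simp [QuaternionAlgebra.Basis.lift, diagonalBasis, splittingPair, h0]
  · have hp : (splittingCoord a b v).1 ^ 2 + (open Classical in if (2 : F) = 0 then 1 else 0)
        * (splittingCoord a b v).1 * (splittingCoord a b v).2 - a * (splittingCoord a b v).2 ^ 2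
        = b := by
      by_cases hc : (2 : F) = 0
      · rw [normForm, if_pos hc, TernaryForm.eval] at hQ
        rw [splittingCoord, if_pos hc, if_pos hc]
        field_simp
        linear_combination hQ - (v 0 ^ 2 + a * b * v 2 ^ 2) * hc
      · have ha := h.2 hc
        rw [normForm, if_neg hc, TernaryForm.eval] at hQ
        rw [splittingCoord, if_neg hc, if_neg hc]
        field_simp
        linear_combination hQ
    obtain ⟨φ, hφ⟩ := (companionBasis hp).exists_algEquiv h.disc_ne_zero hb hM
    refine ⟨φ, ?_, ?_, ?_⟩ <;> rw [hφ] <;>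
      simp [QuaternionAlgebra.Basis.lift, companionBasis, splittingPair, h0]

/-- The zero of the norm form of `(a, b | F)` computed from an isomorphism with the matrix ring:
it spans the elements of trace zero whose image has vanishing first column. -/
noncomputable def splittingPoint {a b : F} (φ : StdQuat a b ≃ₐ[F] Matrix (Fin 2) (Fin 2) F) :
    Fin 3 → F :=
  crossProduct (fun l => φ (pureQuat a b (Pi.single l 1)) 0 0)
    (fun l => φ (pureQuat a b (Pi.single l 1)) 1 0)

theorem pureQuat_eq_sum (a b : F) (v : Fin 3 → F) :
    pureQuat a b v = ∑ l, v l • pureQuat a b (Pi.single l 1) := by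
  unfold pureQuat
  split_ifs <;> ext <;> simp [Fin.sum_univ_three]

theorem apply_pureQuat_eq_dotProduct {a b : F} (φ : StdQuat a b ≃ₐ[F] Matrix (Fin 2) (Fin 2) F)
    (v : Fin 3 → F) (i j : Fin 2) :
    φ (pureQuat a b v) i j = v ⬝ᵥ fun l => φ (pureQuat a b (Pi.single l 1)) i j := by
  rw [pureQuat_eq_sum, map_sum, Matrix.sum_apply, dotProduct]
  simp

/-- A nonscalar element with scalar square has trace zero. -/
theorem exists_pureQuat_eq_of_mul_self {a b d : F} {x : StdQuat a b}
    (hx : x * x = algebraMap F _ d) (hxF : ∀ c, algebraMap F _ c ≠ x) :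
    ∃ v, pureQuat a b v = x := by
  obtain ⟨t, ht⟩ := isStandardInvolution_star.exists_eq_sub x
  obtain ⟨n, hn⟩ := isStandardInvolution_star.standard x
  refine exists_pureQuat_eq ?_
  change star x = _ at ht
  change x * star x = _ at hn
  rw [ht] at hn ⊢
  by_cases ht0 : t = 0
  · simp [ht0]
  · refine absurd ?_ (hxF (t⁻¹ * (n + d)))
    rw [map_mul, map_add, ← hn, ← hx, mul_sub, sub_add_cancel, ← Algebra.commutes t x, ← mul_assoc,
      ← map_mul, inv_mul_cancel₀ ht0, map_one, one_mul]

theorem eval_splittingPoint {a b : F} (φ : StdQuat a b ≃ₐ[F] Matrix (Fin 2) (Fin 2) F) :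
    (normForm a b).eval (splittingPoint φ) = 0 := by
  have h₀ : φ (pureQuat a b (splittingPoint φ)) 0 0 = 0 := by
    rw [apply_pureQuat_eq_dotProduct, splittingPoint, dotProduct_comm, dot_self_cross]
  have h₁ : φ (pureQuat a b (splittingPoint φ)) 1 0 = 0 := by
    rw [apply_pureQuat_eq_dotProduct, splittingPoint, dotProduct_comm, dot_cross_self]
  have h := congrArg (fun x => φ x 0 0) (pureQuat_mul_self a b (splittingPoint φ))
  simp only [map_mul, Matrix.mul_apply, Fin.sum_univ_two, h₀, h₁, AlgEquiv.commutes] at h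
  simpa [Matrix.algebraMap_matrix_apply] using h

/-- If the cross product vanished, then some nontrivial combination of the entries in the first
column would vanish on the images of all elements of trace zero; but these include a nilpotent
matrix unit, and the identity or `diag(1, -1)`. -/
theorem splittingPoint_ne_zero {a b : F} (φ : StdQuat a b ≃ₐ[F] Matrix (Fin 2) (Fin 2) F) :
    splittingPoint φ ≠ 0 := by
  rw [splittingPoint, crossProduct_ne_zero_iff_linearIndependent, LinearIndependent.pair_iff]
  intro c d hcd
  have key : ∀ v, c * φ (pureQuat a b v) 0 0 + d * φ (pureQuat a b v) 1 0 = 0 := by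
    intro v
    rw [apply_pureQuat_eq_dotProduct, apply_pureQuat_eq_dotProduct, ← smul_eq_mul, ← smul_eq_mul,
      ← dotProduct_smul, ← dotProduct_smul, ← dotProduct_add, hcd, dotProduct_zero]
  have lift : ∀ (X : Matrix (Fin 2) (Fin 2) F) (e : F), X * X = algebraMap F _ e →
      (∀ s, algebraMap F _ s ≠ X) → c * X 0 0 + d * X 1 0 = 0 := by
    intro X e hX hXF
    obtain ⟨v, hv⟩ := exists_pureQuat_eq_of_mul_self (a := a) (b := b) (x := φ.symm X) (d := e)
      (by rw [← map_mul, hX, AlgEquiv.commutes]) fun s hs => hXF s (by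
        rw [← φ.commutes, hs, AlgEquiv.apply_symm_apply])
    simpa [hv] using key v
  have hd : d = 0 := by
    have := lift !![0, 0; 1, 0] 0 (by ext i j; fin_cases i <;> fin_cases j <;> simp)
      fun s hs => by simpa [Matrix.algebraMap_matrix_apply] using congrFun (congrFun hs 1) 0
    simpa using this
  refine ⟨?_, hd⟩
  by_cases h2 : (2 : F) = 0
  · have := key (Pi.single 0 1)
    have h1 : pureQuat a b (Pi.single 0 1) = 1 := by
      rw [pureQuat, if_pos h2]; ext <;> simp
    simpa [h1] using this
  · have := lift !![1, 0; 0, -1] 1 (by ext i j; fin_cases i <;> fin_cases j <;> simp)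
      fun s hs => h2 ?_
    · simpa using this
    · have h₀ := congrFun (congrFun hs 0) 0
      have h₁ := congrFun (congrFun hs 1) 1
      simp [Matrix.algebraMap_matrix_apply] at h₀ h₁
      linear_combination h₁ - h₀

end Splitting

/-! ### Similar norm forms belong to isomorphic algebras -/

section Similarity

open Matrix QuaternionAlgebra

variable {F : Type u} [Field F]

/-- Products of two anticommuting elements with scalar squares satisfy quaternion relations. -/
theorem exists_basis_of_anticommute {A : Type*} [Ring A] [Algebra F A] {e₀ e₁ e₂ : A} {p q s β : F}
    (h₀ : e₀ * e₀ = p • 1) (h₁ : e₁ * e₁ = q • 1) (h₂ : e₂ * e₂ = s • 1)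
    (h₁₀ : e₁ * e₀ = -(e₀ * e₁)) (h₂₀ : e₂ * e₀ = -(e₀ * e₂)) (h₂₁ : e₂ * e₁ = -(e₁ * e₂))
    (hp : p ≠ 0) (hq : q ≠ 0) (hβ : β = 0) :
    Nonempty (QuaternionAlgebra.Basis A (-(s / q)) β (-(s / p))) := by
  subst hβ
  have assoc : ∀ {x y z : A} (w : A), x * y = z → x * (y * w) = z * w :=
    fun w h => by rw [← mul_assoc, h]
  refine ⟨⟨q⁻¹ • (e₁ * e₂), p⁻¹ • (e₂ * e₀), (q⁻¹ • (e₁ * e₂)) * (p⁻¹ • (e₂ * e₀)), ?_, ?_, rfl,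
    ?_⟩⟩ <;>
    simp only [mul_assoc, fun w => assoc w h₂₀, fun w => assoc w h₂₁, h₀, h₁, h₂, h₁₀, h₂₀,
      smul_mul_assoc, mul_smul_comm, neg_mul, mul_neg, mul_one, neg_neg, smul_neg, smul_smul]
  · match_scalars <;> field_simp
    ring
  · match_scalars
    field_simp
  · match_scalars <;> field_simp
    ring

/-- The analogue of `exists_basis_of_anticommute` when `e₁` and `e₂` do not anticommute but
`e₁ e₂ + e₂ e₁ = e₁²`. -/
theorem exists_basis_of_anticommute' {A : Type*} [Ring A] [Algebra F A] {e₀ e₁ e₂ : A} {p q s β : F}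
    (h₀ : e₀ * e₀ = p • 1) (h₁ : e₁ * e₁ = q • 1) (h₂ : e₂ * e₂ = s • 1)
    (h₁₀ : e₁ * e₀ = -(e₀ * e₁)) (h₂₀ : e₂ * e₀ = -(e₀ * e₂)) (h₂₁ : e₂ * e₁ = q • 1 - e₁ * e₂)
    (hq : q ≠ 0) (hβ : β = 1) (c : F) :
    Nonempty (QuaternionAlgebra.Basis A (-(s / q)) β (-(c ^ 2 * p * q))) := by
  subst hβ
  have assoc : ∀ {x y z : A} (w : A), x * y = z → x * (y * w) = z * w :=
    fun w h => by rw [← mul_assoc, h]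
  refine ⟨⟨q⁻¹ • (e₁ * e₂), c • (e₀ * e₁), (q⁻¹ • (e₁ * e₂)) * (c • (e₀ * e₁)), ?_, ?_, rfl,
    ?_⟩⟩ <;>
    simp only [mul_assoc, fun w => assoc w h₁, fun w => assoc w h₁₀, fun w => assoc w h₂₀,
      fun w => assoc w h₂₁, h₀, h₁, h₂, h₁₀, h₂₁, smul_mul_assoc, mul_smul_comm, neg_mul, mul_neg,
      one_mul, mul_one, smul_neg, smul_smul, sub_mul, mul_sub, smul_sub]
  · match_scalars <;> field_simp
  · match_scalars <;> field_simp
  · match_scalars <;> field_simp <;> ring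

/-- If the norm forms are similar, then products of two elements of trace zero satisfy the relations
of the other algebra; the factor of similarity drops out. -/
theorem algEquiv_of_act_eq_smul {a b a' b' : F} (h : IsStdParam a b) {M : Matrix (Fin 3) (Fin 3) F}
    {k : F} (hk : k ≠ 0) (hM : (normForm a' b').act M = k • normForm a b) :
    Nonempty (StdQuat a b ≃ₐ[F] StdQuat a' b') := by
  have hb := h.1
  have hsq : ∀ l, pureQuat a' b' (fun i => M i l) * pureQuat a' b' (fun i => M i l)
      = (-(k * (normForm a b).eval (Pi.single l 1))) • 1 := by
    intro l
    rw [pureQuat_mul_self, ← TernaryForm.eval_smul, ← hM, TernaryForm.eval_act,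
      Algebra.algebraMap_eq_smul_one, Matrix.mulVec_single_one]
    rfl
  have hadd : ∀ l m, pureQuat a' b' (fun i => M i l) * pureQuat a' b' (fun i => M i m)
      = (-(k * (normForm a b).polar (Pi.single m 1) (Pi.single l 1))) • 1
        - pureQuat a' b' (fun i => M i m) * pureQuat a' b' (fun i => M i l) := by
    intro l m
    rw [eq_sub_iff_add_eq, add_comm, pureQuat_mul_add_mul, ← TernaryForm.polar_smul, ← hM,
      TernaryForm.polar_act,
      Algebra.algebraMap_eq_smul_one, Matrix.mulVec_single_one, Matrix.mulVec_single_one]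
    rfl
  have h₀ := hsq 0
  have h₁ := hsq 1
  have h₂ := hsq 2
  have h₁₀ := hadd 1 0
  have h₂₀ := hadd 2 0
  have h₂₁ := hadd 2 1
  clear hsq hadd
  generalize pureQuat a' b' (fun i => M i 0) = e₀ at *
  generalize pureQuat a' b' (fun i => M i 1) = e₁ at *
  generalize pureQuat a' b' (fun i => M i 2) = e₂ at *
  by_cases h2 : (2 : F) = 0
  · have hneg : ∀ z : F, -z = z := fun z => by linear_combination -z * h2
    simp only [normForm, if_pos h2, TernaryForm.eval, TernaryForm.polar] at h₀ h₁ h₂ h₁₀ h₂₀ h₂₁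
    simp [h2] at h₀ h₁ h₂ h₁₀ h₂₀ h₂₁
    obtain ⟨B⟩ := exists_basis_of_anticommute' (p := -k) (q := -(k * b)) (s := -(k * (a * b)))
      (by simpa using h₀) (by simpa using h₁) (by simpa using h₂) h₁₀ h₂₀ (by simpa using h₂₁)
      (by simp [hk, hb]) (if_pos h2) k⁻¹
    have hα : -(-(k * (a * b)) / -(k * b)) = a := by rw [hneg]; field_simp
    have hγ : -(k⁻¹ ^ 2 * -k * -(k * b)) = b := by rw [hneg]; field_simp
    rw [hα, hγ] at B
    obtain ⟨e, -⟩ := B.exists_algEquiv h.disc_ne_zero hb (QuaternionAlgebra.finrank_eq_four ..)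
    exact ⟨e⟩
  · have ha := h.2 h2
    simp [normForm, if_neg h2, TernaryForm.eval, TernaryForm.polar] at h₀ h₁ h₂ h₁₀ h₂₀ h₂₁
    obtain ⟨B⟩ := exists_basis_of_anticommute h₀ h₁ (s := -(k * (a * b))) (by simpa using h₂)
      h₁₀ h₂₀ h₂₁ (mul_ne_zero hk ha) (mul_ne_zero hk hb) (if_neg h2)
    have hα : -(-(k * (a * b)) / (k * b)) = a := by field_simp
    have hγ : -(-(k * (a * b)) / (k * a)) = b := by field_simp
    rw [hα, hγ] at B
    obtain ⟨e, -⟩ := B.exists_algEquiv h.disc_ne_zero hb (QuaternionAlgebra.finrank_eq_four ..)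
    exact ⟨e⟩

end Similarity

/-! ### Reduction of a nonsingular ternary form to a norm form -/

namespace TernaryForm

open Matrix

variable {F : Type*} [Field F]

theorem Nonsingular.exists_polar_ne_zero {Q : TernaryForm F} (h : Q.Nonsingular) {v : Fin 3 → F}
    (hv : v ≠ 0) (hQ : Q.eval v = 0) : ∃ w, Q.polar v w ≠ 0 := by
  obtain ⟨i, hi⟩ := h (fun j => algebraMap F _ (v j))
    (fun h0 => hv (funext fun j => by simpa using congrFun h0 j))
    (by rw [aeval_poly, eval_map, hQ, map_zero])
  refine ⟨Pi.single i 1, fun h0 => hi ?_⟩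
  have : (Pi.single i 1 : Fin 3 → AlgebraicClosure F)
      = fun j => algebraMap F _ ((Pi.single i 1 : Fin 3 → F) j) := by
    funext j
    by_cases hj : j = i
    · subst hj; simp
    · simp [hj]
  rw [aeval_pderiv_poly, this, polar_map, h0, map_zero]

/-- In characteristic two a nonsingular form has nonzero polar form: otherwise it is the square of
a linear form over the algebraic closure. -/
theorem Nonsingular.polar_ne_zero {Q : TernaryForm F} (h : Q.Nonsingular) (h2 : (2 : F) = 0) :
    ¬ (Q.r = 0 ∧ Q.s = 0 ∧ Q.t = 0) := by
  rintro ⟨hr, hs, ht⟩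
  have h2' : (2 : AlgebraicClosure F) = 0 := by
    rw [← map_ofNat (algebraMap F (AlgebraicClosure F)) 2, h2, map_zero]
  rw [nonsingular_iff] at h
  have hpol : ∀ v w, (Q.map (algebraMap F (AlgebraicClosure F))).polar v w = 0 := by
    intro v w
    simp [polar, map, hr, hs, ht, h2']
  by_cases ha : Q.a = 0
  · obtain ⟨w, hw⟩ := h ![1, 0, 0] (fun h0 => by simpa using congrFun h0 0)
      (by simp [eval, map, ha])
    exact hw (hpol _ _)
  · obtain ⟨x, hx⟩ := IsAlgClosed.exists_pow_nat_eq
      (-(algebraMap F (AlgebraicClosure F) Q.b / algebraMap F _ Q.a)) (n := 2) two_pos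
    obtain ⟨w, hw⟩ := h ![x, 1, 0] (fun h0 => by simpa using congrFun h0 1) (by
      have : algebraMap F (AlgebraicClosure F) Q.a ≠ 0 := by simpa using ha
      simp [eval, map, hr, hs, ht, hx]
      field_simp
      ring)
    exact hw (hpol _ _)

open Classical in
/-- A change of variables whose first basis vector is anisotropic. In characteristic two this vector
spans the radical of the polar form. -/
noncomputable def anisotropicStep (Q : TernaryForm F) : Matrix (Fin 3) (Fin 3) F :=
  if (2 : F) = 0 then
    if Q.r = 0 then
      if Q.s = 0 then !![Q.r, 1, 0; Q.s, 0, 1; Q.t, 0, 0] else !![Q.r, 1, 0; Q.s, 0, 0; Q.t, 0, 1]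
    else !![Q.r, 0, 0; Q.s, 1, 0; Q.t, 0, 1]
  else
    if Q.a = 0 then
      if Q.b = 0 then
        if Q.c = 0 then
          if Q.t = 0 then !![1, 0, 0; 0, 1, 0; 1, 0, 1] else !![1, 0, 0; 1, 1, 0; 0, 0, 1]
        else !![0, 0, 1; 0, 1, 0; 1, 0, 0]
      else !![0, 1, 0; 1, 0, 0; 0, 0, 1]
    else !![1, 0, 0; 0, 1, 0; 0, 0, 1]

open Classical in
/-- The change of variables that splits off the first variable. -/
noncomputable def orthogonalStep (Q : TernaryForm F) : Matrix (Fin 3) (Fin 3) F :=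
  if (2 : F) = 0 then !![1, 0, 0; 0, 1, 0; 0, 0, 1]
  else !![1, -(Q.t / (2 * Q.a)), -(Q.s / (2 * Q.a)); 0, 1, 0; 0, 0, 1]

open Classical in
/-- A change of the last two variables that makes the second basis vector anisotropic. -/
noncomputable def binaryStep (Q : TernaryForm F) : Matrix (Fin 3) (Fin 3) F :=
  if Q.b = 0 then
    if Q.c = 0 then !![1, 0, 0; 0, 1, 0; 0, 1, 1] else !![1, 0, 0; 0, 0, 1; 0, 1, 0]
  else !![1, 0, 0; 0, 1, 0; 0, 0, 1]

open Classical in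
/-- The change of variables that diagonalizes the binary part, or scales the last variable if the
characteristic is two. -/
noncomputable def finalStep (Q : TernaryForm F) : Matrix (Fin 3) (Fin 3) F :=
  if (2 : F) = 0 then !![1, 0, 0; 0, 1, 0; 0, 0, Q.b / Q.r]
  else !![1, 0, 0; 0, 1, -(Q.r / (2 * Q.b)); 0, 0, 1]

/-- A form whose first variable is split off, with anisotropic first basis vector. -/
structure IsSplit (Q : TernaryForm F) : Prop where
  a_ne_zero : Q.a ≠ 0
  s_eq_zero : Q.s = 0
  t_eq_zero : Q.t = 0

theorem isUnit_det_anisotropicStep {Q : TernaryForm F} (h : Q.Nonsingular) :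
    IsUnit Q.anisotropicStep.det := by
  unfold anisotropicStep
  split_ifs with h2 hr hs <;> simp [Matrix.det_fin_three]
  · exact fun ht => h.polar_ne_zero h2 ⟨hr, hs, ht⟩
  · exact hs
  · exact hr

theorem a_act_anisotropicStep_ne_zero {Q : TernaryForm F} (h : Q.Nonsingular) :
    (Q.act Q.anisotropicStep).a ≠ 0 := by
  by_cases h2 : (2 : F) = 0
  · have hρ : (fun i => Q.anisotropicStep i 0) = ![Q.r, Q.s, Q.t] := by
      unfold anisotropicStep
      rw [if_pos h2]
      split_ifs <;> funext i <;> fin_cases i <;> rfl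
    intro h0
    change Q.eval (fun i => Q.anisotropicStep i 0) = 0 at h0
    rw [hρ] at h0
    obtain ⟨w, hw⟩ := h.exists_polar_ne_zero (fun h' => h.polar_ne_zero h2
      ⟨congrFun h' 0, congrFun h' 1, congrFun h' 2⟩) h0
    refine hw ?_
    simp [polar, h2]
    linear_combination (Q.r * Q.s * w 2 + Q.r * Q.t * w 1 + Q.s * Q.t * w 0) * h2
  · unfold anisotropicStep
    rw [if_neg h2]
    split_ifs with ha hb hc ht <;> simp [act, eval, *]
    intro hs
    obtain ⟨w, hw⟩ := h.exists_polar_ne_zero (v := ![1, 0, 0])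
      (fun h' => by simpa using congrFun h' 0) (by simp [eval, ha])
    exact hw (by simp [polar, ha, hs, ht])

theorem isUnit_det_orthogonalStep (Q : TernaryForm F) : IsUnit Q.orthogonalStep.det := by
  unfold orthogonalStep
  split_ifs <;> simp [Matrix.det_fin_three]

theorem isUnit_det_binaryStep (Q : TernaryForm F) : IsUnit Q.binaryStep.det := by
  unfold binaryStep
  split_ifs <;> simp [Matrix.det_fin_three]

theorem isSplit_orthogonalStep {Q : TernaryForm F} (h : Q.Nonsingular) :
    ((Q.act Q.anisotropicStep).act (Q.act Q.anisotropicStep).orthogonalStep).IsSplit := by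
  have ha := a_act_anisotropicStep_ne_zero h
  by_cases h2 : (2 : F) = 0
  · have h1 : (Q.act Q.anisotropicStep).orthogonalStep = 1 := by
      rw [orthogonalStep, if_pos h2]
      exact Matrix.one_fin_three.symm
    rw [h1, act_one]
    refine ⟨ha, ?_, ?_⟩ <;>
    · simp only [anisotropicStep, if_pos h2]
      split_ifs <;> simp [act, polar, *] <;> ring_nf <;> simp [h2]
  · generalize Q.act Q.anisotropicStep = Q' at *
    refine ⟨?_, ?_, ?_⟩
    · simpa [orthogonalStep, if_neg h2, act, eval] using ha
    · simp [orthogonalStep, if_neg h2, act, polar]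
      field_simp
      ring
    · simp [orthogonalStep, if_neg h2, act, polar]
      field_simp
      ring

theorem IsSplit.binaryStep {Q : TernaryForm F} (h : Q.IsSplit) (hQ : Q.Nonsingular) :
    (Q.act Q.binaryStep).IsSplit ∧ (Q.act Q.binaryStep).b ≠ 0 := by
  obtain ⟨ha, hs, ht⟩ := h
  unfold TernaryForm.binaryStep
  split_ifs with hb hc
  · refine ⟨⟨?_, ?_, ?_⟩, ?_⟩ <;> simp [act, eval, polar, *]
    intro hr
    obtain ⟨w, hw⟩ := hQ.exists_polar_ne_zero (v := ![0, 1, 0])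
      (fun h' => by simpa using congrFun h' 1) (by simp [eval, hb])
    exact hw (by simp [polar, hb, ht, hr])
  · refine ⟨⟨?_, ?_, ?_⟩, ?_⟩ <;> simp [act, eval, polar, *]
  · refine ⟨⟨?_, ?_, ?_⟩, ?_⟩ <;> simp [act, eval, polar, *]

/-- The parameter `a` of the norm form similar to the result of `finalStep`. -/
def paramA (Q : TernaryForm F) : F := -(Q.c / Q.b)

open Classical in
/-- The parameter `b` of the norm form similar to the result of `finalStep`. -/
noncomputable def paramB (Q : TernaryForm F) : F := if (2 : F) = 0 then Q.b / Q.a else -(Q.c / Q.a)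

theorem IsSplit.finalStep {Q : TernaryForm F} (h : Q.IsSplit) (hb : Q.b ≠ 0)
    (hQ : Q.Nonsingular) : IsUnit Q.finalStep.det ∧
      IsStdParam (Q.act Q.finalStep).paramA (Q.act Q.finalStep).paramB ∧
      ∃ k : F, k ≠ 0 ∧ Q.act Q.finalStep
        = k • normForm (Q.act Q.finalStep).paramA (Q.act Q.finalStep).paramB := by
  obtain ⟨ha, hs, ht⟩ := h
  by_cases h2 : (2 : F) = 0
  · have hr : Q.r ≠ 0 := fun hr => hQ.polar_ne_zero h2 ⟨hr, hs, ht⟩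
    have hact : Q.act Q.finalStep = ⟨Q.a, Q.b, Q.c * (Q.b / Q.r) ^ 2, Q.b, 0, 0⟩ := by
      simp only [TernaryForm.finalStep, if_pos h2]
      ext <;> simp [act, eval, polar, *]
      field_simp
    rw [hact]
    refine ⟨?_, ⟨?_, fun h => absurd h2 h⟩, Q.a, ha, ?_⟩
    · simp [TernaryForm.finalStep, if_pos h2, Matrix.det_fin_three, hb, hr]
    · simp [paramB, h2, hb, ha]
    · have hneg : ∀ x : F, -x = x := fun x => by linear_combination -x * h2
      simp only [normForm, paramA, paramB, if_pos h2, smul_def, mk.injEq, hneg]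
      refine ⟨?_, ?_, ?_, ?_, ?_, ?_⟩ <;> field_simp <;> simp
  · obtain ⟨c, hact⟩ : ∃ c, Q.act Q.finalStep = ⟨Q.a, Q.b, c, 0, 0, 0⟩ := by
      refine ⟨(Q.act Q.finalStep).c, ?_⟩
      simp only [TernaryForm.finalStep, if_neg h2]
      ext <;> simp [act, eval, polar, *]
      field_simp
      ring
    have hdet : IsUnit Q.finalStep.det := by
      simp [TernaryForm.finalStep, if_neg h2, Matrix.det_fin_three]
    have hc : c ≠ 0 := by
      have h' := hQ.act hdet
      rw [hact] at h'
      rintro rfl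
      obtain ⟨w, hw⟩ := h'.exists_polar_ne_zero (v := ![0, 0, 1])
        (fun h' => by simpa using congrFun h' 2) (by simp [eval])
      exact hw (by simp [polar])
    rw [hact]
    refine ⟨hdet, ⟨?_, fun _ => ?_⟩, Q.a * Q.b / c, ?_, ?_⟩
    · simp [paramB, h2, hc, ha]
    · simp [paramA, hc, hb]
    · simp [ha, hb, hc]
    · simp only [normForm, paramA, paramB, if_neg h2, smul_def, mk.injEq]
      refine ⟨?_, ?_, ?_, ?_, ?_, ?_⟩ <;> field_simp <;> simp

/-- The composite of the changes of variables that reduce a nonsingular form to a multiple of a norm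
form. -/
noncomputable def reduction (Q : TernaryForm F) : Matrix (Fin 3) (Fin 3) F :=
  letI Q₁ := Q.act Q.anisotropicStep
  letI Q₂ := Q₁.act Q₁.orthogonalStep
  letI Q₃ := Q₂.act Q₂.binaryStep
  Q.anisotropicStep * Q₁.orthogonalStep * Q₂.binaryStep * Q₃.finalStep

theorem Nonsingular.reduction {Q : TernaryForm F} (h : Q.Nonsingular) :
    IsUnit Q.reduction.det ∧
      IsStdParam (Q.act Q.reduction).paramA (Q.act Q.reduction).paramB ∧
      ∃ k : F, k ≠ 0 ∧ Q.act Q.reduction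
        = k • normForm (Q.act Q.reduction).paramA (Q.act Q.reduction).paramB := by
  have hu₁ := isUnit_det_anisotropicStep h
  have hu₂ := isUnit_det_orthogonalStep (Q.act Q.anisotropicStep)
  have hsplit := isSplit_orthogonalStep h
  have hns := (h.act hu₁).act hu₂
  have hu₃ := isUnit_det_binaryStep
    ((Q.act Q.anisotropicStep).act (Q.act Q.anisotropicStep).orthogonalStep)
  obtain ⟨hs, hb⟩ := hsplit.binaryStep hns
  obtain ⟨hu₄, hp, hk⟩ := hs.finalStep hb (hns.act hu₃)
  refine ⟨?_, ?_⟩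
  · simp only [TernaryForm.reduction, Matrix.det_mul]
    exact ((hu₁.mul hu₂).mul hu₃).mul hu₄
  · simp only [TernaryForm.reduction, ← act_act]
    exact ⟨hp, hk⟩

end TernaryForm

/-! ### Morphisms between parametrized conics -/

section ParametrizedConic

open Matrix

/-- The form `y² - x z`, whose zeros are parametrized by `(1, t, t²)`. -/
def TernaryForm.parabola (R : Type*) [CommRing R] : TernaryForm R := ⟨0, 1, 0, 0, -1, 0⟩

theorem TernaryForm.eval_parabola {R : Type*} [CommRing R] (x : Fin 3 → R) :
    (parabola R).eval x = x 1 ^ 2 - x 0 * x 2 := by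
  simp [parabola, eval]; ring

theorem normForm_map {F L : Type u} [Field F] [Field L] (f : F →+* L) (a b : F) :
    (normForm a b).map f = normForm (f a) (f b) := by
  have h2 : (2 : L) = 0 ↔ (2 : F) = 0 := by
    rw [← map_ofNat f 2, map_eq_zero]
  by_cases h : (2 : F) = 0
  · rw [normForm, normForm, if_pos h, if_pos (h2.2 h)]
    simp [TernaryForm.map]
  · rw [normForm, normForm, if_neg h, if_neg (mt h2.1 h)]
    simp [TernaryForm.map]

theorem IsStdParam.map {F L : Type u} [Field F] [Field L] (f : F →+* L) {a b : F}
    (h : IsStdParam a b) : IsStdParam (f a) (f b) := by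
  refine ⟨by simpa using h.1, fun h2 => ?_⟩
  have : (2 : F) ≠ 0 := fun h0 => h2 (by rw [← map_ofNat f 2, h0, map_zero])
  simpa using h.2 this

/-- Over a separably closed field the norm forms are similar to `y² - x z`. -/
theorem IsStdParam.exists_act_eq_parabola {L : Type u} [Field L] [IsSepClosed L] {a b : L}
    (h : IsStdParam a b) : ∃ (B : Matrix (Fin 3) (Fin 3) L) (k : L), IsUnit B.det ∧ k ≠ 0 ∧
      (normForm a b).act B = k • TernaryForm.parabola L := by
  have hb := h.1
  by_cases h2 : (2 : L) = 0
  · obtain ⟨θ, hθ⟩ : ∃ θ : L, θ ^ 2 + θ + a = 0 := by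
      have hp :
          (Polynomial.X ^ 2 + Polynomial.X + Polynomial.C a : Polynomial L).natDegree = 2 := by
        compute_degree!
      obtain ⟨θ, hθ⟩ := IsSepClosed.exists_root
        (Polynomial.X ^ 2 + Polynomial.X + Polynomial.C a : Polynomial L)
        (fun h0 => by rw [Polynomial.natDegree_eq_of_degree_eq_some h0] at hp; simp at hp)
        (by
          rw [Polynomial.separable_def]
          have : Polynomial.derivative (Polynomial.X ^ 2 + Polynomial.X + Polynomial.C a :
              Polynomial L) = 1 := by
            simp [one_add_one_eq_two, h2]
          rw [this]
          exact isCoprime_one_right)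
      exact ⟨θ, by simpa using hθ⟩
    have h2' : ∀ x : L, -x = x := fun x => by linear_combination -x * h2
    refine ⟨!![0, 1, 0; (1 + θ) / b, 0, θ; 1 / b, 0, 1], 1, ?_, one_ne_zero, ?_⟩
    · simp [Matrix.det_fin_three]
      have : -((1 + θ) / b) + θ * b⁻¹ = -b⁻¹ := by field_simp; ring
      simp [this, hb]
    · rw [normForm, if_pos h2]
      have hθ' : a = -(θ ^ 2 + θ) := by linear_combination hθ
      subst hθ'
      simp only [TernaryForm.act, TernaryForm.parabola, TernaryForm.smul_def, TernaryForm.mk.injEq,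
        TernaryForm.eval, TernaryForm.polar]
      refine ⟨?_, ?_, ?_, ?_, ?_, ?_⟩ <;> simp <;> field_simp
      · linear_combination (1 + θ) * h2
      · ring
      · linear_combination (θ + 1) * h2
  · have ha := h.2 h2
    have : NeZero (2 : L) := ⟨h2⟩
    obtain ⟨α, rfl⟩ := IsSepClosed.exists_pow_nat_eq a 2
    obtain ⟨β, rfl⟩ := IsSepClosed.exists_pow_nat_eq b 2
    have hα : α ≠ 0 := by rintro rfl; simp at ha
    have hβ : β ≠ 0 := by rintro rfl; simp at hb
    refine ⟨!![-(1 / (2 * α)), 0, 1 / (2 * α); 0, 1 / β, 0;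
      1 / (2 * α * β), 0, 1 / (2 * α * β)], -1, ?_, by simp, ?_⟩
    · simp [Matrix.det_fin_three]
      have : -(α⁻¹ * 2⁻¹ * β⁻¹ * (β⁻¹ * (α⁻¹ * 2⁻¹))) - α⁻¹ * 2⁻¹ * β⁻¹ * (β⁻¹ * (α⁻¹ * 2⁻¹))
          = -(2 * α ^ 2 * β ^ 2)⁻¹ := by field_simp; ring
      simp [this, h2, hα, hβ]
    · rw [normForm, if_neg h2]
      simp only [TernaryForm.act, TernaryForm.parabola, TernaryForm.smul_def, TernaryForm.mk.injEq,
        TernaryForm.eval, TernaryForm.polar]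
      refine ⟨?_, ?_, ?_, ?_, ?_, ?_⟩ <;> simp <;> field_simp
      all_goals norm_num

/-- A separably closed field is infinite: over a field with `q` elements the separable polynomial
`X ^ q - X + 1` has no root. -/
theorem IsSepClosed.infinite (L : Type*) [Field L] [IsSepClosed L] : Infinite L := by
  by_contra hfin
  rw [not_infinite_iff_finite] at hfin
  have := Fintype.ofFinite L
  let p : Polynomial L := Polynomial.X ^ Fintype.card L - Polynomial.X + 1
  have hq : 1 < Fintype.card L := Fintype.one_lt_card
  have hdeg : p.natDegree = Fintype.card L := by
    simp only [p]
    compute_degree!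
    · split_ifs <;> simp_all
    · omega
  obtain ⟨x, hx⟩ := IsSepClosed.exists_root p
    (fun h0 => by
      have : p.natDegree = 0 := Polynomial.natDegree_eq_of_degree_eq_some h0
      omega) (by
      rw [Polynomial.separable_def]
      have : Polynomial.derivative p = -1 := by
        simp [p, Polynomial.derivative_X_pow]
      rw [this]
      exact isCoprime_one_right.neg_right)
  simp [p, FiniteField.pow_card] at hx

/-- The tuple of values of a tuple of polynomials in three variables. -/
noncomputable def polyMap {F A : Type*} [CommRing F] [CommRing A] [Algebra F A]
    (f : Fin 3 → MvPolynomial (Fin 3) F) (v : Fin 3 → A) : Fin 3 → A :=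
  fun i => MvPolynomial.aeval v (f i)

theorem polyMap_algHom {F A A' : Type*} [CommRing F] [CommRing A] [Algebra F A] [CommRing A']
    [Algebra F A'] (φ : A →ₐ[F] A') (f : Fin 3 → MvPolynomial (Fin 3) F) (v : Fin 3 → A)
    (i : Fin 3) : φ (polyMap f v i) = polyMap f (fun j => φ (v j)) i := by
  rw [polyMap, polyMap, ← AlgHom.comp_apply, MvPolynomial.comp_aeval]

theorem polyMap_smul {F K : Type*} [Field F] [Field K] [Algebra F K] {d : ℕ}
    {f : Fin 3 → MvPolynomial (Fin 3) F} (hf : ∀ i, (f i).IsHomogeneous d) (c : K)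
    (v : Fin 3 → K) : polyMap f (c • v) = c ^ d • polyMap f v :=
  funext fun i => aeval_smul_of_isHomogeneous (hf i) c v

/-- The parametrization of the zeros of `y² - x z` other than `(0, 0, 1)`. -/
def parabolaPoint {R : Type*} [CommRing R] (t : R) : Fin 3 → R := ![1, t, t ^ 2]

/-- The action on the points `(1, t, t²)` of the substitution `t ↦ (α t + β) / (γ t + δ)`. -/
def symmetricSquare {R : Type*} [CommRing R] (α β γ δ : R) : Matrix (Fin 3) (Fin 3) R :=
  !![δ ^ 2, 2 * (γ * δ), γ ^ 2; β * δ, α * δ + β * γ, α * γ; β ^ 2, 2 * (α * β), α ^ 2]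

theorem symmetricSquare_mulVec {R : Type*} [CommRing R] (α β γ δ t : R) :
    symmetricSquare α β γ δ *ᵥ parabolaPoint t
      = ![(γ * t + δ) ^ 2, (α * t + β) * (γ * t + δ), (α * t + β) ^ 2] := by
  funext i
  fin_cases i <;> simp [symmetricSquare, parabolaPoint, mulVec, dotProduct, Fin.sum_univ_three] <;>
    ring

theorem det_symmetricSquare {R : Type*} [CommRing R] (α β γ δ : R) :
    (symmetricSquare α β γ δ).det = (α * δ - β * γ) ^ 3 := by
  simp [symmetricSquare, Matrix.det_fin_three]; ring

theorem parabola_act_symmetricSquare {R : Type*} [CommRing R] (α β γ δ : R) :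
    (TernaryForm.parabola R).act (symmetricSquare α β γ δ)
      = (α * δ - β * γ) ^ 2 • TernaryForm.parabola R := by
  simp only [TernaryForm.act, TernaryForm.smul_def, TernaryForm.parabola, TernaryForm.mk.injEq,
    TernaryForm.eval, TernaryForm.polar]
  refine ⟨?_, ?_, ?_, ?_, ?_, ?_⟩ <;> simp [symmetricSquare] <;> ring

open Polynomial in
/-- A rational function that generates the field of rational functions is a quotient of linear
polynomials. -/
theorem exists_linear_of_mem_adjoin {L : Type*} [Field L] {ρ : RatFunc L}
    (h : (RatFunc.X : RatFunc L) ∈ IntermediateField.adjoin L {ρ}) :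
    ∃ α β γ δ : L, α * δ - β * γ ≠ 0 ∧
      ρ * algebraMap L[X] (RatFunc L) (C γ * X + C δ) = algebraMap L[X] _ (C α * X + C β) := by
  have htop : IntermediateField.adjoin L {ρ} = ⊤ := by
    rw [eq_top_iff, ← RatFunc.adjoin_X, IntermediateField.adjoin_simple_le_iff]
    exact h
  have hdeg := ρ.finrank_eq_max_natDegree
  rw [htop, IntermediateField.finrank_top] at hdeg
  have hp := Polynomial.eq_X_add_C_of_natDegree_le_one (p := ρ.num) (by omega)
  have hq := Polynomial.eq_X_add_C_of_natDegree_le_one (p := ρ.denom) (by omega)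
  have hden : algebraMap L[X] (RatFunc L) ρ.denom ≠ 0 := by
    simpa using ρ.denom_ne_zero
  refine ⟨ρ.num.coeff 1, ρ.num.coeff 0, ρ.denom.coeff 1, ρ.denom.coeff 0, fun h0 => ?_, ?_⟩
  · obtain ⟨u, v, huv⟩ := ρ.isCoprime_num_denom
    have hpq : C (ρ.denom.coeff 1) * ρ.num = C (ρ.num.coeff 1) * ρ.denom := by
      rw [hp, hq]
      simp only [coeff_add, coeff_C_mul, coeff_X_one, coeff_C, mul_one]
      simp
      have : C (ρ.num.coeff 1) * C (ρ.denom.coeff 0) - C (ρ.num.coeff 0) * C (ρ.denom.coeff 1)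
        = (0 : L[X]) := by rw [← C_mul, ← C_mul, ← C_sub, h0, C_0]
      linear_combination -this
    -- the leading coefficients cannot both vanish, and then `num` and `denom` are associated
    have h1 : C (ρ.denom.coeff 1)
        = (u * C (ρ.num.coeff 1) + v * C (ρ.denom.coeff 1)) * ρ.denom := by
      linear_combination u * hpq - C (ρ.denom.coeff 1) * huv
    have h2 : C (ρ.num.coeff 1) = (u * C (ρ.num.coeff 1) + v * C (ρ.denom.coeff 1)) * ρ.num := by
      linear_combination -v * hpq - C (ρ.num.coeff 1) * huv
    have key : ∀ r w : L[X], C (r.coeff 1) = w * r → r.natDegree ≠ 1 := by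
      intro r w h hr
      have hr1 : r.coeff 1 ≠ 0 := by
        rw [← hr]
        exact leadingCoeff_ne_zero.2 fun h0 => by simp [h0] at hr
      have hw : w ≠ 0 := by
        rintro rfl
        exact hr1 (by simpa using h)
      have := congrArg natDegree h
      rw [natDegree_C, natDegree_mul hw (fun h0 => by simp [h0] at hr), hr] at this
      omega
    rcases max_choice ρ.num.natDegree ρ.denom.natDegree with hm | hm <;> rw [hm] at hdeg
    · exact key _ _ h2 hdeg.symm
    · exact key _ _ h1 hdeg.symm
  · rw [← hp, ← hq]
    nth_rewrite 1 [← RatFunc.num_div_denom ρ]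
    exact div_mul_cancel₀ _ hden

open Polynomial in
/-- A rational map from the curve `(1, t, t²)` to itself that has a rational inverse is a fractional
linear transformation of the parameter `t`, and hence induced by an invertible matrix. -/
theorem exists_symmetricSquare_of_rational_inverse {L : Type*} [Field L] [Infinite L] {e : ℕ}
    {f g : Fin 3 → MvPolynomial (Fin 3) L} (hg : ∀ i, (g i).IsHomogeneous e)
    (hQ : ∀ t : L, polyMap f (parabolaPoint t) ≠ 0 →
      (TernaryForm.parabola L).eval (polyMap f (parabolaPoint t)) = 0)
    (hgf : ∀ t : L, polyMap f (parabolaPoint t) ≠ 0 → ∀ i j,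
      polyMap g (polyMap f (parabolaPoint t)) i * parabolaPoint t j
        = polyMap g (polyMap f (parabolaPoint t)) j * parabolaPoint t i)
    (hf0 : polyMap f (parabolaPoint (0 : L)) ≠ 0)
    (hg0 : polyMap g (polyMap f (parabolaPoint (0 : L))) ≠ 0) :
    ∃ α β γ δ : L, α * δ - β * γ ≠ 0 ∧
      ∀ t : L, ∀ i j, polyMap f (parabolaPoint t) i
          * (symmetricSquare α β γ δ *ᵥ parabolaPoint t) j
        = polyMap f (parabolaPoint t) j * (symmetricSquare α β γ δ *ᵥ parabolaPoint t) i := by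
  -- `h` and `k` are the map and its composite with the inverse in terms of the parameter
  let h : Fin 3 → L[X] := polyMap f (parabolaPoint X)
  let k : Fin 3 → L[X] := polyMap g h
  have hX : ∀ (t : L) i, eval t (parabolaPoint (X : L[X]) i) = parabolaPoint t i := by
    intro t i; fin_cases i <;> simp [parabolaPoint]
  have hh : ∀ t i, (h i).eval t = polyMap f (parabolaPoint t) i := by
    intro t i
    have := polyMap_algHom (aeval t) f (parabolaPoint X) i
    simpa only [coe_aeval_eq_eval, hX] using this
  have hk : ∀ t i, (k i).eval t = polyMap g (polyMap f (parabolaPoint t)) i := by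
    intro t i
    have := polyMap_algHom (aeval t) g h i
    simpa only [coe_aeval_eq_eval, hh] using this
  have hne : h ≠ 0 := fun h0 => hf0 (funext fun i => by rw [← hh 0, h0]; simp)
  obtain ⟨l, hl⟩ := Function.ne_iff.1 hne
  have hrel : h 1 ^ 2 = h 0 * h 2 := by
    refine Polynomial.funext fun t => ?_
    by_cases ht : polyMap f (parabolaPoint t) = 0
    · have h0 : ∀ i, (h i).eval t = 0 := fun i => (hh t i).trans (congrFun ht i)
      simp [h0]
    · have := hQ t ht
      rw [TernaryForm.eval_parabola, ← hh, ← hh, ← hh, sub_eq_zero] at this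
      simpa using this
  have hkrel : ∀ i j, k i * parabolaPoint X j = k j * parabolaPoint X i := by
    intro i j
    refine mul_right_cancel₀ hl (Polynomial.funext fun t => ?_)
    by_cases ht : polyMap f (parabolaPoint t) = 0
    · have h0 : (h l).eval t = 0 := (hh t l).trans (congrFun ht l)
      simp [h0]
    · rw [eval_mul, eval_mul, eval_mul, eval_mul, hX, hX, hk, hk, hgf t ht i j]
  have hk1 : k 1 = k 0 * X := by simpa [parabolaPoint] using hkrel 1 0
  have hk2 : k 2 = k 0 * X ^ 2 := by simpa [parabolaPoint] using hkrel 2 0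
  have hk0 : k 0 ≠ 0 := by
    intro h0
    refine hg0 (funext fun i => ?_)
    rw [← hk]
    fin_cases i <;> simp [hk1, hk2, h0]
  let ι : L[X] →ₐ[L] RatFunc L := IsScalarTower.toAlgHom L L[X] (RatFunc L)
  have hι : Function.Injective ι := IsFractionRing.injective L[X] (RatFunc L)
  have hιX : ι X = RatFunc.X := RatFunc.algebraMap_X
  have hkι : ∀ i, ι (k i) = polyMap g (fun j => ι (h j)) i := fun i => polyMap_algHom ι g h i
  have hk0' : ι (k 0) ≠ 0 := by simpa using (map_ne_zero_iff ι hι).2 hk0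
  have hXk : RatFunc.X = ι (k 1) / ι (k 0) := by
    rw [hk1, map_mul, mul_div_cancel_left₀ _ hk0', hιX]
  by_cases h0 : h 0 = 0
  · -- a constant map has no inverse
    exfalso
    have h1 : h 1 = 0 := by
      rw [h0, zero_mul] at hrel
      exact pow_eq_zero_iff two_ne_zero |>.1 hrel
    have h2 : ι (h 2) ≠ 0 := by
      refine (map_ne_zero_iff ι hι).2 fun h2 => hne (funext fun j => ?_)
      fin_cases j <;> assumption
    let φ : L →ₐ[L] RatFunc L := Algebra.ofId L (RatFunc L)
    have hvec : (fun j => ι (h j)) = ι (h 2) • fun j => φ ((Pi.single 2 1 : Fin 3 → L) j) := by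
      funext j
      fin_cases j <;> simp [h0, h1]
    obtain ⟨α, β, γ, δ, hdet, hαβ⟩ := exists_linear_of_mem_adjoin (L := L) (ρ := 0) (by
      rw [hXk, hkι, hkι, hvec, polyMap_smul hg, Pi.smul_apply, Pi.smul_apply, smul_eq_mul,
        smul_eq_mul, mul_div_mul_left _ _ (pow_ne_zero e h2), ← polyMap_algHom, ← polyMap_algHom]
      exact div_mem (IntermediateField.algebraMap_mem _ _) (IntermediateField.algebraMap_mem _ _))
    rw [zero_mul, eq_comm, map_eq_zero_iff _ (IsFractionRing.injective L[X] (RatFunc L))] at hαβ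
    have hα : α = 0 := by simpa using congrArg (coeff · 1) hαβ
    have hβ : β = 0 := by simpa using congrArg (coeff · 0) hαβ
    exact hdet (by rw [hα, hβ]; ring)
  · have h0' : ι (h 0) ≠ 0 := by simpa using (map_ne_zero_iff ι hι).2 h0
    obtain ⟨ρ, hρ⟩ : ∃ ρ, ρ = ι (h 1) / ι (h 0) := ⟨_, rfl⟩
    have hvec : (fun j => ι (h j)) = ι (h 0) • parabolaPoint ρ := by
      have := congrArg ι hrel
      rw [map_pow, map_mul] at this
      funext j
      fin_cases j
      · simp [parabolaPoint]
      · simp [parabolaPoint, hρ]; field_simp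
      · simp [parabolaPoint, hρ]; field_simp; linear_combination -this
    have hmem : ∀ i, polyMap g (parabolaPoint ρ) i ∈ IntermediateField.adjoin L {ρ} := by
      intro i
      have hρmem := IntermediateField.mem_adjoin_simple_self L ρ
      let ρ' : IntermediateField.adjoin L {ρ} := ⟨ρ, hρmem⟩
      have := polyMap_algHom (IntermediateField.adjoin L {ρ}).val g (parabolaPoint ρ') i
      have hpt : (fun j => (IntermediateField.adjoin L {ρ}).val (parabolaPoint ρ' j))
          = parabolaPoint ρ := by
        funext j; fin_cases j <;> simp [parabolaPoint, ρ']
      rw [hpt] at this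
      rw [← this]
      exact Subtype.property _
    obtain ⟨α, β, γ, δ, hdet, hαβ⟩ := exists_linear_of_mem_adjoin (ρ := ρ) (by
      rw [hXk, hkι, hkι, hvec, polyMap_smul hg, Pi.smul_apply, Pi.smul_apply, smul_eq_mul,
        smul_eq_mul, mul_div_mul_left _ _ (pow_ne_zero e h0')]
      exact div_mem (hmem 1) (hmem 0))
    refine ⟨α, β, γ, δ, hdet, fun t => ?_⟩
    have hlin : h 1 * (C γ * X + C δ) = h 0 * (C α * X + C β) := by
      refine hι ?_
      rw [map_mul, map_mul]
      change ι (h 1) * algebraMap _ _ _ = ι (h 0) * algebraMap _ _ _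
      rw [← hαβ, hρ]
      field_simp
    have hlin2 : h 2 * (C γ * X + C δ) ^ 2 = h 0 * (C α * X + C β) ^ 2 := by
      refine mul_left_cancel₀ h0 ?_
      linear_combination (h 1 * (C γ * X + C δ) + h 0 * (C α * X + C β)) * hlin
        - (C γ * X + C δ) ^ 2 * hrel
    have hlin12 : h 2 * (C γ * X + C δ) * (C α * X + C β) = h 1 * (C α * X + C β) ^ 2 := by
      refine mul_left_cancel₀ h0 ?_
      linear_combination (h 1 * (C α * X + C β)) * hlin
        - (C γ * X + C δ) * (C α * X + C β) * hrel
    have e1 := congrArg (eval t) hlin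
    have e2 := congrArg (eval t) hlin2
    have e3 := congrArg (eval t) hlin12
    simp only [eval_mul, eval_add, eval_pow, eval_C, eval_X, hh] at e1 e2 e3
    rw [symmetricSquare_mulVec]
    intro i j
    fin_cases i <;> fin_cases j <;> simp
    · linear_combination -(γ * t + δ) * e1
    · linear_combination -e2
    · linear_combination (γ * t + δ) * e1
    · linear_combination -e3
    · linear_combination e2
    · linear_combination e3

end ParametrizedConic

/-! ### Isomorphic norm conics have similar equations -/

section ConicIsomorphism

open Matrix

/-- The tuple of polynomials obtained from `f` by linear changes of variables in the source and in
the target. -/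
noncomputable def conjPoly {F L : Type*} [CommRing F] [CommRing L] [Algebra F L]
    (N M : Matrix (Fin 3) (Fin 3) L) (f : Fin 3 → MvPolynomial (Fin 3) F) :
    Fin 3 → MvPolynomial (Fin 3) L :=
  fun i => ∑ j, MvPolynomial.C (N i j)
    * MvPolynomial.aeval (fun l => ∑ m, MvPolynomial.C (M l m) * MvPolynomial.X m) (f j)

theorem polyMap_conjPoly {F L : Type*} [CommRing F] [CommRing L] [Algebra F L]
    (N M : Matrix (Fin 3) (Fin 3) L) (f : Fin 3 → MvPolynomial (Fin 3) F) (v : Fin 3 → L) :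
    polyMap (conjPoly N M f) v = N *ᵥ polyMap f (M *ᵥ v) := by
  funext i
  have h := polyMap_algHom
    ((MvPolynomial.aeval v : MvPolynomial (Fin 3) L →ₐ[L] L).restrictScalars F) f
    (fun l => ∑ m, MvPolynomial.C (M l m) * MvPolynomial.X m)
  have hv : (fun j => ((MvPolynomial.aeval v : MvPolynomial (Fin 3) L →ₐ[L] L).restrictScalars F)
      (∑ m, MvPolynomial.C (M j m) * MvPolynomial.X m)) = M *ᵥ v := by
    funext j
    simp [mulVec, dotProduct]
  rw [hv] at h
  simp only [mulVec, dotProduct] at h ⊢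
  simp only [← h]
  simp [polyMap, conjPoly]

theorem isHomogeneous_conjPoly {F L : Type*} [CommRing F] [CommRing L] [Algebra F L] {d : ℕ}
    (N M : Matrix (Fin 3) (Fin 3) L) {f : Fin 3 → MvPolynomial (Fin 3) F}
    (hf : ∀ i, (f i).IsHomogeneous d) (i : Fin 3) : (conjPoly N M f i).IsHomogeneous d := by
  refine MvPolynomial.IsHomogeneous.sum _ _ _ fun j _ => ?_
  rw [← zero_add d]
  refine (MvPolynomial.isHomogeneous_C _ _).mul ?_
  rw [← one_mul d]
  refine (hf j).aeval _ fun l => MvPolynomial.IsHomogeneous.sum _ _ _ fun m _ => ?_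
  rw [← zero_add 1]
  exact (MvPolynomial.isHomogeneous_C _ _).mul (MvPolynomial.isHomogeneous_X _ _)

/-- Linear maps preserve proportionality. -/
theorem mulVec_mul_mulVec_comm {R : Type*} [CommRing R] (M : Matrix (Fin 3) (Fin 3) R)
    {u w : Fin 3 → R} (h : ∀ i j, u i * w j = u j * w i) (i j : Fin 3) :
    (M *ᵥ u) i * (M *ᵥ w) j = (M *ᵥ u) j * (M *ᵥ w) i := by
  simp only [mulVec, dotProduct, Fin.sum_univ_three]
  linear_combination M i 0 * M j 1 * h 0 1 + M i 0 * M j 2 * h 0 2 + M i 1 * M j 0 * h 1 0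
    + M i 1 * M j 2 * h 1 2 + M i 2 * M j 0 * h 2 0 + M i 2 * M j 1 * h 2 1

section Infinite

variable {L : Type*} [Field L] [Infinite L]

open Polynomial in
theorem coeff_eq_zero_of_forall {c₀ c₁ c₂ c₃ c₄ : L}
    (h : ∀ t : L, c₀ + c₁ * t + c₂ * t ^ 2 + c₃ * t ^ 3 + c₄ * t ^ 4 = 0) :
    c₀ = 0 ∧ c₁ = 0 ∧ c₂ = 0 ∧ c₃ = 0 ∧ c₄ = 0 := by
  have h0 : C c₀ + C c₁ * X + C c₂ * X ^ 2 + C c₃ * X ^ 3 + C c₄ * X ^ 4 = 0 :=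
    Polynomial.funext fun t => by simpa using h t
  refine ⟨?_, ?_, ?_, ?_, ?_⟩
  · simpa [coeff_X, coeff_C] using congrArg (coeff · 0) h0
  · simpa [coeff_X, coeff_C] using congrArg (coeff · 1) h0
  · simpa [coeff_X, coeff_C] using congrArg (coeff · 2) h0
  · simpa [coeff_X, coeff_C] using congrArg (coeff · 3) h0
  · simpa [coeff_X, coeff_C] using congrArg (coeff · 4) h0

/-- A matrix that fixes all points `(1 : t : t²)` is a scalar matrix. -/
theorem eq_smul_one_of_fixes_parabolaPoint {N : Matrix (Fin 3) (Fin 3) L}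
    (h : ∀ t : L, ∃ c : L, N *ᵥ parabolaPoint t = c • parabolaPoint t) : N = N 0 0 • 1 := by
  have h' : ∀ t : L, (N *ᵥ parabolaPoint t) 1 = t * (N *ᵥ parabolaPoint t) 0 ∧
      (N *ᵥ parabolaPoint t) 2 = t ^ 2 * (N *ᵥ parabolaPoint t) 0 := by
    intro t
    obtain ⟨c, hc⟩ := h t
    rw [hc]
    constructor <;> simp [parabolaPoint, mul_comm]
  simp only [mulVec, dotProduct, Fin.sum_univ_three, parabolaPoint, cons_val] at h'
  have h₁ := coeff_eq_zero_of_forall (c₀ := N 1 0) (c₁ := N 1 1 - N 0 0) (c₂ := N 1 2 - N 0 1)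
    (c₃ := -N 0 2) (c₄ := 0) fun t => by linear_combination (h' t).1
  have h₂ := coeff_eq_zero_of_forall (c₀ := N 2 0) (c₁ := N 2 1) (c₂ := N 2 2 - N 0 0)
    (c₃ := -N 0 1) (c₄ := -N 0 2) fun t => by linear_combination (h' t).2
  obtain ⟨h10, h11, h12, h02, -⟩ := h₁
  obtain ⟨h20, h21, h22, h01, -⟩ := h₂
  rw [neg_eq_zero] at h02 h01
  rw [h01, sub_zero] at h12
  ext i j
  fin_cases i <;> fin_cases j <;> simp [*]
  · linear_combination h11
  · linear_combination h22

open Polynomial in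
/-- Two matrices that induce the same rational map on the points `(1, t, t²)` are proportional. -/
theorem exists_eq_smul_of_polyMap {f : Fin 3 → MvPolynomial (Fin 3) L}
    (hf0 : polyMap f (parabolaPoint (0 : L)) ≠ 0) {S S' : Matrix (Fin 3) (Fin 3) L}
    (hS : IsUnit S.det)
    (h : ∀ t : L, ∀ i j, polyMap f (parabolaPoint t) i * (S *ᵥ parabolaPoint t) j
      = polyMap f (parabolaPoint t) j * (S *ᵥ parabolaPoint t) i)
    (h' : ∀ t : L, ∀ i j, polyMap f (parabolaPoint t) i * (S' *ᵥ parabolaPoint t) j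
      = polyMap f (parabolaPoint t) j * (S' *ᵥ parabolaPoint t) i) :
    ∃ c : L, S' = c • S := by
  have hX : ∀ (t : L) i, eval t (parabolaPoint (X : L[X]) i) = parabolaPoint t i := by
    intro t i; fin_cases i <;> simp [parabolaPoint]
  have hh : ∀ t i, (polyMap f (parabolaPoint (X : L[X])) i).eval t
      = polyMap f (parabolaPoint t) i := by
    intro t i
    have := polyMap_algHom (aeval t) f (parabolaPoint (X : L[X])) i
    simpa only [coe_aeval_eq_eval, hX] using this
  have hm : ∀ (T : Matrix (Fin 3) (Fin 3) L) t i, ((T.map C *ᵥ parabolaPoint (X : L[X])) i).eval t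
      = (T *ᵥ parabolaPoint t) i := by
    intro T t i
    simp [mulVec, dotProduct, Fin.sum_univ_three, hX]
  obtain ⟨l, hl⟩ := Function.ne_iff.1 hf0
  have hl' : polyMap f (parabolaPoint (X : L[X])) l ≠ 0 := by
    intro h0
    refine hl ?_
    rw [← hh, h0]
    simp
  have hcross : ∀ i j, (S'.map C *ᵥ parabolaPoint (X : L[X])) i
        * (S.map C *ᵥ parabolaPoint (X : L[X])) j
      = (S'.map C *ᵥ parabolaPoint (X : L[X])) j * (S.map C *ᵥ parabolaPoint (X : L[X])) i := by
    intro i j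
    refine mul_left_cancel₀ hl' (Polynomial.funext fun t => ?_)
    simp only [eval_mul, hh, hm]
    have a₁ := h' t l i
    have a₂ := h' t l j
    have a₃ := h t i j
    linear_combination (S *ᵥ parabolaPoint t) j * a₁ - (S *ᵥ parabolaPoint t) i * a₂
      + (S' *ᵥ parabolaPoint t) l * a₃
  have hS1 := Matrix.nonsing_inv_mul S hS
  have hfix := eq_smul_one_of_fixes_parabolaPoint (N := S⁻¹ * S') fun t => by
    have h₁ := mulVec_mul_mulVec_comm S⁻¹ (u := S' *ᵥ parabolaPoint t) (w := S *ᵥ parabolaPoint t)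
      fun i j => by simpa only [eval_mul, hm] using congrArg (eval t) (hcross i j)
    rw [mulVec_mulVec, mulVec_mulVec, hS1, one_mulVec] at h₁
    refine ⟨((S⁻¹ * S') *ᵥ parabolaPoint t) 0, funext fun i => ?_⟩
    simpa [parabolaPoint] using h₁ i 0
  refine ⟨(S⁻¹ * S') 0 0, ?_⟩
  have := congrArg (S * ·) hfix
  simpa [Matrix.mul_nonsing_inv_cancel_left _ _ hS] using this

open Polynomial in
/-- An identity between homogeneous forms on the points `(1, t, t²)` extends to all zeros of
`y² - x z`. -/
theorem forall_of_forall_parabolaPoint {d : ℕ} {f : Fin 3 → MvPolynomial (Fin 3) L}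
    (hf : ∀ i, (f i).IsHomogeneous d) {S : Matrix (Fin 3) (Fin 3) L}
    (h : ∀ t : L, ∀ i j, polyMap f (parabolaPoint t) i * (S *ᵥ parabolaPoint t) j
      = polyMap f (parabolaPoint t) j * (S *ᵥ parabolaPoint t) i)
    {x : Fin 3 → L} (hx : (TernaryForm.parabola L).eval x = 0) (i j : Fin 3) :
    polyMap f x i * (S *ᵥ x) j = polyMap f x j * (S *ᵥ x) i := by
  rw [TernaryForm.eval_parabola, sub_eq_zero] at hx
  have key : ∀ (c : L) (v : Fin 3 → L), (polyMap f v i * (S *ᵥ v) j = polyMap f v j * (S *ᵥ v) i) →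
      polyMap f (c • v) i * (S *ᵥ (c • v)) j = polyMap f (c • v) j * (S *ᵥ (c • v)) i := by
    intro c v hv
    rw [polyMap_smul hf, mulVec_smul]
    simp only [Pi.smul_apply, smul_eq_mul]
    linear_combination c ^ d * c * hv
  by_cases h0 : x 0 = 0
  · have h1 : x 1 = 0 := by simpa [h0] using hx
    have hx' : x = x 2 • ![0, 0, 1] := by
      funext l; fin_cases l <;> simp [h0, h1]
    -- the point at infinity is the limit of the points `(s², s, 1)`
    let p : Fin 3 → L[X] := ![X ^ 2, X, 1]
    let q : L[X] := polyMap f p i * (S.map C *ᵥ p) j - polyMap f p j * (S.map C *ᵥ p) i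
    have hp : ∀ (s : L) l, eval s (p l) = (![s ^ 2, s, 1] : Fin 3 → L) l := by
      intro s l; fin_cases l <;> simp [p]
    have hq : ∀ s : L, eval s q = polyMap f ![s ^ 2, s, 1] i * (S *ᵥ ![s ^ 2, s, 1]) j
        - polyMap f ![s ^ 2, s, 1] j * (S *ᵥ ![s ^ 2, s, 1]) i := by
      intro s
      have h₁ : ∀ l, eval s (polyMap f p l) = polyMap f ![s ^ 2, s, 1] l := by
        intro l
        have := polyMap_algHom (aeval s) f p l
        simpa only [coe_aeval_eq_eval, hp] using this
      have h₂ : ∀ l, eval s ((S.map C *ᵥ p) l) = (S *ᵥ ![s ^ 2, s, 1]) l := by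
        intro l
        simp [mulVec, dotProduct, Fin.sum_univ_three, hp]
      simp only [q, eval_sub, eval_mul, h₁, h₂]
    have hq0 : q * X = 0 := by
      refine Polynomial.funext fun s => ?_
      by_cases hs : s = 0
      · simp [hs]
      · have hv : (![s ^ 2, s, 1] : Fin 3 → L) = s ^ 2 • parabolaPoint s⁻¹ := by
          funext l; fin_cases l <;> simp [parabolaPoint] <;> field_simp
        rw [eval_mul, hq, hv, sub_eq_zero.2 (key _ _ (h s⁻¹ i j)), zero_mul, eval_zero]
    have hq1 : q = 0 := (mul_eq_zero.1 hq0).resolve_right X_ne_zero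
    have h₀ := hq 0
    rw [hq1, eval_zero, eq_comm, sub_eq_zero] at h₀
    rw [hx']
    refine key _ _ ?_
    simpa using h₀
  · have hx' : x = x 0 • parabolaPoint (x 1 / x 0) := by
      funext l; fin_cases l <;> simp [parabolaPoint] <;> field_simp
      linear_combination -hx
    rw [hx']
    exact key _ _ (h _ i j)

end Infinite

section Extraction

variable {F : Type u} [Field F] {L : Type u} [Field L] [Algebra L (AlgebraicClosure F)]

theorem map_ne_zero_of_ne_zero {v : Fin 3 → L} (hv : v ≠ 0) :
    (fun i => algebraMap L (AlgebraicClosure F) (v i)) ≠ 0 :=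
  fun h0 => hv (funext fun i => by simpa using congrFun h0 i)

variable [Algebra F L] [IsScalarTower F L (AlgebraicClosure F)]

theorem polyMap_algebraMap (f : Fin 3 → MvPolynomial (Fin 3) F) (v : Fin 3 → L) :
    polyMap f (fun i => algebraMap L (AlgebraicClosure F) (v i))
      = fun i => algebraMap L (AlgebraicClosure F) (polyMap f v i) :=
  funext fun i => (polyMap_algHom (IsScalarTower.toAlgHom F L (AlgebraicClosure F)) f v i).symm

theorem Conic.mk_map_mem_points_iff {C : Conic F} {v : Fin 3 → L} (hv : v ≠ 0) :
    Projectivization.mk _ _ (map_ne_zero_of_ne_zero (F := F) hv) ∈ C.points (AlgebraicClosure F)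
      ↔ (C.form.map (algebraMap F L)).eval v = 0 := by
  rw [Conic.mk_mem_points_iff, IsScalarTower.algebraMap_eq F L (AlgebraicClosure F),
    ← TernaryForm.map_map, TernaryForm.eval_map, map_eq_zero]

/-- Around a point with coordinates in `L` a morphism of conics is given by polynomials that can be
evaluated in `L`. -/
theorem IsConicMorphism.exists_polyMap {C D : Conic F}
    {φ : C.points (AlgebraicClosure F) → D.points (AlgebraicClosure F)} (hφ : IsConicMorphism φ)
    {v₀ : Fin 3 → L} (hv₀ : v₀ ≠ 0) (hC : (C.form.map (algebraMap F L)).eval v₀ = 0) :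
    ∃ (d : ℕ) (f : Fin 3 → MvPolynomial (Fin 3) F), (∀ i, (f i).IsHomogeneous d) ∧
      polyMap f v₀ ≠ 0 ∧ ∀ (v : Fin 3 → L) (hv : v ≠ 0) (hf : polyMap f v ≠ 0)
        (R : C.points (AlgebraicClosure F)),
        R.1 = Projectivization.mk _ _ (map_ne_zero_of_ne_zero hv) →
        (φ R).1 = Projectivization.mk _ _ (map_ne_zero_of_ne_zero hf) := by
  obtain ⟨d, f, hf, hf0, hfφ⟩ := hφ ⟨_, (Conic.mk_map_mem_points_iff hv₀).2 hC⟩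
  have hrep : ∀ (v : Fin 3 → L) (hv : v ≠ 0), ∃ c : AlgebraicClosure F, c ≠ 0 ∧
      polyMap f (Projectivization.mk (AlgebraicClosure F) _ (map_ne_zero_of_ne_zero hv)).rep
        = c • fun i => algebraMap L (AlgebraicClosure F) (polyMap f v i) := by
    intro v hv
    obtain ⟨c, hc⟩ := Projectivization.exists_smul_eq_mk_rep (AlgebraicClosure F) _
      (map_ne_zero_of_ne_zero (F := F) hv)
    refine ⟨c ^ d, pow_ne_zero d c.ne_zero, ?_⟩
    rw [← hc, Units.smul_def, polyMap_smul hf, polyMap_algebraMap]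
  refine ⟨d, f, hf, fun h0 => hf0 ?_, fun v hv hfv R hR => ?_⟩
  · obtain ⟨c, -, hc⟩ := hrep v₀ hv₀
    refine hc.trans ?_
    rw [h0]
    funext i
    simp
  · obtain ⟨c, hc0, hc⟩ := hrep v hv
    have hR' : (fun i => MvPolynomial.aeval R.1.rep (f i))
        = c • fun i => algebraMap L (AlgebraicClosure F) (polyMap f v i) := by
      rw [hR]; exact hc
    rw [hfφ R (by rw [hR']; exact smul_ne_zero hc0 (map_ne_zero_of_ne_zero hfv)),
      Projectivization.mk_eq_mk_iff']
    exact ⟨c, hR'.symm⟩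

/-- Around a point with coordinates in `L`, mutually inverse morphisms of conics are given by
polynomials that are mutually inverse up to proportionality. -/
theorem Conic.Iso.exists_polyMap {C D : Conic F} (h : Conic.Iso C D)
    {v₀ : Fin 3 → L} (hv₀ : v₀ ≠ 0) (hC : (C.form.map (algebraMap F L)).eval v₀ = 0) :
    ∃ (d e : ℕ) (f g : Fin 3 → MvPolynomial (Fin 3) F), (∀ i, (f i).IsHomogeneous d) ∧
      (∀ i, (g i).IsHomogeneous e) ∧ polyMap f v₀ ≠ 0 ∧ polyMap g (polyMap f v₀) ≠ 0 ∧
      ∀ v : Fin 3 → L, v ≠ 0 → (C.form.map (algebraMap F L)).eval v = 0 → polyMap f v ≠ 0 →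
        (D.form.map (algebraMap F L)).eval (polyMap f v) = 0 ∧
        ∀ i j, polyMap g (polyMap f v) i * v j = polyMap g (polyMap f v) j * v i := by
  obtain ⟨φ, hφ, hφ'⟩ := h
  obtain ⟨d, f, hf, hf0, hfφ⟩ := hφ.exists_polyMap hv₀ hC
  have hD : ∀ v : Fin 3 → L, v ≠ 0 → (C.form.map (algebraMap F L)).eval v = 0 →
      polyMap f v ≠ 0 → (D.form.map (algebraMap F L)).eval (polyMap f v) = 0 := by
    intro v hv hCv hfv
    rw [← Conic.mk_map_mem_points_iff hfv,
      ← hfφ v hv hfv ⟨_, (Conic.mk_map_mem_points_iff hv).2 hCv⟩ rfl]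
    exact Subtype.property _
  obtain ⟨e, g, hg, hg0, hgφ⟩ := hφ'.exists_polyMap hf0 (hD v₀ hv₀ hC hf0)
  refine ⟨d, e, f, g, hf, hg, hf0, hg0, fun v hv hCv hfv => ⟨hD v hv hCv hfv, fun i j => ?_⟩⟩
  by_cases hgv : polyMap g (polyMap f v) = 0
  · simp [hgv]
  · have hR := hfφ v hv hfv ⟨_, (Conic.mk_map_mem_points_iff hv).2 hCv⟩ rfl
    have h₁ := hgφ _ hfv hgv _ hR
    rw [Equiv.symm_apply_apply, Projectivization.mk_eq_mk_iff'] at h₁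
    obtain ⟨c, hc⟩ := h₁
    refine (algebraMap L (AlgebraicClosure F)).injective ?_
    have hi := congrFun hc i
    have hj := congrFun hc j
    simp only [Pi.smul_apply, smul_eq_mul] at hi hj
    rw [map_mul, map_mul, ← hi, ← hj]
    ring

end Extraction

/-- Conjugation by an automorphism preserves the linear representation of a map over `F`, so that a
representing matrix, which is unique up to a factor, can be normalized to have entries in `F`. -/
theorem exists_matrix_of_iso_of_isSepClosed {F : Type u} [Field F] (L : Type u) [Field L]
    [Algebra F L] [Algebra L (AlgebraicClosure F)] [IsScalarTower F L (AlgebraicClosure F)]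
    [IsSepClosed L] [IsGalois F L] {a b a' b' : F} (h : IsStdParam a b) (h' : IsStdParam a' b')
    (hiso : Conic.Iso h.conic h'.conic) : ∃ (M : Matrix (Fin 3) (Fin 3) F) (k : F), k ≠ 0 ∧
      (normForm a' b').act M = k • normForm a b := by
  have : Infinite L := IsSepClosed.infinite L
  obtain ⟨B, k, hB, hk, hBk⟩ := (h.map (algebraMap F L)).exists_act_eq_parabola
  obtain ⟨B', k', hB', hk', hBk'⟩ := (h'.map (algebraMap F L)).exists_act_eq_parabola
  rw [← normForm_map] at hBk hBk'
  have hBi := Matrix.nonsing_inv_mul B hB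
  have hBi' := Matrix.nonsing_inv_mul B' hB'
  have hBr := Matrix.mul_nonsing_inv B hB
  have hBr' := Matrix.mul_nonsing_inv B' hB'
  have heval : ∀ x, ((normForm a b).map (algebraMap F L)).eval (B *ᵥ x)
      = k * (TernaryForm.parabola L).eval x := by
    intro x
    rw [← TernaryForm.eval_act, hBk, TernaryForm.eval_smul]
  have heval' : ∀ x, ((normForm a' b').map (algebraMap F L)).eval (B' *ᵥ x)
      = k' * (TernaryForm.parabola L).eval x := by
    intro x
    rw [← TernaryForm.eval_act, hBk', TernaryForm.eval_smul]
  have hpt : ∀ t : L, (TernaryForm.parabola L).eval (parabolaPoint t) = 0 := by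
    intro t
    rw [TernaryForm.eval_parabola]
    simp [parabolaPoint]
  have hBP : ∀ t : L, B *ᵥ parabolaPoint t ≠ 0 := by
    intro t h0
    have : (B⁻¹ * B) *ᵥ parabolaPoint t = 0 := by rw [← mulVec_mulVec, h0, mulVec_zero]
    rw [hBi, one_mulVec] at this
    simpa [parabolaPoint] using congrFun this 0
  obtain ⟨d, e, f, g, hf, hg, hf0, hg0, hfg⟩ := hiso.exists_polyMap (L := L) (hBP 0)
    (by rw [IsStdParam.conic, heval, hpt, mul_zero])
  have hinv : ∀ v, B' *ᵥ (B'⁻¹ *ᵥ v) = v := fun v => by rw [mulVec_mulVec, hBr', one_mulVec]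
  have hinj' : ∀ v, B'⁻¹ *ᵥ v = 0 → v = 0 := fun v h0 => by rw [← hinv v, h0, mulVec_zero]
  have hinj : ∀ v, B⁻¹ *ᵥ v = 0 → v = 0 := fun v h0 => by
    rw [← one_mulVec v, ← hBr, ← mulVec_mulVec, h0, mulVec_zero]
  -- the isomorphism and its inverse in coordinates for which both conics are `y² = x z`
  set f' := conjPoly B'⁻¹ B f with hf'
  set g' := conjPoly B⁻¹ B' g with hg'
  have hf'e : ∀ v : Fin 3 → L, polyMap f' v = B'⁻¹ *ᵥ polyMap f (B *ᵥ v) := polyMap_conjPoly _ _ _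
  have hg'e : ∀ v : Fin 3 → L, polyMap g' (polyMap f' v)
      = B⁻¹ *ᵥ polyMap g (polyMap f (B *ᵥ v)) := by
    intro v
    rw [polyMap_conjPoly, hf'e, hinv]
  have hf'0 : ∀ v : Fin 3 → L, polyMap f' v ≠ 0 → polyMap f (B *ᵥ v) ≠ 0 := by
    intro v hv h0
    rw [hf'e, h0, mulVec_zero] at hv
    exact hv rfl
  have hdata := fun (t : L) (ht : polyMap f' (parabolaPoint t) ≠ 0) =>
    hfg (B *ᵥ parabolaPoint t) (hBP t) (by rw [IsStdParam.conic, heval, hpt, mul_zero]) (hf'0 _ ht)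
  have hf'ne : polyMap f' (parabolaPoint (0 : L)) ≠ 0 :=
    fun h0 => hf0 (hinj' _ (by rw [← hf'e, h0]))
  obtain ⟨α, β, γ, δ, hdet, hS⟩ := exists_symmetricSquare_of_rational_inverse (f := f') (g := g')
    (isHomogeneous_conjPoly _ _ hg) (fun t ht => by
      have := (hdata t ht).1
      rw [IsStdParam.conic, ← hinv (polyMap f _), heval', ← hf'e] at this
      exact (mul_eq_zero.1 this).resolve_left hk') (fun t ht i j => by
      have := mulVec_mul_mulVec_comm B⁻¹ (hdata t ht).2 i j
      rwa [mulVec_mulVec, hBi, one_mulVec, ← hg'e] at this)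
    hf'ne (fun h0 => hg0 (hinj _ (by rw [← hg'e, h0])))
  set S := symmetricSquare α β γ δ with hSdef
  have hSdet : IsUnit S.det := by
    rw [hSdef, det_symmetricSquare]
    exact (pow_ne_zero 3 hdet).isUnit
  -- `A` represents the isomorphism
  set A := B' * S * B⁻¹ with hA
  have hAdet : IsUnit A.det := by
    rw [hA, det_mul, det_mul]
    exact (hB'.mul hSdet).mul (isUnit_nonsing_inv_det B hB)
  have hAf : ∀ v : Fin 3 → L, ((normForm a b).map (algebraMap F L)).eval v = 0 → ∀ i j,
      polyMap f v i * (A *ᵥ v) j = polyMap f v j * (A *ᵥ v) i := by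
    intro v hv
    have hvB : v = B *ᵥ (B⁻¹ *ᵥ v) := by rw [mulVec_mulVec, hBr, one_mulVec]
    rw [hvB, heval] at hv
    have h₁ := forall_of_forall_parabolaPoint (isHomogeneous_conjPoly _ _ hf) hS
      ((mul_eq_zero.1 hv).resolve_left hk)
    have h₂ := mulVec_mul_mulVec_comm B' h₁
    rwa [hf'e, hinv, ← hvB, mulVec_mulVec, mulVec_mulVec] at h₂
  have hAact : ((normForm a' b').map (algebraMap F L)).act A
      = (k' * (α * δ - β * γ) ^ 2 * k⁻¹) • (normForm a b).map (algebraMap F L) := by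
    have h₁ : ((normForm a b).map (algebraMap F L)) = k • (TernaryForm.parabola L).act B⁻¹ := by
      rw [← TernaryForm.act_smul, ← hBk, TernaryForm.act_act, hBr, TernaryForm.act_one]
    rw [hA, ← TernaryForm.act_act, ← TernaryForm.act_act, hBk', TernaryForm.act_smul,
      TernaryForm.act_smul, hSdef, parabola_act_symmetricSquare, TernaryForm.act_smul, h₁,
      TernaryForm.smul_smul', TernaryForm.smul_smul', mul_assoc _ k⁻¹, inv_mul_cancel₀ hk, mul_one]
  -- on the conic the matrix is determined up to a factor by the map that it represents
  have huniq : ∀ A' : Matrix (Fin 3) (Fin 3) L,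
      (∀ v : Fin 3 → L, ((normForm a b).map (algebraMap F L)).eval v = 0 → ∀ i j,
        polyMap f v i * (A' *ᵥ v) j = polyMap f v j * (A' *ᵥ v) i) → ∃ c : L, A' = c • A := by
    intro A' hA'
    obtain ⟨c, hc⟩ := exists_eq_smul_of_polyMap hf'ne hSdet hS (S' := B'⁻¹ * A' * B)
      fun t i j => by
        have := mulVec_mul_mulVec_comm B'⁻¹ (hA' (B *ᵥ parabolaPoint t)
          (by rw [heval, hpt, mul_zero])) i j
        rwa [← hf'e, mulVec_mulVec, mulVec_mulVec] at this
    refine ⟨c, ?_⟩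
    have h₁ : A' = B' * (B'⁻¹ * A' * B) * B⁻¹ := by
      rw [Matrix.mul_assoc B'⁻¹, Matrix.mul_nonsing_inv_cancel_left _ _ hB',
        Matrix.mul_nonsing_inv_cancel_right _ _ hB]
    rw [h₁, hc, hA, Matrix.mul_smul, Matrix.smul_mul]
  -- the polynomials `f` have coefficients in `F`, so that conjugates of `A` represent the same map
  have hconj : ∀ σ : Gal(L/F), ∃ c : L, A.map σ = c • A := by
    intro σ
    refine huniq _ fun v hv i j => ?_
    have hσ : ∀ w : Fin 3 → L, ∀ l, σ (polyMap f w l) = polyMap f (fun m => σ (w m)) l :=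
      fun w l => polyMap_algHom (σ : L →ₐ[F] L) f w l
    have hσv : (fun m => σ (σ.symm (v m))) = v := funext fun m => σ.apply_symm_apply _
    have hw : ((normForm a b).map (algebraMap F L)).eval (fun m => σ.symm (v m)) = 0 := by
      refine (map_eq_zero_iff σ σ.injective).1 ?_
      have h₁ := TernaryForm.eval_map (σ : L →+* L) ((normForm a b).map (algebraMap F L))
        (fun m => σ.symm (v m))
      have h₂ : ((σ : L →+* L).comp (algebraMap F L)) = algebraMap F L :=
        RingHom.ext fun x => σ.commutes x
      rw [TernaryForm.map_map, h₂] at h₁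
      refine h₁.symm.trans ?_
      rw [← hv]
      exact congrArg _ hσv
    have h₁ := congrArg σ (hAf _ hw i j)
    have hmul : ∀ l, σ ((A *ᵥ fun m => σ.symm (v m)) l) = (A.map σ *ᵥ v) l := by
      intro l
      simp [mulVec, dotProduct]
    rwa [map_mul, map_mul, hσ, hσ, hσv, hmul, hmul] at h₁
  have hA0 : A ≠ 0 := by
    rintro h0
    rw [h0, det_zero] at hAdet
    exact not_isUnit_zero hAdet
  obtain ⟨p, q, hpq⟩ : ∃ p q, A p q ≠ 0 := by
    by_contra! h0
    exact hA0 (Matrix.ext h0)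
  have hfixed : ∀ i j, ∃ x : F, algebraMap F L x = (A p q)⁻¹ * A i j := by
    intro i j
    refine (InfiniteGalois.mem_range_algebraMap_iff_fixed (k := F) (K := L) _).2 fun σ => ?_
    obtain ⟨c, hc⟩ := hconj σ
    have h₁ : ∀ i j, σ (A i j) = c * A i j := fun i j => congrFun (congrFun hc i) j
    have hc0 : c ≠ 0 := by
      rintro rfl
      have := h₁ p q
      rw [zero_mul, map_eq_zero_iff σ σ.injective] at this
      exact hpq this
    rw [map_mul, map_inv₀, h₁, h₁]
    field_simp
  choose M hM using hfixed
  have hMA : (Matrix.of M).map (algebraMap F L) = (A p q)⁻¹ • A := by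
    exact Matrix.ext hM
  obtain ⟨m, hm0, hm⟩ : ∃ m : L, m ≠ 0 ∧ ((normForm a' b').act (Matrix.of M)).map (algebraMap F L)
      = m • (normForm a b).map (algebraMap F L) := by
    refine ⟨_, ?_, by rw [TernaryForm.map_act, hMA, TernaryForm.act_smul_right, hAact,
      TernaryForm.smul_smul']⟩
    exact mul_ne_zero (pow_ne_zero 2 (inv_ne_zero hpq))
      (mul_ne_zero (mul_ne_zero hk' (pow_ne_zero 2 hdet)) (inv_ne_zero hk))
  have hb : (normForm a b).b ≠ 0 := by
    unfold normForm
    split_ifs <;> simp [h.1]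
  have hmF : algebraMap F L (((normForm a' b').act (Matrix.of M)).b / (normForm a b).b) = m := by
    have := congrArg TernaryForm.b hm
    rw [map_div₀]
    have hb' : algebraMap F L (normForm a b).b ≠ 0 := by simpa using hb
    exact (div_eq_iff hb').2 this
  refine ⟨Matrix.of M, ((normForm a' b').act (Matrix.of M)).b / (normForm a b).b, ?_, ?_⟩
  · rintro h0
    rw [h0, map_zero] at hmF
    exact hm0 hmF.symm
  · have hinjF := (algebraMap F L).injective
    rw [← hmF, ← TernaryForm.map_smul] at hm
    have h₁ := TernaryForm.ext_iff.1 hm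
    exact TernaryForm.ext (hinjF h₁.1) (hinjF h₁.2.1) (hinjF h₁.2.2.1) (hinjF h₁.2.2.2.1)
      (hinjF h₁.2.2.2.2.1) (hinjF h₁.2.2.2.2.2)

/-- An isomorphism between the norm conics of two standard forms comes from a similarity of the norm
forms. -/
theorem exists_matrix_of_iso {F : Type u} [Field F] {a b a' b' : F} (h : IsStdParam a b)
    (h' : IsStdParam a' b') (hiso : Conic.Iso h.conic h'.conic) :
    ∃ (M : Matrix (Fin 3) (Fin 3) F) (k : F), k ≠ 0 ∧
      (normForm a' b').act M = k • normForm a b :=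
  exists_matrix_of_iso_of_isSepClosed (SeparableClosure F) h h' hiso

end ConicIsomorphism

/-! ### The bijection between quaternion algebras and conics -/

section Bijection

variable {F : Type u} [Field F]

theorem QuatAlg.exists_isNormConic (B : QuatAlg F) : ∃ C : Conic F, IsNormConic B C := by
  obtain ⟨a, b, h, ⟨e⟩⟩ := B.exists_standardForm
  exact ⟨h.conic, isNormConic_of_algEquiv e rfl⟩

/-- Norm conics of isomorphic quaternion algebras are isomorphic; in particular, the norm conic does
not depend on the choice of coordinates. -/
theorem IsNormConic.iso {B B' : QuatAlg F} {C C' : Conic F} (h : IsNormConic B C)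
    (h' : IsNormConic B' C') (ε : B.carrier ≃ₐ[F] B'.carrier) : Conic.Iso C C' := by
  obtain ⟨M, hM, hMC⟩ := h.exists_act_eq h' ε
  exact Conic.iso_of_act_eq_smul hM one_ne_zero (by rw [hMC, TernaryForm.one_smul'])

/-- Quaternion algebras with isomorphic norm conics are isomorphic. -/
theorem IsNormConic.nonempty_algEquiv {B B' : QuatAlg F} {C C' : Conic F} (h : IsNormConic B C)
    (h' : IsNormConic B' C') (hiso : Conic.Iso C C') :
    Nonempty (B.carrier ≃ₐ[F] B'.carrier) := by
  obtain ⟨a, b, hab, ⟨e⟩⟩ := B.exists_standardForm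
  obtain ⟨a', b', hab', ⟨e'⟩⟩ := B'.exists_standardForm
  have h₁ : Conic.Iso hab.conic C :=
    IsNormConic.iso (isNormConic_of_algEquiv e rfl) h AlgEquiv.refl
  have h₂ : Conic.Iso C' hab'.conic :=
    IsNormConic.iso h' (isNormConic_of_algEquiv e' rfl) AlgEquiv.refl
  have htrans := (conicIso_equivalence F).trans h₁ ((conicIso_equivalence F).trans hiso h₂)
  obtain ⟨M, k, hk, hM⟩ := exists_matrix_of_iso hab hab' htrans
  obtain ⟨ε⟩ := algEquiv_of_act_eq_smul hab hk hM
  exact ⟨(e.symm.trans ε).trans e'⟩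

/-- Every conic is isomorphic to the norm conic of a quaternion algebra. -/
theorem Conic.exists_isNormConic_iso (C : Conic F) :
    ∃ (B : QuatAlg F) (C' : Conic F), IsNormConic B C' ∧ Conic.Iso C' C := by
  obtain ⟨hM, hab, k, hk, h⟩ := C.nonsingular.reduction
  exact ⟨hab.quatAlg, hab.conic,
    isNormConic_of_algEquiv (B := hab.quatAlg) AlgEquiv.refl rfl,
    Conic.iso_of_act_eq_smul hM hk h⟩

theorem exists_bijective_normConic : ∃ Φ : Quotient (quatAlgSetoid F) → Quotient (conicSetoid F),
    Function.Bijective Φ ∧ ∀ B : QuatAlg F, (∃ C : Conic F, IsNormConic B C) ∧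
      ∀ C : Conic F, IsNormConic B C →
        Φ (Quotient.mk (quatAlgSetoid F) B) = Quotient.mk (conicSetoid F) C := by
  choose C hC using QuatAlg.exists_isNormConic (F := F)
  let Φ : Quotient (quatAlgSetoid F) → Quotient (conicSetoid F) :=
    Quotient.map' (s₁ := quatAlgSetoid F) (s₂ := conicSetoid F) C
      fun B B' ⟨ε⟩ => (hC B).iso (hC B') ε
  have hΦ : ∀ B C', IsNormConic B C' →
      Φ (Quotient.mk (quatAlgSetoid F) B) = Quotient.mk (conicSetoid F) C' := fun B C' h =>
    Quotient.sound (s := conicSetoid F) ((hC B).iso h AlgEquiv.refl)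
  refine ⟨Φ, ⟨?_, ?_⟩, fun B => ⟨B.exists_isNormConic, hΦ B⟩⟩
  · intro x y hxy
    induction x using Quotient.ind with | _ B
    induction y using Quotient.ind with | _ B'
    exact Quotient.sound ((hC B).nonempty_algEquiv (hC B') (Quotient.exact hxy))
  · intro y
    induction y using Quotient.ind with | _ D
    obtain ⟨B, C', h, hiso⟩ := D.exists_isNormConic_iso
    exact ⟨Quotient.mk _ B, (hΦ B C' h).trans (Quotient.sound hiso)⟩

end Bijection

/-! ### Rational functions computed by calls to the algorithms of the field -/

section FieldComputations

open Matrix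

variable {F : Type u} [Field F] {E : ComputableField F}
  {𝒞 : (List (List Bool) → List (List Bool)) → Prop}

/-- A class of functions on tuples of bit strings that contains the polynomial-time computable
functions and versions of the algorithms of the field that are correct on representing strings, and
that is closed under composition and under joining the output tuples. -/
structure IsFieldClass (E : ComputableField F)
    (𝒞 : (List (List Bool) → List (List Bool)) → Prop) : Prop where
  polyTime : ∀ {f}, PolyTime f → 𝒞 f
  comp : ∀ {f g}, 𝒞 g → 𝒞 f → 𝒞 (g ∘ f)
  append : ∀ {f g}, 𝒞 f → 𝒞 g → 𝒞 fun ws => f ws ++ g ws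
  add : ∃ f, 𝒞 f ∧
    ∀ u v x y, E.decode u = some x → E.decode v = some y → f [u, v] = [E.add u v]
  sub : ∃ f, 𝒞 f ∧
    ∀ u v x y, E.decode u = some x → E.decode v = some y → f [u, v] = [E.sub u v]
  mul : ∃ f, 𝒞 f ∧
    ∀ u v x y, E.decode u = some x → E.decode v = some y → f [u, v] = [E.mul u v]
  div : ∃ f, 𝒞 f ∧
    ∀ u v x y, E.decode u = some x → E.decode v = some y → y ≠ 0 → f [u, v] = [E.div u v]
  isZero : ∃ f, 𝒞 f ∧ ∀ u x, E.decode u = some x → f [u] = [[E.isZero u]]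

theorem isFieldClass_polyTimeWithField (E : ComputableField F) :
    IsFieldClass E E.PolyTimeWithField where
  polyTime := .polyTime
  comp := .comp
  append := .append
  add := ⟨_, .add, fun _ _ _ _ _ _ => rfl⟩
  sub := ⟨_, .sub, fun _ _ _ _ _ _ => rfl⟩
  mul := ⟨_, .mul, fun _ _ _ _ _ _ => rfl⟩
  div := ⟨_, .div, fun _ _ _ _ _ _ _ => rfl⟩
  isZero := ⟨_, .isZero, fun _ _ _ => rfl⟩

theorem ComputableField.IsPolyTime.isFieldClass (hE : E.IsPolyTime) : IsFieldClass E PolyTime where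
  polyTime := id
  comp := .comp
  append := .append
  add := hE.add
  sub := hE.sub
  mul := hE.mul
  div := hE.div
  isZero := hE.isZero

theorem ComputableField.Represents.append {ws ws' : List (List Bool)} {xs xs' : List F}
    (h : E.Represents ws xs) (h' : E.Represents ws' xs') :
    E.Represents (ws ++ ws') (xs ++ xs') := by
  unfold ComputableField.Represents at *
  rw [List.map_append, List.map_append, h, h']

theorem ComputableField.Represents.unique {ws : List (List Bool)} {xs ys : List F}
    (h : E.Represents ws xs) (h' : E.Represents ws ys) : xs = ys :=
  List.map_injective_iff.2 (Option.some_injective F) (h.symm.trans h')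

theorem ComputableField.Represents.length_eq {ws : List (List Bool)} {xs : List F}
    (h : E.Represents ws xs) : ws.length = xs.length := by
  simpa using congrArg List.length h

theorem polyTime_drop (n : ℕ) : PolyTime (List.drop n) := by
  induction n with
  | zero =>
    convert polyTime_take_one.append polyTime_tail using 1
    funext ws
    cases ws <;> simp
  | succ n ih =>
    convert ih.comp polyTime_tail using 1
    funext ws
    simp

/-- The function `u`, whose argument is encoded by a tuple of field elements, is computed by a
member of the class `𝒞`. -/
def FieldComputable (E : ComputableField F) (𝒞 : (List (List Bool) → List (List Bool)) → Prop)
    {X : Type*} (enc : X → List F) (u : X → F) : Prop :=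
  ∃ f, 𝒞 f ∧ ∀ ws x, E.Represents ws (enc x) → ∃ w, f ws = [w] ∧ E.decode w = some (u x)

/-- The tuple-valued version of `FieldComputable`. -/
def TupleComputable (E : ComputableField F) (𝒞 : (List (List Bool) → List (List Bool)) → Prop)
    {X : Type*} (enc : X → List F) (φ : X → List F) : Prop :=
  ∃ f, 𝒞 f ∧ ∀ ws x, E.Represents ws (enc x) → E.Represents (f ws) (φ x)

namespace FieldComputable

variable {X : Type*} {enc : X → List F} {u v w : X → F}

theorem proj (h𝒞 : IsFieldClass E 𝒞) (i : ℕ) (hu : ∀ x, (enc x)[i]? = some (u x)) :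
    FieldComputable E 𝒞 enc u := by
  refine ⟨List.take 1 ∘ List.drop i, h𝒞.polyTime (polyTime_take_one.comp (polyTime_drop i)),
    fun ws x hx => ?_⟩
  have h := congrArg (·[i]?) hx
  simp only [List.getElem?_map, hu, Option.map_some] at h
  obtain ⟨w, hw, hw'⟩ := Option.map_eq_some_iff.1 h
  refine ⟨w, ?_, hw'⟩
  obtain ⟨hlt, hget⟩ := List.getElem?_eq_some_iff.1 hw
  rw [Function.comp_apply, List.drop_eq_getElem_cons hlt, hget]
  rfl

theorem const (h𝒞 : IsFieldClass E 𝒞) (c : F) : FieldComputable E 𝒞 enc fun _ => c := by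
  obtain ⟨w, hw⟩ := E.decode_surjective c
  exact ⟨_, h𝒞.polyTime (polyTime_const [w]), fun _ _ _ => ⟨w, rfl, hw⟩⟩

theorem add (h𝒞 : IsFieldClass E 𝒞) (hu : FieldComputable E 𝒞 enc u)
    (hv : FieldComputable E 𝒞 enc v) : FieldComputable E 𝒞 enc fun x => u x + v x := by
  obtain ⟨f, hf, hfu⟩ := hu
  obtain ⟨g, hg, hgv⟩ := hv
  obtain ⟨o, ho, hoe⟩ := h𝒞.add
  refine ⟨_, h𝒞.comp ho (h𝒞.append hf hg), fun ws x hx => ?_⟩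
  obtain ⟨a, ha, ha'⟩ := hfu ws x hx
  obtain ⟨b, hb, hb'⟩ := hgv ws x hx
  exact ⟨_, by simp [ha, hb, hoe _ _ _ _ ha' hb'], E.decode_add _ _ _ _ ha' hb'⟩

theorem sub (h𝒞 : IsFieldClass E 𝒞) (hu : FieldComputable E 𝒞 enc u)
    (hv : FieldComputable E 𝒞 enc v) : FieldComputable E 𝒞 enc fun x => u x - v x := by
  obtain ⟨f, hf, hfu⟩ := hu
  obtain ⟨g, hg, hgv⟩ := hv
  obtain ⟨o, ho, hoe⟩ := h𝒞.sub
  refine ⟨_, h𝒞.comp ho (h𝒞.append hf hg), fun ws x hx => ?_⟩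
  obtain ⟨a, ha, ha'⟩ := hfu ws x hx
  obtain ⟨b, hb, hb'⟩ := hgv ws x hx
  exact ⟨_, by simp [ha, hb, hoe _ _ _ _ ha' hb'], E.decode_sub _ _ _ _ ha' hb'⟩

theorem mul (h𝒞 : IsFieldClass E 𝒞) (hu : FieldComputable E 𝒞 enc u)
    (hv : FieldComputable E 𝒞 enc v) : FieldComputable E 𝒞 enc fun x => u x * v x := by
  obtain ⟨f, hf, hfu⟩ := hu
  obtain ⟨g, hg, hgv⟩ := hv
  obtain ⟨o, ho, hoe⟩ := h𝒞.mul
  refine ⟨_, h𝒞.comp ho (h𝒞.append hf hg), fun ws x hx => ?_⟩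
  obtain ⟨a, ha, ha'⟩ := hfu ws x hx
  obtain ⟨b, hb, hb'⟩ := hgv ws x hx
  exact ⟨_, by simp [ha, hb, hoe _ _ _ _ ha' hb'], E.decode_mul _ _ _ _ ha' hb'⟩

/-- Case distinctions are made by the test for zero: each branch is joined to the result of the test
and cut off if the result is the wrong one. -/
theorem ite [∀ x, Decidable (u x = 0)] (h𝒞 : IsFieldClass E 𝒞) (hu : FieldComputable E 𝒞 enc u)
    (hv : FieldComputable E 𝒞 enc v) (hw : FieldComputable E 𝒞 enc w) :
    FieldComputable E 𝒞 enc fun x => if u x = 0 then v x else w x := by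
  obtain ⟨f, hf, hfu⟩ := hu
  obtain ⟨g, hg, hgv⟩ := hv
  obtain ⟨k, hk, hkw⟩ := hw
  obtain ⟨o, ho, hoe⟩ := h𝒞.isZero
  have htest := h𝒞.comp ho hf
  refine ⟨_, h𝒞.append (h𝒞.comp (h𝒞.polyTime (polyTime_guardBit true)) (h𝒞.append htest hg))
    (h𝒞.comp (h𝒞.polyTime (polyTime_guardBit false)) (h𝒞.append htest hk)), fun ws x hx => ?_⟩
  obtain ⟨a, ha, ha'⟩ := hfu ws x hx
  obtain ⟨b, hb, hb'⟩ := hgv ws x hx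
  obtain ⟨c, hc, hc'⟩ := hkw ws x hx
  have hz := E.isZero_iff a (u x) ha'
  by_cases h0 : u x = 0
  · refine ⟨b, ?_, by simp only [if_pos h0, hb']⟩
    simp [ha, hb, hc, hoe _ _ ha', hz.2 h0, guardBit]
  · refine ⟨c, ?_, by simp only [if_neg h0, hc']⟩
    have : E.isZero a = false := by simpa using mt hz.1 h0
    simp [ha, hb, hc, hoe _ _ ha', this, guardBit]

theorem div (h𝒞 : IsFieldClass E 𝒞) (hu : FieldComputable E 𝒞 enc u)
    (hv : FieldComputable E 𝒞 enc v) : FieldComputable E 𝒞 enc fun x => u x / v x := by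
  classical
  -- the given algorithm is only called with a nonzero divisor
  have hv' := ite h𝒞 hv (const h𝒞 1) hv
  have hquot : FieldComputable E 𝒞 enc fun x => u x / (if v x = 0 then 1 else v x) := by
    obtain ⟨f, hf, hfu⟩ := hu
    obtain ⟨g, hg, hgv⟩ := hv'
    obtain ⟨o, ho, hoe⟩ := h𝒞.div
    refine ⟨_, h𝒞.comp ho (h𝒞.append hf hg), fun ws x hx => ?_⟩
    obtain ⟨a, ha, ha'⟩ := hfu ws x hx
    obtain ⟨b, hb, hb'⟩ := hgv ws x hx
    have hne : (if v x = 0 then 1 else v x) ≠ 0 := by split_ifs with h <;> simp [h]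
    exact ⟨_, by simp [ha, hb, hoe _ _ _ _ ha' hb' hne], E.decode_div _ _ _ _ ha' hb' hne⟩
  convert ite h𝒞 hv (const h𝒞 0) hquot using 2 with x
  split_ifs with h
  · rw [h, div_zero]
  · rfl

theorem neg (h𝒞 : IsFieldClass E 𝒞) (hu : FieldComputable E 𝒞 enc u) :
    FieldComputable E 𝒞 enc fun x => -u x := by
  simpa using (const h𝒞 0).sub h𝒞 hu

end FieldComputable

theorem tupleComputable_map {X : Type*} {enc : X → List F} (h𝒞 : IsFieldClass E 𝒞)
    (us : List (X → F)) (hus : ∀ u ∈ us, FieldComputable E 𝒞 enc u) :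
    TupleComputable E 𝒞 enc fun x => us.map fun u => u x := by
  induction us with
  | nil => exact ⟨_, h𝒞.polyTime (polyTime_const []), fun _ _ _ => rfl⟩
  | cons u us ih =>
    obtain ⟨f, hf, hfu⟩ := hus u (by simp)
    obtain ⟨g, hg, hgu⟩ := ih fun v hv => hus v (by simp [hv])
    refine ⟨_, h𝒞.append hf hg, fun ws x hx => ?_⟩
    obtain ⟨w, hw, hw'⟩ := hfu ws x hx
    rw [hw]
    exact (show E.Represents [w] [u x] by simp [ComputableField.Represents, hw']).append
      (hgu ws x hx)

/-- A function of the class can be modified to return the empty tuple on arguments of length `n`, in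
order to pass on a negative answer, which is an empty tuple appended to an instance of length
`n`. -/
theorem IsFieldClass.exists_guarded (h𝒞 : IsFieldClass E 𝒞) (n : ℕ)
    {g : List (List Bool) → List (List Bool)} (hg : 𝒞 g) :
    ∃ g', 𝒞 g' ∧ (∀ ws, ws.length = n → g' ws = []) ∧ ∀ ws, n < ws.length → g' ws = g ws := by
  refine ⟨_, h𝒞.comp (h𝒞.polyTime (polyTime_guardBit true)) (h𝒞.append
    (h𝒞.polyTime (polyTime_nonempty.comp (polyTime_drop n))) hg),
    fun ws hws => ?_, fun ws hws => ?_⟩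
  · have : List.drop n ws = [] := List.drop_eq_nil_of_le hws.le
    simp [this, guardBit]
  · have : (List.drop n ws).isEmpty = false := List.isEmpty_eq_false_iff.2 fun h => by
      rw [List.drop_eq_nil_iff] at h
      omega
    simp [guardBit, this]

end FieldComputations

/-! ### Computability of the explicit constructions -/

section ExplicitComputations

open Matrix

variable {F : Type u} [Field F] {E : ComputableField F}
  {𝒞 : (List (List Bool) → List (List Bool)) → Prop} {X : Type*} {enc : X → List F}

/-- The entries of a matrix that depends on an encoded argument are computed by members of `𝒞`. -/
def MatrixComputable (E : ComputableField F) (𝒞 : (List (List Bool) → List (List Bool)) → Prop)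
    (enc : X → List F) {m n : Type*} (M : X → Matrix m n F) : Prop :=
  ∀ i j, FieldComputable E 𝒞 enc fun x => M x i j

/-- The coefficients of a form that depends on an encoded argument are computed by members of
`𝒞`. -/
structure FormComputable (E : ComputableField F)
    (𝒞 : (List (List Bool) → List (List Bool)) → Prop) (enc : X → List F)
    (Q : X → TernaryForm F) : Prop where
  a : FieldComputable E 𝒞 enc fun x => (Q x).a
  b : FieldComputable E 𝒞 enc fun x => (Q x).b
  c : FieldComputable E 𝒞 enc fun x => (Q x).c
  r : FieldComputable E 𝒞 enc fun x => (Q x).r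
  s : FieldComputable E 𝒞 enc fun x => (Q x).s
  t : FieldComputable E 𝒞 enc fun x => (Q x).t

namespace FieldComputable

theorem sum (h𝒞 : IsFieldClass E 𝒞) {ι : Type*} (s : Finset ι) {u : ι → X → F}
    (hu : ∀ i, FieldComputable E 𝒞 enc (u i)) :
    FieldComputable E 𝒞 enc fun x => ∑ i ∈ s, u i x := by
  classical
  induction s using Finset.induction_on with
  | empty => simpa using const h𝒞 0
  | insert i s hi ih => simpa [Finset.sum_insert hi] using (hu i).add h𝒞 ih

theorem pow (h𝒞 : IsFieldClass E 𝒞) {u : X → F} (hu : FieldComputable E 𝒞 enc u) (n : ℕ) :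
    FieldComputable E 𝒞 enc fun x => u x ^ n := by
  induction n with
  | zero => simpa using const h𝒞 1
  | succ n ih => simpa [pow_succ] using ih.mul h𝒞 hu

theorem eval (h𝒞 : IsFieldClass E 𝒞) {Q : X → TernaryForm F} (hQ : FormComputable E 𝒞 enc Q)
    {v : X → Fin 3 → F} (hv : ∀ i, FieldComputable E 𝒞 enc fun x => v x i) :
    FieldComputable E 𝒞 enc fun x => (Q x).eval (v x) :=
  (((((hQ.a.mul h𝒞 ((hv 0).pow h𝒞 2)).add h𝒞 (hQ.b.mul h𝒞 ((hv 1).pow h𝒞 2))).add h𝒞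
    (hQ.c.mul h𝒞 ((hv 2).pow h𝒞 2))).add h𝒞 (hQ.r.mul h𝒞 ((hv 1).mul h𝒞 (hv 2)))).add h𝒞
    (hQ.s.mul h𝒞 ((hv 0).mul h𝒞 (hv 2)))).add h𝒞 (hQ.t.mul h𝒞 ((hv 0).mul h𝒞 (hv 1)))

theorem polar (h𝒞 : IsFieldClass E 𝒞) {Q : X → TernaryForm F} (hQ : FormComputable E 𝒞 enc Q)
    {v w : X → Fin 3 → F} (hv : ∀ i, FieldComputable E 𝒞 enc fun x => v x i)
    (hw : ∀ i, FieldComputable E 𝒞 enc fun x => w x i) :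
    FieldComputable E 𝒞 enc fun x => (Q x).polar (v x) (w x) := by
  have h : ∀ i j, FieldComputable E 𝒞 enc fun x => v x i * w x j :=
    fun i j => (hv i).mul h𝒞 (hw j)
  have h2 : FieldComputable E 𝒞 enc fun _ => 2 := const h𝒞 2
  exact ((((((h2.mul h𝒞 hQ.a).mul h𝒞 (h 0 0)).add h𝒞 ((h2.mul h𝒞 hQ.b).mul h𝒞 (h 1 1))).add h𝒞
    ((h2.mul h𝒞 hQ.c).mul h𝒞 (h 2 2))).add h𝒞 (hQ.r.mul h𝒞 ((h 1 2).add h𝒞 (h 2 1)))).add h𝒞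
    (hQ.s.mul h𝒞 ((h 0 2).add h𝒞 (h 2 0)))).add h𝒞 (hQ.t.mul h𝒞 ((h 0 1).add h𝒞 (h 1 0)))

end FieldComputable

namespace MatrixComputable

theorem mul (h𝒞 : IsFieldClass E 𝒞) {l m n : Type*} [Fintype m] {M : X → Matrix l m F}
    {N : X → Matrix m n F} (hM : MatrixComputable E 𝒞 enc M) (hN : MatrixComputable E 𝒞 enc N) :
    MatrixComputable E 𝒞 enc fun x => M x * N x :=
  fun i j => FieldComputable.sum h𝒞 _ fun k => (hM i k).mul h𝒞 (hN k j)

theorem ite (h𝒞 : IsFieldClass E 𝒞) {m n : Type*} {u : X → F} [∀ x, Decidable (u x = 0)]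
    {M N : X → Matrix m n F} (hu : FieldComputable E 𝒞 enc u) (hM : MatrixComputable E 𝒞 enc M)
    (hN : MatrixComputable E 𝒞 enc N) :
    MatrixComputable E 𝒞 enc fun x => if u x = 0 then M x else N x := by
  intro i j
  convert hu.ite h𝒞 (hM i j) (hN i j) using 2 with x
  by_cases h : u x = 0 <;> simp [h]

theorem fin_two {a b c d : X → F} (ha : FieldComputable E 𝒞 enc a)
    (hb : FieldComputable E 𝒞 enc b) (hc : FieldComputable E 𝒞 enc c)
    (hd : FieldComputable E 𝒞 enc d) :
    MatrixComputable E 𝒞 enc fun x => !![a x, b x; c x, d x] := by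
  intro i j
  fin_cases i <;> fin_cases j <;> assumption

theorem fin_three {a b c d e f g h k : X → F} (ha : FieldComputable E 𝒞 enc a)
    (hb : FieldComputable E 𝒞 enc b) (hc : FieldComputable E 𝒞 enc c)
    (hd : FieldComputable E 𝒞 enc d) (he : FieldComputable E 𝒞 enc e)
    (hf : FieldComputable E 𝒞 enc f) (hg : FieldComputable E 𝒞 enc g)
    (hh : FieldComputable E 𝒞 enc h) (hk : FieldComputable E 𝒞 enc k) :
    MatrixComputable E 𝒞 enc fun x => !![a x, b x, c x; d x, e x, f x; g x, h x, k x] := by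
  intro i j
  fin_cases i <;> fin_cases j <;> assumption

end MatrixComputable

namespace FormComputable

variable {Q : X → TernaryForm F}

theorem act (h𝒞 : IsFieldClass E 𝒞) (hQ : FormComputable E 𝒞 enc Q)
    {M : X → Matrix (Fin 3) (Fin 3) F} (hM : MatrixComputable E 𝒞 enc M) :
    FormComputable E 𝒞 enc fun x => (Q x).act (M x) where
  a := .eval h𝒞 hQ (v := fun x i => M x i 0) fun i => hM i 0
  b := .eval h𝒞 hQ (v := fun x i => M x i 1) fun i => hM i 1
  c := .eval h𝒞 hQ (v := fun x i => M x i 2) fun i => hM i 2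
  r := .polar h𝒞 hQ (v := fun x i => M x i 1) (w := fun x i => M x i 2)
    (fun i => hM i 1) fun i => hM i 2
  s := .polar h𝒞 hQ (v := fun x i => M x i 0) (w := fun x i => M x i 2)
    (fun i => hM i 0) fun i => hM i 2
  t := .polar h𝒞 hQ (v := fun x i => M x i 0) (w := fun x i => M x i 1)
    (fun i => hM i 0) fun i => hM i 1

theorem anisotropicStep (h𝒞 : IsFieldClass E 𝒞) (hQ : FormComputable E 𝒞 enc Q) :
    MatrixComputable E 𝒞 enc fun x => (Q x).anisotropicStep := by
  classical
  have h0 : FieldComputable E 𝒞 enc fun _ => 0 := .const h𝒞 0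
  have h1 : FieldComputable E 𝒞 enc fun _ => 1 := .const h𝒞 1
  unfold TernaryForm.anisotropicStep
  split_ifs
  · exact .ite h𝒞 hQ.r (.ite h𝒞 hQ.s (.fin_three hQ.r h1 h0 hQ.s h0 h1 hQ.t h0 h0)
      (.fin_three hQ.r h1 h0 hQ.s h0 h0 hQ.t h0 h1)) (.fin_three hQ.r h0 h0 hQ.s h1 h0 hQ.t h0 h1)
  · exact .ite h𝒞 hQ.a (.ite h𝒞 hQ.b (.ite h𝒞 hQ.c (.ite h𝒞 hQ.t
      (.fin_three h1 h0 h0 h0 h1 h0 h1 h0 h1) (.fin_three h1 h0 h0 h1 h1 h0 h0 h0 h1))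
      (.fin_three h0 h0 h1 h0 h1 h0 h1 h0 h0)) (.fin_three h0 h1 h0 h1 h0 h0 h0 h0 h1))
      (.fin_three h1 h0 h0 h0 h1 h0 h0 h0 h1)

theorem orthogonalStep (h𝒞 : IsFieldClass E 𝒞) (hQ : FormComputable E 𝒞 enc Q) :
    MatrixComputable E 𝒞 enc fun x => (Q x).orthogonalStep := by
  have h0 : FieldComputable E 𝒞 enc fun _ => 0 := .const h𝒞 0
  have h1 : FieldComputable E 𝒞 enc fun _ => 1 := .const h𝒞 1
  have h2a : FieldComputable E 𝒞 enc fun x => 2 * (Q x).a :=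
    (FieldComputable.const h𝒞 2).mul h𝒞 hQ.a
  unfold TernaryForm.orthogonalStep
  split_ifs
  · exact .fin_three h1 h0 h0 h0 h1 h0 h0 h0 h1
  · exact .fin_three h1 ((hQ.t.div h𝒞 h2a).neg h𝒞) ((hQ.s.div h𝒞 h2a).neg h𝒞) h0 h1 h0 h0 h0 h1

theorem binaryStep (h𝒞 : IsFieldClass E 𝒞) (hQ : FormComputable E 𝒞 enc Q) :
    MatrixComputable E 𝒞 enc fun x => (Q x).binaryStep := by
  classical
  have h0 : FieldComputable E 𝒞 enc fun _ => 0 := .const h𝒞 0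
  have h1 : FieldComputable E 𝒞 enc fun _ => 1 := .const h𝒞 1
  exact .ite h𝒞 hQ.b (.ite h𝒞 hQ.c (.fin_three h1 h0 h0 h0 h1 h0 h0 h1 h1)
    (.fin_three h1 h0 h0 h0 h0 h1 h0 h1 h0)) (.fin_three h1 h0 h0 h0 h1 h0 h0 h0 h1)

theorem finalStep (h𝒞 : IsFieldClass E 𝒞) (hQ : FormComputable E 𝒞 enc Q) :
    MatrixComputable E 𝒞 enc fun x => (Q x).finalStep := by
  have h0 : FieldComputable E 𝒞 enc fun _ => 0 := .const h𝒞 0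
  have h1 : FieldComputable E 𝒞 enc fun _ => 1 := .const h𝒞 1
  unfold TernaryForm.finalStep
  split_ifs
  · exact .fin_three h1 h0 h0 h0 h1 h0 h0 h0 (hQ.b.div h𝒞 hQ.r)
  · exact .fin_three h1 h0 h0 h0 h1
      ((hQ.r.div h𝒞 ((FieldComputable.const h𝒞 2).mul h𝒞 hQ.b)).neg h𝒞) h0 h0 h1

theorem reduction (h𝒞 : IsFieldClass E 𝒞) (hQ : FormComputable E 𝒞 enc Q) :
    MatrixComputable E 𝒞 enc fun x => (Q x).reduction := by
  have h₁ := hQ.anisotropicStep h𝒞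
  have hQ₁ := hQ.act h𝒞 h₁
  have h₂ := hQ₁.orthogonalStep h𝒞
  have hQ₂ := hQ₁.act h𝒞 h₂
  have h₃ := hQ₂.binaryStep h𝒞
  have hQ₃ := hQ₂.act h𝒞 h₃
  exact ((h₁.mul h𝒞 h₂).mul h𝒞 h₃).mul h𝒞 (hQ₃.finalStep h𝒞)

theorem paramA (h𝒞 : IsFieldClass E 𝒞) (hQ : FormComputable E 𝒞 enc Q) :
    FieldComputable E 𝒞 enc fun x => (Q x).paramA :=
  (hQ.c.div h𝒞 hQ.b).neg h𝒞

theorem paramB (h𝒞 : IsFieldClass E 𝒞) (hQ : FormComputable E 𝒞 enc Q) :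
    FieldComputable E 𝒞 enc fun x => (Q x).paramB := by
  unfold TernaryForm.paramB
  split_ifs
  · exact hQ.b.div h𝒞 hQ.a
  · exact (hQ.c.div h𝒞 hQ.a).neg h𝒞

theorem normForm (h𝒞 : IsFieldClass E 𝒞) {a b : X → F} (ha : FieldComputable E 𝒞 enc a)
    (hb : FieldComputable E 𝒞 enc b) : FormComputable E 𝒞 enc fun x => normForm (a x) (b x) := by
  have h0 : FieldComputable E 𝒞 enc fun _ => 0 := .const h𝒞 0
  unfold _root_.normForm
  split_ifs
  · exact ⟨.const h𝒞 1, hb, ha.mul h𝒞 hb, hb, h0, h0⟩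
  · exact ⟨ha.neg h𝒞, hb.neg h𝒞, ha.mul h𝒞 hb, h0, h0, h0⟩

theorem coeffs (h𝒞 : IsFieldClass E 𝒞) (hQ : FormComputable E 𝒞 enc Q) :
    TupleComputable E 𝒞 enc fun x => (Q x).coeffs :=
  tupleComputable_map h𝒞 [fun x => (Q x).a, fun x => (Q x).b, fun x => (Q x).c, fun x => (Q x).r,
    fun x => (Q x).s, fun x => (Q x).t] (by simp [hQ.a, hQ.b, hQ.c, hQ.r, hQ.s, hQ.t])

end FormComputable

theorem matrixComputable_splittingPair (h𝒞 : IsFieldClass E 𝒞) {a b : X → F} {v : X → Fin 3 → F}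
    (ha : FieldComputable E 𝒞 enc a) (hb : FieldComputable E 𝒞 enc b)
    (hv : ∀ i, FieldComputable E 𝒞 enc fun x => v x i) :
    MatrixComputable E 𝒞 enc (fun x => (splittingPair (a x) (b x) (v x)).1) ∧
      MatrixComputable E 𝒞 enc fun x => (splittingPair (a x) (b x) (v x)).2 := by
  classical
  have h0 : FieldComputable E 𝒞 enc fun _ => 0 := .const h𝒞 0
  have h1 : FieldComputable E 𝒞 enc fun _ => 1 := .const h𝒞 1
  have hβ : FieldComputable E 𝒞 enc fun _ => if (2 : F) = 0 then 1 else 0 := .const h𝒞 _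
  have hl : FieldComputable E 𝒞 enc fun x => v x 1 / v x 2 := (hv 1).div h𝒞 (hv 2)
  have hu : FieldComputable E 𝒞 enc fun x => (splittingCoord (a x) (b x) (v x)).1 := by
    unfold splittingCoord
    split_ifs
    · exact (hb.mul h𝒞 (hv 1)).div h𝒞 (hv 0)
    · exact (hb.mul h𝒞 (hv 2)).div h𝒞 (hv 0)
  have hw : FieldComputable E 𝒞 enc fun x => (splittingCoord (a x) (b x) (v x)).2 := by
    unfold splittingCoord
    split_ifs
    · exact (hb.mul h𝒞 (hv 2)).div h𝒞 (hv 0)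
    · exact (hb.mul h𝒞 (hv 1)).div h𝒞 (ha.mul h𝒞 (hv 0))
  have h₁ := MatrixComputable.ite h𝒞 (hv 0) (.fin_two hl h0 h0 (hβ.sub h𝒞 hl))
    (.fin_two h0 ha h1 hβ)
  have h₂ := MatrixComputable.ite h𝒞 (hv 0) (.fin_two h0 hb h1 h0)
    (.fin_two hu ((hβ.mul h𝒞 hu).sub h𝒞 (ha.mul h𝒞 hw)) hw (hu.neg h𝒞))
  constructor
  · convert h₁ using 2 with x
    unfold splittingPair
    split_ifs <;> rfl
  · convert h₂ using 2 with x
    unfold splittingPair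
    split_ifs <;> rfl

end ExplicitComputations

/-! ### The reductions between the algorithmic problems -/

section Reductions

open Matrix

theorem TernaryForm.coeffs_injective {F : Type u} :
    Function.Injective (TernaryForm.coeffs (F := F)) := by
  intro Q Q' h
  simp only [TernaryForm.coeffs, List.cons.injEq] at h
  ext <;> simp [h]

variable {F : Type u} [Field F]

theorem Conic.mk_mem_rationalPoints_iff {C : Conic F} {v : Fin 3 → F} (hv : v ≠ 0) :
    Projectivization.mk F v hv ∈ C.points F ↔ C.form.eval v = 0 :=
  Conic.mk_mem_points_iff hv

theorem Conic.rationalPoints_nonempty_iff {C : Conic F} :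
    (C.points F).Nonempty ↔ ∃ v, v ≠ 0 ∧ C.form.eval v = 0 := by
  constructor
  · rintro ⟨P, hP⟩
    exact ⟨P.rep, P.rep_nonzero, Conic.rep_mem ⟨P, hP⟩⟩
  · rintro ⟨v, hv, h⟩
    exact ⟨_, (Conic.mk_mem_rationalPoints_iff hv).2 h⟩

theorem nonempty_algEquiv_matrix_iff {a b : F} (h : IsStdParam a b) :
    Nonempty (StdQuat a b ≃ₐ[F] Matrix (Fin 2) (Fin 2) F) ↔
      ∃ v, v ≠ 0 ∧ (normForm a b).eval v = 0 := by
  constructor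
  · rintro ⟨φ⟩
    exact ⟨_, splittingPoint_ne_zero φ, eval_splittingPoint φ⟩
  · rintro ⟨v, hv, hQ⟩
    obtain ⟨φ, -⟩ := exists_splitting h hv hQ
    exact ⟨φ⟩

namespace TernaryForm

theorem mulVec_ne_zero {M : Matrix (Fin 3) (Fin 3) F} (hM : IsUnit M.det) {v : Fin 3 → F}
    (hv : v ≠ 0) : M *ᵥ v ≠ 0 := fun h =>
  hv (Matrix.mulVec_injective_of_isUnit ((Matrix.isUnit_iff_isUnit_det M).2 hM)
    (h.trans (Matrix.mulVec_zero M).symm))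

theorem eval_mulVec_eq_zero_iff {Q Q' : TernaryForm F} {M : Matrix (Fin 3) (Fin 3) F} {k : F}
    (hk : k ≠ 0) (h : Q.act M = k • Q') (v : Fin 3 → F) :
    Q.eval (M *ᵥ v) = 0 ↔ Q'.eval v = 0 := by
  rw [← eval_act, h, eval_smul, mul_eq_zero, or_iff_right hk]

theorem exists_zero_iff {Q Q' : TernaryForm F} {M : Matrix (Fin 3) (Fin 3) F} {k : F}
    (hM : IsUnit M.det) (hk : k ≠ 0) (h : Q.act M = k • Q') :
    (∃ v, v ≠ 0 ∧ Q.eval v = 0) ↔ ∃ v, v ≠ 0 ∧ Q'.eval v = 0 := by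
  constructor
  · rintro ⟨v, hv, hQ⟩
    have hMv : M *ᵥ (M⁻¹ *ᵥ v) = v := by
      rw [Matrix.mulVec_mulVec, Matrix.mul_nonsing_inv M hM, Matrix.one_mulVec]
    refine ⟨M⁻¹ *ᵥ v, fun h0 => hv ?_, ?_⟩
    · rw [← hMv, h0, Matrix.mulVec_zero]
    · rwa [← eval_mulVec_eq_zero_iff hk h, hMv]
  · rintro ⟨v, hv, hQ⟩
    exact ⟨_, mulVec_ne_zero hM hv, (eval_mulVec_eq_zero_iff hk h v).2 hQ⟩

end TernaryForm

/-- A conic has a point if and only if the quaternion algebra computed from its equation splits. -/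
theorem Conic.nonempty_algEquiv_matrix_iff (C : Conic F) :
    Nonempty (StdQuat (C.form.act C.form.reduction).paramA (C.form.act C.form.reduction).paramB
      ≃ₐ[F] Matrix (Fin 2) (Fin 2) F) ↔ (C.points F).Nonempty := by
  obtain ⟨hM, hp, k, hk, hQ⟩ := C.nonsingular.reduction
  rw [_root_.nonempty_algEquiv_matrix_iff hp, Conic.rationalPoints_nonempty_iff,
    TernaryForm.exists_zero_iff hM hk hQ]

/-- The entries of a list of `2 × 2` matrices, in the order in which the problems expect them. -/
def matrixEntries (l : List (Matrix (Fin 2) (Fin 2) F)) : List F :=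
  l.flatMap fun x => [x 0 0, x 0 1, x 1 0, x 1 1]

theorem coefficients_eq {a b : F} (φ : StdQuat a b ≃ₐ[F] Matrix (Fin 2) (Fin 2) F) :
    coefficients φ = matrixEntries
      [φ ⟨1, 0, 0, 0⟩, φ ⟨0, 1, 0, 0⟩, φ ⟨0, 0, 1, 0⟩, φ ⟨0, 0, 0, 1⟩] := rfl

open Classical in
/-- The point on the norm conic that `splittingPoint` attaches to an isomorphism, expressed by the
images `T` of `1, i, j, ij`. -/
noncomputable def pointOfImages (T : Fin 4 → Matrix (Fin 2) (Fin 2) F) : Fin 3 → F :=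
  letI T' : Fin 3 → Matrix (Fin 2) (Fin 2) F := ![if (2 : F) = 0 then T 0 else T 1, T 2, T 3]
  crossProduct (fun l => T' l 0 0) (fun l => T' l 1 0)

theorem pointOfImages_eq {a b : F} (φ : StdQuat a b ≃ₐ[F] Matrix (Fin 2) (Fin 2) F) :
    pointOfImages ![φ ⟨1, 0, 0, 0⟩, φ ⟨0, 1, 0, 0⟩, φ ⟨0, 0, 1, 0⟩, φ ⟨0, 0, 0, 1⟩]
      = splittingPoint φ := by
  classical
  have h : (![if (2 : F) = 0 then φ ⟨1, 0, 0, 0⟩ else φ ⟨0, 1, 0, 0⟩, φ ⟨0, 0, 1, 0⟩,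
      φ ⟨0, 0, 0, 1⟩] : Fin 3 → Matrix (Fin 2) (Fin 2) F)
      = fun l => φ (pureQuat a b (Pi.single l 1)) := by
    funext l
    unfold pureQuat
    fin_cases l <;> split_ifs <;> simp
  have h' := congrFun h
  simp only [pointOfImages, splittingPoint, ← h']
  rfl

variable {E : ComputableField F} {𝒞 : (List (List Bool) → List (List Bool)) → Prop}

namespace IsFieldClass

/-- The instance of the point problem that belongs to a standard form. -/
theorem exists_normForm (h𝒞 : IsFieldClass E 𝒞) :
    TupleComputable E 𝒞 (fun p : F × F => [p.1, p.2]) fun p => (normForm p.1 p.2).coeffs :=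
  (FormComputable.normForm h𝒞 (.proj h𝒞 0 fun _ => rfl) (.proj h𝒞 1 fun _ => rfl)).coeffs h𝒞

theorem formComputable_coeffs (h𝒞 : IsFieldClass E 𝒞) {X : Type*} {enc : X → List F}
    {Q : X → TernaryForm F} {l : X → List F} (henc : ∀ x, enc x = (Q x).coeffs ++ l x) :
    FormComputable E 𝒞 enc Q where
  a := .proj h𝒞 0 fun x => by rw [henc]; rfl
  b := .proj h𝒞 1 fun x => by rw [henc]; rfl
  c := .proj h𝒞 2 fun x => by rw [henc]; rfl
  r := .proj h𝒞 3 fun x => by rw [henc]; rfl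
  s := .proj h𝒞 4 fun x => by rw [henc]; rfl
  t := .proj h𝒞 5 fun x => by rw [henc]; rfl

/-- The standard form whose norm conic is isomorphic to a given conic. -/
theorem exists_params (h𝒞 : IsFieldClass E 𝒞) :
    TupleComputable E 𝒞 (TernaryForm.coeffs (F := F)) fun Q =>
      [(Q.act Q.reduction).paramA, (Q.act Q.reduction).paramB] := by
  have hQ : FormComputable E 𝒞 (TernaryForm.coeffs (F := F)) fun Q => Q :=
    h𝒞.formComputable_coeffs (l := fun _ => []) fun Q => (List.append_nil _).symm
  have hQ' := hQ.act h𝒞 (hQ.reduction h𝒞)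
  exact tupleComputable_map h𝒞 [fun Q : TernaryForm F => (Q.act Q.reduction).paramA,
    fun Q => (Q.act Q.reduction).paramB] (by simp [hQ'.paramA h𝒞, hQ'.paramB h𝒞])

theorem exists_matrixEntries (h𝒞 : IsFieldClass E 𝒞) {X : Type*} {enc : X → List F}
    {M : List (X → Matrix (Fin 2) (Fin 2) F)} (hM : ∀ N ∈ M, MatrixComputable E 𝒞 enc N) :
    TupleComputable E 𝒞 enc fun x => matrixEntries (M.map fun N => N x) := by
  convert tupleComputable_map h𝒞 (M.flatMap fun N => [fun x => N x 0 0, fun x => N x 0 1,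
    fun x => N x 1 0, fun x => N x 1 1]) ?_ using 2 with x
  · simp [matrixEntries, List.map_flatMap, List.flatMap_map]
  · simp only [List.mem_flatMap]
    rintro u ⟨N, hN, hu⟩
    simp only [List.mem_cons, List.not_mem_nil, or_false] at hu
    rcases hu with rfl | rfl | rfl | rfl <;> exact hM N hN _ _

/-- The matrices of an isomorphism onto the matrix ring are computed from a zero of the norm
form. -/
theorem exists_splitting (h𝒞 : IsFieldClass E 𝒞) :
    TupleComputable E 𝒞
      (fun x : (F × F) × (Fin 3 → F) => [x.1.1, x.1.2] ++ [x.2 0, x.2 1, x.2 2]) fun x =>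
      matrixEntries [1, (splittingPair x.1.1 x.1.2 x.2).1, (splittingPair x.1.1 x.1.2 x.2).2,
        (splittingPair x.1.1 x.1.2 x.2).1 * (splittingPair x.1.1 x.1.2 x.2).2] := by
  set enc := fun x : (F × F) × (Fin 3 → F) => [x.1.1, x.1.2] ++ [x.2 0, x.2 1, x.2 2]
  obtain ⟨h₁, h₂⟩ := matrixComputable_splittingPair h𝒞 (enc := enc)
    (a := fun x => x.1.1) (b := fun x => x.1.2) (v := fun x => x.2)
    (.proj h𝒞 0 fun _ => rfl) (.proj h𝒞 1 fun _ => rfl) (fun i => by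
      fin_cases i
      · exact .proj h𝒞 2 fun _ => rfl
      · exact .proj h𝒞 3 fun _ => rfl
      · exact .proj h𝒞 4 fun _ => rfl)
  refine h𝒞.exists_matrixEntries (enc := enc)
    (M := [fun _ => 1, fun x => (splittingPair x.1.1 x.1.2 x.2).1,
      fun x => (splittingPair x.1.1 x.1.2 x.2).2,
      fun x => (splittingPair x.1.1 x.1.2 x.2).1 * (splittingPair x.1.1 x.1.2 x.2).2]) ?_
  simp only [List.mem_cons, List.not_mem_nil, or_false]
  rintro N (rfl | rfl | rfl | rfl)
  · exact fun i j => .const h𝒞 _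
  · exact h₁
  · exact h₂
  · exact h₁.mul h𝒞 h₂

/-- A point of a conic is computed from an isomorphism of the quaternion algebra given by
`exists_params` with the matrix ring. -/
theorem exists_point (h𝒞 : IsFieldClass E 𝒞) :
    TupleComputable E 𝒞
      (fun x : TernaryForm F × (Fin 4 → Matrix (Fin 2) (Fin 2) F) =>
        x.1.coeffs ++ matrixEntries [x.2 0, x.2 1, x.2 2, x.2 3]) fun x =>
      [(x.1.reduction *ᵥ pointOfImages x.2) 0, (x.1.reduction *ᵥ pointOfImages x.2) 1,
        (x.1.reduction *ᵥ pointOfImages x.2) 2] := by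
  set enc := fun x : TernaryForm F × (Fin 4 → Matrix (Fin 2) (Fin 2) F) =>
    x.1.coeffs ++ matrixEntries [x.2 0, x.2 1, x.2 2, x.2 3] with henc
  have hM := (h𝒞.formComputable_coeffs (enc := enc) (Q := fun x => x.1) fun x => rfl).reduction h𝒞
  have h₀ : ∀ l, FieldComputable E 𝒞 enc fun x => x.2 l 0 0 := by
    intro l
    refine .proj h𝒞 (6 + 4 * l) fun x => ?_
    fin_cases l <;> rfl
  have h₁ : ∀ l, FieldComputable E 𝒞 enc fun x => x.2 l 1 0 := by
    intro l
    refine .proj h𝒞 (8 + 4 * l) fun x => ?_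
    fin_cases l <;> rfl
  have hp : ∀ i, FieldComputable E 𝒞 enc fun x => pointOfImages x.2 i := by
    intro i
    unfold pointOfImages
    split_ifs <;> fin_cases i
    · exact ((h₀ 2).mul h𝒞 (h₁ 3)).sub h𝒞 ((h₀ 3).mul h𝒞 (h₁ 2))
    · exact ((h₀ 3).mul h𝒞 (h₁ 0)).sub h𝒞 ((h₀ 0).mul h𝒞 (h₁ 3))
    · exact ((h₀ 0).mul h𝒞 (h₁ 2)).sub h𝒞 ((h₀ 2).mul h𝒞 (h₁ 0))
    · exact ((h₀ 2).mul h𝒞 (h₁ 3)).sub h𝒞 ((h₀ 3).mul h𝒞 (h₁ 2))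
    · exact ((h₀ 3).mul h𝒞 (h₁ 1)).sub h𝒞 ((h₀ 1).mul h𝒞 (h₁ 3))
    · exact ((h₀ 1).mul h𝒞 (h₁ 2)).sub h𝒞 ((h₀ 2).mul h𝒞 (h₁ 1))
  have hMp : ∀ i, FieldComputable E 𝒞 enc fun x => (x.1.reduction *ᵥ pointOfImages x.2) i :=
    fun i => .sum h𝒞 Finset.univ
      (u := fun k (x : TernaryForm F × (Fin 4 → Matrix (Fin 2) (Fin 2) F)) =>
        x.1.reduction i k * pointOfImages x.2 k)
      fun k => (hM i k).mul h𝒞 (hp k)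
  exact tupleComputable_map (X := TernaryForm F × (Fin 4 → Matrix (Fin 2) (Fin 2) F)) h𝒞
    [fun x => (x.1.reduction *ᵥ pointOfImages x.2) 0,
    fun x => (x.1.reduction *ᵥ pointOfImages x.2) 1,
    fun x => (x.1.reduction *ᵥ pointOfImages x.2) 2] (by simp [hMp])

theorem isMatrixRing_reduces_hasPoint (h𝒞 : IsFieldClass E 𝒞) :
    E.IsMatrixRing.Reduces 𝒞 E.HasPoint := by
  obtain ⟨f, hf, hfe⟩ := h𝒞.exists_normForm
  refine ⟨f, hf, ?_⟩
  rintro ws ⟨a, b, hp, hws⟩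
  have hC : E.Represents (f ws) hp.conic.form.coeffs := hfe ws (a, b) hws
  refine ⟨⟨_, hC⟩, ?_, ?_⟩
  · rintro ⟨a', b', hws', hφ⟩
    obtain ⟨rfl, rfl⟩ : a = a' ∧ b = b' := by simpa using hws.unique hws'
    exact ⟨_, hC, Conic.rationalPoints_nonempty_iff.2 ((nonempty_algEquiv_matrix_iff hp).1 hφ)⟩
  · rintro ⟨C, hC', hne⟩
    refine ⟨a, b, hws, (nonempty_algEquiv_matrix_iff hp).2 ?_⟩
    rw [Conic.rationalPoints_nonempty_iff, ← TernaryForm.coeffs_injective (hC.unique hC')] at hne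
    exact hne

theorem hasPoint_reduces_isMatrixRing (h𝒞 : IsFieldClass E 𝒞) :
    E.HasPoint.Reduces 𝒞 E.IsMatrixRing := by
  obtain ⟨f, hf, hfe⟩ := h𝒞.exists_params
  refine ⟨f, hf, ?_⟩
  rintro ws ⟨C, hws⟩
  have hA := hfe ws C.form hws
  obtain ⟨-, hp, -⟩ := C.nonsingular.reduction
  refine ⟨⟨_, _, hp, hA⟩, ?_, ?_⟩
  · rintro ⟨C', hws', hne⟩
    have hCC : C.form = C'.form := TernaryForm.coeffs_injective (hws.unique hws')
    refine ⟨_, _, hA, ?_⟩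
    rwa [C.nonempty_algEquiv_matrix_iff, Conic.rationalPoints_nonempty_iff, hCC,
      ← Conic.rationalPoints_nonempty_iff]
  · rintro ⟨a, b, hA', hφ⟩
    obtain ⟨rfl, rfl⟩ : _ = a ∧ _ = b := by simpa using hA.unique hA'
    exact ⟨C, hws, C.nonempty_algEquiv_matrix_iff.1 hφ⟩

theorem exhibitMatrixRing_reduces_exhibitPoint (h𝒞 : IsFieldClass E 𝒞) :
    E.ExhibitMatrixRing.Reduces 𝒞 E.ExhibitPoint := by
  obtain ⟨f, hf, hfe⟩ := h𝒞.exists_normForm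
  obtain ⟨g₀, hg₀, hge₀⟩ := h𝒞.exists_splitting
  obtain ⟨g, hg, hgn, hge⟩ := h𝒞.exists_guarded 2 hg₀
  refine ⟨f, g, hf, hg, ?_⟩
  rintro ws ⟨a, b, hp, hws⟩
  have hC : E.Represents (f ws) hp.conic.form.coeffs := hfe ws (a, b) hws
  have hlen : ws.length = 2 := hws.length_eq
  refine ⟨⟨_, hC⟩, ?_⟩
  rintro s ⟨C, hC', hs⟩
  have hform : normForm a b = C.form := TernaryForm.coeffs_injective (hC.unique hC')
  refine ⟨a, b, hws, ?_⟩
  rcases hs with ⟨rfl, hempty⟩ | ⟨v, hv, hvC, hs⟩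
  · refine .inl ⟨hgn _ (by simpa using hlen), not_nonempty_iff.1 fun hφ => ?_⟩
    rw [nonempty_algEquiv_matrix_iff hp, hform, ← Conic.rationalPoints_nonempty_iff, hempty] at hφ
    exact Set.not_nonempty_empty hφ
  · rw [Conic.mk_mem_rationalPoints_iff, ← hform] at hvC
    obtain ⟨φ, hi, hj, hij⟩ := _root_.exists_splitting hp hv hvC
    refine .inr ⟨φ, ?_⟩
    have hone : φ ⟨1, 0, 0, 0⟩ = 1 := map_one φ
    rw [hge _ (by rw [List.length_append, hlen, hs.length_eq]; simp), coefficients_eq, hone, hi, hj,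
      hij]
    exact hge₀ _ ((a, b), v) (hws.append hs)

theorem exhibitPoint_reduces_exhibitMatrixRing (h𝒞 : IsFieldClass E 𝒞) :
    E.ExhibitPoint.Reduces 𝒞 E.ExhibitMatrixRing := by
  obtain ⟨f, hf, hfe⟩ := h𝒞.exists_params
  obtain ⟨g₀, hg₀, hge₀⟩ := h𝒞.exists_point
  obtain ⟨g, hg, hgn, hge⟩ := h𝒞.exists_guarded 6 hg₀
  refine ⟨f, g, hf, hg, ?_⟩
  rintro ws ⟨C, hws⟩
  have hA := hfe ws C.form hws
  have hlen : ws.length = 6 := hws.length_eq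
  obtain ⟨hM, hp, k, hk, hQ⟩ := C.nonsingular.reduction
  refine ⟨⟨_, _, hp, hA⟩, ?_⟩
  rintro s ⟨a, b, hA', hs⟩
  obtain ⟨rfl, rfl⟩ : _ = a ∧ _ = b := by simpa using hA.unique hA'
  refine ⟨C, hws, ?_⟩
  rcases hs with ⟨rfl, hempty⟩ | ⟨φ, hs⟩
  · refine .inl ⟨hgn _ (by simpa using hlen), Set.not_nonempty_iff_eq_empty.1 fun hne => ?_⟩
    exact not_nonempty_iff.2 hempty (C.nonempty_algEquiv_matrix_iff.2 hne)
  · refine .inr ⟨_, TernaryForm.mulVec_ne_zero hM (splittingPoint_ne_zero φ),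
      (Conic.mk_mem_rationalPoints_iff _).2
        ((TernaryForm.eval_mulVec_eq_zero_iff hk hQ _).2 (eval_splittingPoint φ)), ?_⟩
    rw [hge _ (by
      rw [List.length_append, hlen, hs.length_eq, coefficients_eq]; simp [matrixEntries]),
      ← pointOfImages_eq]
    exact hge₀ _ (C.form, ![φ ⟨1, 0, 0, 0⟩, φ ⟨0, 1, 0, 0⟩, φ ⟨0, 0, 1, 0⟩, φ ⟨0, 0, 0, 1⟩])
      (hws.append hs)

theorem equivalent (h𝒞 : IsFieldClass E 𝒞) :
    DecisionProblem.Equivalent 𝒞 E.IsMatrixRing E.HasPoint ∧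
      SearchProblem.Equivalent 𝒞 E.ExhibitMatrixRing E.ExhibitPoint :=
  ⟨⟨h𝒞.isMatrixRing_reduces_hasPoint, h𝒞.hasPoint_reduces_isMatrixRing⟩,
    h𝒞.exhibitMatrixRing_reduces_exhibitPoint, h𝒞.exhibitPoint_reduces_exhibitMatrixRing⟩

end IsFieldClass

end Reductions

theorem mainTheorem5 (F : Type u) [Field F] :
    (∃ Φ : Quotient (quatAlgSetoid F) → Quotient (conicSetoid F),
      Function.Bijective Φ ∧
      ∀ B : QuatAlg F, (∃ C : Conic F, IsNormConic B C) ∧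
        ∀ C : Conic F, IsNormConic B C →
          Φ (Quotient.mk (quatAlgSetoid F) B) = Quotient.mk (conicSetoid F) C) ∧
    (∀ E : ComputableField F,
      DecisionProblem.Equivalent E.PolyTimeWithField E.IsMatrixRing E.HasPoint ∧
      SearchProblem.Equivalent E.PolyTimeWithField E.ExhibitMatrixRing E.ExhibitPoint) ∧
    (∀ E : ComputableField F, E.IsPolyTime →
      DecisionProblem.Equivalent PolyTime E.IsMatrixRing E.HasPoint ∧
      SearchProblem.Equivalent PolyTime E.ExhibitMatrixRing E.ExhibitPoint) := by
  exact ⟨exists_bijective_normConic, fun E => (isFieldClass_polyTimeWithField E).equivalent,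
    fun _ hE => hE.isFieldClass.equivalent⟩
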